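/- Let $m\ge 1$ and let $n\ge 3$ be even. Let $\mathcal A$ be either the algebra of smooth functions on a connected nonempty open subset of $\mathbb R\times\mathbb R^m$ ($K=\mathbb R$), or the algebra of holomorphic functions on a connected nonempty open subset of $\mathbb C\times\mathbb C^m$ ($K=\mathbb C$), or the algebra $K[[x,y_1,\dots,y_m]]$ of formal power series over an arbitrary field $K$ of characteristic zero; the coordinates are $x,y_1,\dots,y_m$, and vector fields have coefficients in $\mathcal A$. Let $u,v\in\mathcal A$ be functions of $x$ alone (that is, all $\partial u/\partial y_j$ and $\partial v/\partial y_j$ vanish) with $uv'-u'v=1$, and consider an isotropic system $$\Delta_j\equiv y_j^{(n)}+A_2\,y_j^{(n-2)}+\dots+A_n\,y_j=0,\qquad j=1,\dots,m,$$ whose coefficients $A_i\in\mathcal A$ are functions of $x$ alone, in the canonical class of the trivial system: it is the transform of $d^n\mathbf w/dz^n=0$ under $dz/dx=u^{-2}$, $\mathbf y=u^{n-1}\mathbf w$ where $u\neq 0$, and under $dz/dx=v^{-2}$, $\mathbf y=v^{n-1}\mathbf w$ where $v\ne0$; that is, $$u^{2n}\Delta_j=\bigl(u^2D_x-(n-1)uu'\bigr)^n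 y_j\quad\text{and}\quad v^{2n}\Delta_j=\bigl(v^2D_x-(n-1)vv'\bigr)^n y_j\qquad (j=1,\dots,m)$$ identically on the jet space, $D_x$ being the total derivative. Let $L_0=\frac12\sum_j y_j\Delta_j$. A divergence symmetry is a Lie point symmetry $\mathbf v=\xi(x,\mathbf y)\,\partial_x+\sum_j\psi_j(x,\mathbf y)\,\partial_{y_j}$ of the system (that is, the $n$-th prolongation $\mathbf v^{(n)}$ satisfies $\mathbf v^{(n)}(\Delta_j)=0$ on $\Delta=0$ for all $j$) such that $$E_j\bigl[\mathbf v^{(n)}(L_0)+L_0\,D_x\xi\bigr]=0\quad (j=1,\dots,m),\qquad E_j=\sum_k(-1)^kD_x^k\,\frac{\partial}{\partial y_j^{(k)}}.$$ Then the divergence symmetries form a Lie algebra $\mathcal S_{div}$ over $K$ of dimension $\frac12\bigl(m^2+m(2n-1)+6\bigr)$, and it is the semidirect sum $$\mathcal S_{div}=\left[\mathfrak g_F\oplus\mathfrak{so}(m)\right]\ltimes\mathfrak g_S .$$ Here $\mathfrak g_F\cong\mathfrak{sl}_2(K)$ is a subalgebra spanned by $F_p=v^2\partial_x+(n-1)vv'\sum_i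 y_i\partial_{y_i}$, $F_m=-u^2\partial_x-(n-1)uu'\sum_i y_i\partial_{y_i}$ and $F_z=2uv\,\partial_x+(n-1)(uv'+u'v)\sum_i y_i\partial_{y_i}$; $\mathfrak{so}(m)$ is a subalgebra isomorphic to the Lie algebra of skew-symmetric $m\times m$ matrices over $K$ and spanned by the rotations $y_i\partial_{y_j}-y_j\partial_{y_i}$; these two subalgebras commute and have zero intersection; and $\mathfrak g_S$ is an abelian ideal, spanned by the fields $u^{n-1-k}v^k\,\partial_{y_j}$ ($0\le k\le n-1$, $1\le j\le m$). If $m\neq2$, this is a Levi decomposition: $\mathfrak g_F\oplus\mathfrak{so}(m)$ is semisimple and $\mathfrak g_S$ is the radical of $\mathcal S_{div}$. -/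

import Mathlib

universe u

open scoped ContDiff

noncomputable section

/-! ### Algebras of functions of the variables `x, y₁, …, y_m` -/

/-- An algebra of functions of one independent variable `x` and `m` dependent variables
`y₁, …, y_m` over the field `K`, with its partial derivatives. The algebras meant are the two
standard ones built below, `smoothFunctions` and `formalFunctions`; see `IsStandard`. -/
structure FunctionAlgebra (K : Type u) [Field K] (m : ℕ) where
  /-- the functions -/
  carrier : Type u
  [commRing : CommRing carrier]
  [algebra : Algebra K carrier]
  [nontrivial : Nontrivial carrier]
  /-- the coordinate function `x` -/
  x : carrier
  /-- the coordinate functions `y_j` -/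
  y : Fin m → carrier
  /-- `∂/∂x` -/
  dx : Derivation K carrier carrier
  /-- `∂/∂y_j` -/
  dy : Fin m → Derivation K carrier carrier
  dx_x : dx x = 1
  dx_y : ∀ j, dx (y j) = 0
  dy_x : ∀ i, dy i x = 0
  dy_y : ∀ i j, dy i (y j) = if i = j then 1 else 0
  dx_dy : ∀ i f, dx (dy i f) = dy i (dx f)
  dy_dy : ∀ i j f, dy i (dy j f) = dy j (dy i f)
  eq_const : ∀ f, dx f = 0 → (∀ i, dy i f = 0) → ∃ c : K, f = algebraMap K carrier c

attribute [instance] FunctionAlgebra.commRing FunctionAlgebra.algebra FunctionAlgebra.nontrivial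

section Smooth

variable {𝕜 : Type u} [RCLike 𝕜] {m : ℕ}

/-- Extension by zero of a function on a subset `M` of `𝕜 × 𝕜ᵐ`. -/
def extendZero {M : Set (𝕜 × (Fin m → 𝕜))} (f : M → 𝕜) : 𝕜 × (Fin m → 𝕜) → 𝕜 :=
  Function.extend Subtype.val f 0

theorem extendZero_apply {M : Set (𝕜 × (Fin m → 𝕜))} (f : M → 𝕜) (p : M) :
    extendZero f p = f p :=
  Subtype.val_injective.extend_apply _ _ _

theorem extendZero_eventuallyEq {M : Set (𝕜 × (Fin m → 𝕜))} (hM : IsOpen M) {f : M → 𝕜}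
    {g : 𝕜 × (Fin m → 𝕜) → 𝕜} (h : ∀ p : M, f p = g p) (p : M) :
    extendZero f =ᶠ[nhds (p : 𝕜 × (Fin m → 𝕜))] g := by
  filter_upwards [hM.mem_nhds p.2] with q hq
  rw [← h ⟨q, hq⟩]
  exact extendZero_apply f ⟨q, hq⟩

theorem contDiffOn_extendZero {M : Set (𝕜 × (Fin m → 𝕜))} {f : M → 𝕜}
    {g : 𝕜 × (Fin m → 𝕜) → 𝕜} (h : ∀ p : M, f p = g p) (hg : ContDiffOn 𝕜 ∞ g M) :
    ContDiffOn 𝕜 ∞ (extendZero f) M := by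
  refine hg.congr fun q hq => ?_
  rw [← h ⟨q, hq⟩]
  exact extendZero_apply f ⟨q, hq⟩

/-- The algebra `C^∞(M)` of the functions on `M` that are smooth over `𝕜`
(holomorphic, if `𝕜 = ℂ`). -/
def smoothSubalgebra (M : Set (𝕜 × (Fin m → 𝕜))) : Subalgebra 𝕜 (M → 𝕜) where
  carrier := {f | ContDiffOn 𝕜 ∞ (extendZero f) M}
  mul_mem' {f g} hf hg := contDiffOn_extendZero
    (g := fun p => extendZero f p * extendZero g p)
    (fun p => by simp [extendZero_apply]) (ContDiffOn.mul hf hg)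
  add_mem' {f g} hf hg := contDiffOn_extendZero
    (g := fun p => extendZero f p + extendZero g p)
    (fun p => by simp [extendZero_apply]) (ContDiffOn.add hf hg)
  algebraMap_mem' c := contDiffOn_extendZero (g := fun _ => c) (fun p => rfl) contDiffOn_const

theorem smooth_contDiffAt {M : Set (𝕜 × (Fin m → 𝕜))} (hM : IsOpen M) (f : smoothSubalgebra M)
    (p : M) : ContDiffAt 𝕜 ∞ (extendZero f.1) p :=
  (show ContDiffOn 𝕜 ∞ (extendZero f.1) M from f.2).contDiffAt (hM.mem_nhds p.2)

theorem smooth_differentiableAt {M : Set (𝕜 × (Fin m → 𝕜))} (hM : IsOpen M)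
    (f : smoothSubalgebra M) (p : M) : DifferentiableAt 𝕜 (extendZero f.1) p :=
  (smooth_contDiffAt hM f p).differentiableAt (by simp)

/-- The derivative in the direction `e` on `C^∞(M)`, for `M` open. -/
def smoothDeriv {M : Set (𝕜 × (Fin m → 𝕜))} (hM : IsOpen M) (e : 𝕜 × (Fin m → 𝕜)) :
    Derivation 𝕜 (smoothSubalgebra M) (smoothSubalgebra M) :=
  Derivation.mk'
    { toFun := fun f => ⟨fun p => fderiv 𝕜 (extendZero f.1) p e,
        contDiffOn_extendZero (g := fun p => fderiv 𝕜 (extendZero f.1) p e) (fun _ => rfl)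
          ((ContDiffOn.fderiv_of_isOpen (m := ∞) f.2 hM (by simp)).clm_apply contDiffOn_const)⟩
      map_add' := fun f g => by
        ext p
        have h := (extendZero_eventuallyEq hM (f := (f + g).1)
          (g := extendZero f.1 + extendZero g.1) (fun p => by simp [extendZero_apply]) p).fderiv_eq
          (𝕜 := 𝕜)
        simp only [h, fderiv_add (smooth_differentiableAt hM f p) (smooth_differentiableAt hM g p)]
        rfl
      map_smul' := fun c f => by
        ext p
        have h := (extendZero_eventuallyEq hM (f := (c • f).1)
          (g := c • extendZero f.1) (fun p => by simp [extendZero_apply]) p).fderiv_eq (𝕜 := 𝕜)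
        simp only [h, fderiv_const_smul (smooth_differentiableAt hM f p)]
        rfl }
    (fun f g => by
      ext p
      have h := (extendZero_eventuallyEq hM (f := (f * g).1)
        (g := extendZero f.1 * extendZero g.1) (fun p => by simp [extendZero_apply]) p).fderiv_eq
        (𝕜 := 𝕜)
      have h2 := fderiv_mul (smooth_differentiableAt hM f p) (smooth_differentiableAt hM g p)
      change fderiv 𝕜 (extendZero (f * g).1) p e = _
      rw [h, h2]
      simp [extendZero_apply])

theorem smoothDeriv_apply {M : Set (𝕜 × (Fin m → 𝕜))} (hM : IsOpen M) (e : 𝕜 × (Fin m → 𝕜))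
    (f : smoothSubalgebra M) (p : M) :
    (smoothDeriv hM e f).1 p = fderiv 𝕜 (extendZero f.1) p e := rfl

theorem smoothDeriv_comm {M : Set (𝕜 × (Fin m → 𝕜))} (hM : IsOpen M) (e e' : 𝕜 × (Fin m → 𝕜))
    (f : smoothSubalgebra M) :
    smoothDeriv hM e (smoothDeriv hM e' f) = smoothDeriv hM e' (smoothDeriv hM e f) := by
  have key : ∀ (a b : 𝕜 × (Fin m → 𝕜)) (p : M), (smoothDeriv hM a (smoothDeriv hM b f)).1 p
      = fderiv 𝕜 (fderiv 𝕜 (extendZero f.1)) p a b := by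
    intro a b p
    rw [smoothDeriv_apply, (extendZero_eventuallyEq hM (f := (smoothDeriv hM b f).1)
      (g := fun q => fderiv 𝕜 (extendZero f.1) q b) (fun _ => rfl) p).fderiv_eq]
    have hd : DifferentiableAt 𝕜 (fderiv 𝕜 (extendZero f.1)) (p : 𝕜 × (Fin m → 𝕜)) :=
      ((smooth_contDiffAt hM f p).fderiv_right (m := ∞) (by simp)).differentiableAt (by simp)
    rw [fderiv_clm_apply hd (differentiableAt_const b)]
    simp
  ext p
  rw [key, key]
  exact ((smooth_contDiffAt hM f p).isSymmSndFDerivAt (by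
    rw [minSmoothness_of_isRCLikeNormedField]
    exact WithTop.coe_le_coe.2 (le_top : (2 : ℕ∞) ≤ ⊤))) e e'

/-- A smooth function on the whole space, as an element of `C^∞(M)`. -/
def smoothRestrict (M : Set (𝕜 × (Fin m → 𝕜))) (g : 𝕜 × (Fin m → 𝕜) → 𝕜)
    (hg : ContDiff 𝕜 ∞ g) : smoothSubalgebra M :=
  ⟨fun p => g p, contDiffOn_extendZero (g := g) (fun _ => rfl) hg.contDiffOn⟩

theorem smoothDeriv_restrict {M : Set (𝕜 × (Fin m → 𝕜))} (hM : IsOpen M)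
    (e : 𝕜 × (Fin m → 𝕜)) (g : (𝕜 × (Fin m → 𝕜)) →L[𝕜] 𝕜) :
    smoothDeriv hM e (smoothRestrict M g g.contDiff) = algebraMap 𝕜 _ (g e) := by
  ext p
  rw [smoothDeriv_apply, (extendZero_eventuallyEq hM (f := (smoothRestrict M g g.contDiff).1)
      (g := g) (fun _ => rfl) p).fderiv_eq]
  simp

/-- The algebra `C^∞(M)` of the smooth functions (the holomorphic ones, if `𝕜 = ℂ`) on a connected
nonempty open subset `M` of the space `𝕜 × 𝕜ᵐ` with coordinates `x, y₁, …, y_m`. -/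
def smoothFunctions (M : Set (𝕜 × (Fin m → 𝕜))) (hM : IsOpen M) (hM' : IsConnected M) :
    FunctionAlgebra 𝕜 m where
  carrier := smoothSubalgebra M
  nontrivial := by
    obtain ⟨p, hp⟩ := hM'.nonempty
    refine ⟨0, 1, fun h => ?_⟩
    have := congrArg (fun f : smoothSubalgebra M => f.1 ⟨p, hp⟩) h
    simp at this
  x := smoothRestrict M (ContinuousLinearMap.fst 𝕜 𝕜 (Fin m → 𝕜)) (ContinuousLinearMap.contDiff _)
  y := fun j => smoothRestrict M
    ((ContinuousLinearMap.proj j).comp (ContinuousLinearMap.snd 𝕜 𝕜 (Fin m → 𝕜)))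
    (ContinuousLinearMap.contDiff _)
  dx := smoothDeriv hM (1, 0)
  dy := fun j => smoothDeriv hM (0, Pi.single j 1)
  dx_x := by rw [smoothDeriv_restrict]; simp
  dx_y := fun j => by rw [smoothDeriv_restrict]; simp
  dy_x := fun i => by rw [smoothDeriv_restrict]; simp
  dy_y := fun i j => by
    rw [smoothDeriv_restrict]
    by_cases h : i = j
    · simp [h]
    · simp [h, Ne.symm h]
  dx_dy := fun i f => smoothDeriv_comm hM _ _ f
  dy_dy := fun i j f => smoothDeriv_comm hM _ _ f
  eq_const := fun f hx hy => by
    have hd : Set.EqOn (fderiv 𝕜 (extendZero f.1)) 0 M := by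
      intro p hp
      have h1 : fderiv 𝕜 (extendZero f.1) p (1, 0) = 0 :=
        congrArg (fun g : smoothSubalgebra M => g.1 ⟨p, hp⟩) hx
      have h2 : ∀ j, fderiv 𝕜 (extendZero f.1) p (0, Pi.single j 1) = 0 := fun j =>
        congrArg (fun g : smoothSubalgebra M => g.1 ⟨p, hp⟩) (hy j)
      refine ContinuousLinearMap.ext fun w => ?_
      have hw : w = w.1 • ((1 : 𝕜), (0 : Fin m → 𝕜))
          + ∑ j, w.2 j • ((0 : 𝕜), (Pi.single j 1 : Fin m → 𝕜)) := by
        refine Prod.ext (by simp [Prod.fst_sum]) ?_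
        funext i
        simp [Prod.snd_sum, Finset.sum_apply, Pi.single_apply]
      rw [hw]
      simp only [map_add, map_smul, map_sum, h1, h2]
      simp
    obtain ⟨c, hc⟩ := hM.exists_is_const_of_fderiv_eq_zero hM'.isPreconnected
      (ContDiffOn.differentiableOn f.2 (by simp)) hd
    refine ⟨c, ?_⟩
    ext p
    rw [← extendZero_apply f.1 p]
    exact hc p.1 p.2

end Smooth

/-- The algebra `K⟦x, y₁, …, y_m⟧` of formal power series; `x` is the variable `none` and `y_j` is
the variable `some j`. -/
def formalFunctions (K : Type u) [Field K] [CharZero K] (m : ℕ) : FunctionAlgebra K m where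
  carrier := MvPowerSeries (Option (Fin m)) K
  x := MvPowerSeries.X none
  y := fun j => MvPowerSeries.X (some j)
  dx := MvPowerSeries.pderiv K none
  dy := fun j => MvPowerSeries.pderiv K (some j)
  dx_x := by simp
  dx_y := fun j => by simp
  dy_x := fun j => by simp
  dy_y := fun i j => by simp [MvPowerSeries.pderiv_X, Pi.single_apply, eq_comm]
  dx_dy := fun i f => by
    ext d
    simp only [MvPowerSeries.coeff_pderiv, add_right_comm d]
    simp
    ring
  dy_dy := fun i j f => by
    ext d
    by_cases h : i = j
    · rw [h]
    · simp only [MvPowerSeries.coeff_pderiv, add_right_comm d]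
      simp [h, Ne.symm h]
      ring
  eq_const := fun f hx hy => by
    refine ⟨MvPowerSeries.constantCoeff f, ?_⟩
    refine MvPowerSeries.pderiv.ext (fun i => ?_) (by simp [MvPowerSeries.algebraMap_apply])
    cases i with
    | none => simp [MvPowerSeries.algebraMap_apply, hx]
    | some j => simp [MvPowerSeries.algebraMap_apply, hy j]

/-- The function algebras considered: the smooth functions on a connected nonempty open subset of
`ℝ × ℝᵐ`, the holomorphic functions on a connected nonempty open subset of `ℂ × ℂᵐ`, and, over an
arbitrary field of characteristic zero, the formal power series. -/
inductive FunctionAlgebra.IsStandard {m : ℕ} :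
    ∀ {K : Type u} [Field K], FunctionAlgebra K m → Prop
  | smooth {𝕜 : Type u} [RCLike 𝕜] (M : Set (𝕜 × (Fin m → 𝕜))) (hM : IsOpen M)
      (hM' : IsConnected M) : IsStandard (smoothFunctions M hM hM')
  | formal (K : Type u) [Field K] [CharZero K] : IsStandard (formalFunctions K m)

namespace FunctionAlgebra

variable {K : Type u} [Field K] {m : ℕ} (𝒜 : FunctionAlgebra K m)

/-- `f` is a function of `x` alone. -/
def DependsOnX (f : 𝒜.carrier) : Prop := ∀ j, 𝒜.dy j f = 0

/-! ### Differential functions -/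

/-- Functions on the jet space that are polynomial in the derivatives `y_j^{(k)}`, `k ≥ 1`, with
arbitrary functions of `x, y₁, …, y_m` as coefficients. The variable `(k, j)` is
`y_j^{(k+1)}`. -/
abbrev Jet : Type u := MvPolynomial (ℕ × Fin m) 𝒜.carrier

/-- The jet coordinate `y_j^{(k)}`. -/
def jet (k : ℕ) (j : Fin m) : 𝒜.Jet :=
  match k with
  | 0 => MvPolynomial.C (𝒜.y j)
  | k + 1 => MvPolynomial.X (k, j)

/-- A derivation applied to the coefficients of a differential function; for `∂/∂x` and `∂/∂y_j`
this is the partial derivative on the jet space. -/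
def onCoeffs (d : Derivation K 𝒜.carrier 𝒜.carrier) (P : 𝒜.Jet) : 𝒜.Jet :=
  ∑ s ∈ P.support, MvPolynomial.monomial s (d (P.coeff s))

/-- The vector field `a ∂/∂x + ∑ b k j ∂/∂y_j^{(k)}` on the jet space. -/
def jetField (a : 𝒜.Jet) (b : ℕ → Fin m → 𝒜.Jet) (P : 𝒜.Jet) : 𝒜.Jet :=
  a * 𝒜.onCoeffs 𝒜.dx P + ∑ j, b 0 j * 𝒜.onCoeffs (𝒜.dy j) P
    + MvPolynomial.mkDerivation 𝒜.carrier (fun p : ℕ × Fin m => b (p.1 + 1) p.2) P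

/-- The total derivative `D_x = ∂/∂x + ∑ y_j^{(k+1)} ∂/∂y_j^{(k)}`. -/
def totalDeriv : 𝒜.Jet → 𝒜.Jet := 𝒜.jetField 1 fun k j => 𝒜.jet (k + 1) j

/-- The partial derivative `∂/∂y_j^{(k)}`. -/
def partialJet (k : ℕ) (j : Fin m) (P : 𝒜.Jet) : 𝒜.Jet :=
  match k with
  | 0 => 𝒜.onCoeffs (𝒜.dy j) P
  | k + 1 => MvPolynomial.pderiv (k, j) P

/-- The Euler operator `E_j = ∑ₖ (-1)ᵏ D_xᵏ ∂/∂y_j^{(k)}` (only finitely many terms are nonzero). -/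
def euler (j : Fin m) (L : 𝒜.Jet) : 𝒜.Jet :=
  ∑ᶠ k : ℕ, (-1) ^ k * 𝒜.totalDeriv^[k] (𝒜.partialJet k j L)

/-! ### Vector fields and their prolongation -/

/-- `v` is a vector field `ξ ∂/∂x + ∑ ψ_j ∂/∂y_j`; then `ξ = v x` and `ψ_j = v y_j`. -/
def IsVectorField (v : Derivation K 𝒜.carrier 𝒜.carrier) : Prop :=
  v = v 𝒜.x • 𝒜.dx + ∑ j, v (𝒜.y j) • 𝒜.dy j

/-- The coefficient `ψ_j^k` of `∂/∂y_j^{(k)}` in the prolongation of `v`: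
`ψ_j^0 = ψ_j` and `ψ_j^{k+1} = D_x ψ_j^k - y_j^{(k+1)} D_x ξ`. -/
def prolongCoeff (v : Derivation K 𝒜.carrier 𝒜.carrier) : ℕ → Fin m → 𝒜.Jet
  | 0, j => MvPolynomial.C (v (𝒜.y j))
  | k + 1, j => 𝒜.totalDeriv (prolongCoeff v k j)
      - 𝒜.jet (k + 1) j * 𝒜.totalDeriv (MvPolynomial.C (v 𝒜.x))

/-- The prolongation of the vector field `v` to the jet space; on differential functions of order
at most `n` it is the `n`-th prolongation `v^{(n)}`. -/
def prolong (v : Derivation K 𝒜.carrier 𝒜.carrier) : 𝒜.Jet → 𝒜.Jet :=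
  𝒜.jetField (MvPolynomial.C (v 𝒜.x)) (𝒜.prolongCoeff v)

/-! ### Linear systems in a canonical class -/

/-- The left-hand side `Δ_j = y_j^{(n)} + A₂ y_j^{(n-2)} + ⋯ + A_n y_j` of an isotropic linear
system in normal form. -/
def isotropicLHS (n : ℕ) (A : ℕ → 𝒜.carrier) (j : Fin m) : 𝒜.Jet :=
  𝒜.jet n j + ∑ i ∈ Finset.Icc 2 n, MvPolynomial.C (A i) * 𝒜.jet (n - i) j

/-- The operator `u² D_x - (n-1) u u'`, which is `u^{n-1} ∘ (u² D_x) ∘ u^{1-n}` where `u ≠ 0`. -/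
def transOp (n : ℕ) (u : 𝒜.carrier) (P : 𝒜.Jet) : 𝒜.Jet :=
  MvPolynomial.C (u ^ 2) * 𝒜.totalDeriv P - MvPolynomial.C (((n : 𝒜.carrier) - 1) * u * 𝒜.dx u) * P

/-- Where `u ≠ 0`, the system `Δ = 0` is the transform of the trivial system `d^n w / dz^n = 0`
under the point transformation `dz/dx = u^{-2}`, `y = u^{n-1} w`: since `d/dz = u² D_x`, this means
`u^{n-1} d^n w / dz^n = (u² D_x - (n-1) u u')^n y` and `d^n w / dz^n = u^{n+1} Δ`. -/
def IsTransformOfTrivial (n : ℕ) (A : ℕ → 𝒜.carrier) (u : 𝒜.carrier) : Prop :=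
  ∀ j, MvPolynomial.C (u ^ (2 * n)) * 𝒜.isotropicLHS n A j
    = (𝒜.transOp n u)^[n] (𝒜.jet 0 j)

/-- A system `y^{(n)} + A₂ y^{(n-2)} + ⋯ + A_n y = 0` in the canonical class of `y^{(n)} = 0`,
with two solutions `u, v` of its second-order source equation, of Wronskian one (the source
equation is `y'' + q y = 0` with `q = u' v'' - u'' v'`). It is the transform of the trivial system
under `z = v/u = ∫ u⁻² dx`, `y = u^{n-1} w` where `u ≠ 0`, and under `z = -u/v = ∫ v⁻² dx`,
`y = v^{n-1} w` where `v ≠ 0`; at every point one of the two is nonzero. -/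
structure CanonicalSystem (n : ℕ) where
  /-- the coefficients `A₂, …, A_n` -/
  A : ℕ → 𝒜.carrier
  /-- the solution `u` of the source equation -/
  u : 𝒜.carrier
  /-- the solution `v` of the source equation -/
  v : 𝒜.carrier
  A_dependsOnX : ∀ i ∈ Finset.Icc 2 n, 𝒜.DependsOnX (A i)
  u_dependsOnX : 𝒜.DependsOnX u
  v_dependsOnX : 𝒜.DependsOnX v
  wronskian : u * 𝒜.dx v - 𝒜.dx u * v = 1
  transform_u : 𝒜.IsTransformOfTrivial n A u
  transform_v : 𝒜.IsTransformOfTrivial n A v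

namespace CanonicalSystem

variable {𝒜} {n : ℕ} (𝓔 : 𝒜.CanonicalSystem n)

/-- The left-hand sides `Δ_j` of the system. -/
def lhs (j : Fin m) : 𝒜.Jet := 𝒜.isotropicLHS n 𝓔.A j

/-- Restriction of a differential function of order at most `n` to the solution manifold `Δ = 0`
in the jet space: `y_j^{(n)}` is replaced by `-(A₂ y_j^{(n-2)} + ⋯ + A_n y_j)`. -/
def onSolutions (P : 𝒜.Jet) : 𝒜.Jet :=
  MvPolynomial.aeval (fun p : ℕ × Fin m =>
    if p.1 + 1 = n then -∑ i ∈ Finset.Icc 2 n, MvPolynomial.C (𝓔.A i) * 𝒜.jet (n - i) p.2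
    else 𝒜.jet (p.1 + 1) p.2) P

/-- `v` is a Lie point symmetry (infinitesimal generator of the symmetry group) of the system:
`v^{(n)}(Δ_j) = 0` on `Δ = 0` for all `j`. -/
def IsPointSymmetry (v : Derivation K 𝒜.carrier 𝒜.carrier) : Prop :=
  𝒜.IsVectorField v ∧ ∀ j, 𝓔.onSolutions (𝒜.prolong v (𝓔.lhs j)) = 0

/-- The standard Lagrangian `L₀ = ½ y · Δ`. -/
def lagrangian : 𝒜.Jet := (1 / 2 : K) • ∑ j, 𝒜.jet 0 j * 𝓔.lhs j

/-- `𝒮(v) = v^{(n)}(L₀) + L₀ D_x ξ`. -/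
def lagrangianVariation (v : Derivation K 𝒜.carrier 𝒜.carrier) : 𝒜.Jet :=
  𝒜.prolong v 𝓔.lagrangian + 𝓔.lagrangian * 𝒜.totalDeriv (MvPolynomial.C (v 𝒜.x))

/-- `v` is a divergence symmetry: a Lie point symmetry of the system with `E_j(𝒮(v)) = 0` for
all `j`. -/
def IsDivergenceSymmetry (v : Derivation K 𝒜.carrier 𝒜.carrier) : Prop :=
  𝓔.IsPointSymmetry v ∧ ∀ j, 𝒜.euler j (𝓔.lagrangianVariation v) = 0

/-- `F_p = v² ∂/∂x + (n-1) v v' ∑ y_i ∂/∂y_i`. -/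
def Fp : Derivation K 𝒜.carrier 𝒜.carrier :=
  𝓔.v ^ 2 • 𝒜.dx + (((n : 𝒜.carrier) - 1) * (𝓔.v * 𝒜.dx 𝓔.v)) • ∑ i, 𝒜.y i • 𝒜.dy i

/-- `F_m = -u² ∂/∂x - (n-1) u u' ∑ y_i ∂/∂y_i`. -/
def Fm : Derivation K 𝒜.carrier 𝒜.carrier :=
  -(𝓔.u ^ 2 • 𝒜.dx) - (((n : 𝒜.carrier) - 1) * (𝓔.u * 𝒜.dx 𝓔.u)) • ∑ i, 𝒜.y i • 𝒜.dy i

/-- `F_z = 2 u v ∂/∂x + (n-1) (u v' + u' v) ∑ y_i ∂/∂y_i`. -/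
def Fz : Derivation K 𝒜.carrier 𝒜.carrier :=
  (2 * 𝓔.u * 𝓔.v) • 𝒜.dx
    + (((n : 𝒜.carrier) - 1) * (𝓔.u * 𝒜.dx 𝓔.v + 𝒜.dx 𝓔.u * 𝓔.v)) • ∑ i, 𝒜.y i • 𝒜.dy i

/-- `S_{kj} = s_k ∂/∂y_j` with `s_k = u^{n-1-k} v^k`, for `k = 0, …, n - 1`. -/
def Skj (k : Fin n) (j : Fin m) : Derivation K 𝒜.carrier 𝒜.carrier :=
  (𝓔.u ^ (n - 1 - (k : ℕ)) * 𝓔.v ^ (k : ℕ)) • 𝒜.dy j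

end CanonicalSystem

/-- The rotation `R_{ij} = y_i ∂/∂y_j - y_j ∂/∂y_i`. -/
def rotation (i j : Fin m) : Derivation K 𝒜.carrier 𝒜.carrier :=
  𝒜.y i • 𝒜.dy j - 𝒜.y j • 𝒜.dy i

end FunctionAlgebra

end

/-!
The theorem is a determination of the divergence symmetries followed by a computation with the Lie
algebra found.

**Binary forms.** With `q = u' v'' - u'' v'`, both `u` and `v` solve `y'' + q y = 0`. Let `s` be the
pair of these solutions and `F` a symmetric `d`-linear form with constant coefficients; the suitably
normalized values `p_i` of `F` at `d - i` arguments `s` and `i` arguments `s'` satisfy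
`D p_i = p_{i+1} - i (d - i + 1) q p_{i-1}`. A sequence with this property, over any differential
ring, is called a form of degree `d` (`IsForm`); it is determined by `p_0`, and `p_{d+1} = 0` is a
linear equation of order `d + 1` for `p_0`, the symmetric power of the source equation. An operator
`s² D - (n-1) s s'` with `s'' = -q s` iterates well on forms of degree `d = n - 1`: its `n`-th power
maps `p_0` to `s^{2n} p_n` (`IsForm.iterate_eq`). Taking `s = u` and `s = v`, the hypotheses on the
system say that `Δ_j` and `p_n`, for the form with `p_0 = y_j`, agree up to the factors `u^{2n}` and
`v^{2n}`; these are coprime since `u v' - u' v = 1`, so `Δ_j = p_n` (`CanonicalSystem.lhs_eq`).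

**Point symmetries.** The coefficients of `y_i^{(n-1)}` in the symmetry condition force `ξ` to
depend on `x` alone and `ψ_j` to be affine in the `y_i`, so that a symmetry is the sum of a
projective field `ξ ∂/∂x + ½ (n-1) ξ' ∑ y_j ∂/∂y_j`, a linear field `∑ c_{ij} y_i ∂/∂y_j` and a
translation `∑ b_j(x) ∂/∂y_j` (`IsPointSymmetry.exists_eq`). The prolongation of a linear field maps
the `Δ_j` to linear combinations of them and that of a translation maps `Δ_j` to the value of the
scalar operator at `b_j`. A projective field carries the form of `y_j` along up to a defect, which
is driven by `½ ξ''' + 2 q ξ' + q' ξ` (`IsForm.reparamDefect_add_two`). Comparing the coefficients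
of `y_j^{(n-2)}`, where a positive sum appears (`partialD_defect`), gives
`½ ξ''' + 2 q ξ' + q' ξ = 0`, and then each `b_j` solves the scalar equation
(`IsPointSymmetry.symSquare_eq_zero`).

**The variational condition.** Under the variation of `L₀`, projective fields give zero. A
translation gives `½ ∑ b_j Δ_j`, which is a total derivative because of the invariant pairing of
forms of degree `n - 1` (`IsForm.sum_mul`); a linear field gives `½ ∑ (c_{ij} + c_{ji}) y_i Δ_j`. As
`n` is even, the coefficient of `y_i^{(n)}` in the `l`-th Euler expression of the latter is a
nonzero multiple of `c_{il} + c_{li}`, so exactly the rotations remain (`linearField_mem_iff`).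

**Solution spaces.** The forms of degree `d` in functions of `x` alone with `p_{d+1} = 0` are those
whose `p_0` is a polynomial in `u`, `v`, homogeneous of degree `d` with constant coefficients:
polarization along `u` and `v` lowers the degree (`mem_span_of_isForm`). The monomials are
independent by Euler's identity and its derivative (`eq_zero_of_sum_eq_zero`). With `d = 2` and
`d = n - 1` this parametrizes the `ξ` by `sl₂` and the `b_j` by `n` constants each.

**The Lie algebra.** The brackets of the three kinds of fields give the semidirect sum and its
dimension. For `m ≠ 2`, neither `sl₂` nor `so(m)` has a nonzero abelian ideal
(`LieAlgebra.Orthogonal.hasTrivialRadical`), so the Levi factor has trivial radical. Hence it is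
semisimple by Cartan's criterion, and its complement, an abelian ideal, is the radical
(`LieAlgebra.radical_eq_of_isCompl_range`).
-/

noncomputable section

theorem derivation_sum_apply {K A ι : Type*} [CommRing K] [CommRing A] [Algebra K A]
    (s : Finset ι) (d : ι → Derivation K A A) (f : A) : (∑ i ∈ s, d i) f = ∑ i ∈ s, d i f := by
  classical
  induction s using Finset.induction_on with
  | empty => simp
  | insert a s ha ih => rw [Finset.sum_insert ha, Finset.sum_insert ha, Derivation.add_apply, ih]

namespace FunctionAlgebra

variable {K : Type u} [Field K] {m : ℕ} (𝒜 : FunctionAlgebra K m)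

/-! ### Derivations of the jet algebra -/

theorem coeff_onCoeffs (d : Derivation K 𝒜.carrier 𝒜.carrier) (P : 𝒜.Jet)
    (s : (ℕ × Fin m) →₀ ℕ) : (𝒜.onCoeffs d P).coeff s = d (P.coeff s) := by
  classical
  simp only [onCoeffs, MvPolynomial.coeff_sum, MvPolynomial.coeff_monomial]
  rw [Finset.sum_ite_eq' P.support s]
  split_ifs with h
  · rfl
  · rw [MvPolynomial.notMem_support_iff.1 h, map_zero]

/-- `onCoeffs d` as a derivation of the jet algebra over `K`. -/
def onCoeffsD (d : Derivation K 𝒜.carrier 𝒜.carrier) : Derivation K 𝒜.Jet 𝒜.Jet :=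
  Derivation.mk'
    { toFun := 𝒜.onCoeffs d
      map_add' := fun P Q => by ext s; simp [coeff_onCoeffs]
      map_smul' := fun c P => by ext s; simp [coeff_onCoeffs] }
    (fun P Q => by
      ext s
      simp only [LinearMap.coe_mk, AddHom.coe_mk, coeff_onCoeffs, smul_eq_mul,
        MvPolynomial.coeff_add]
      rw [mul_comm Q]
      simp only [MvPolynomial.coeff_mul, coeff_onCoeffs, map_sum, Derivation.leibniz,
        smul_eq_mul, Finset.sum_add_distrib]
      congr 1
      exact Finset.sum_congr rfl fun x _ => mul_comm _ _)

theorem onCoeffsD_apply (d : Derivation K 𝒜.carrier 𝒜.carrier) (P : 𝒜.Jet) :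
    𝒜.onCoeffsD d P = 𝒜.onCoeffs d P := rfl

@[simp] theorem onCoeffsD_C (d : Derivation K 𝒜.carrier 𝒜.carrier) (f : 𝒜.carrier) :
    𝒜.onCoeffsD d (MvPolynomial.C f) = MvPolynomial.C (d f) := by
  classical
  ext s
  simp only [onCoeffsD_apply, coeff_onCoeffs, MvPolynomial.coeff_C]
  split_ifs <;> simp

@[simp] theorem onCoeffsD_X (d : Derivation K 𝒜.carrier 𝒜.carrier) (p : ℕ × Fin m) :
    𝒜.onCoeffsD d (MvPolynomial.X p) = 0 := by
  classical
  ext s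
  simp only [onCoeffsD_apply, coeff_onCoeffs, MvPolynomial.coeff_X]
  split_ifs <;> simp

/-- `jetField a b` as a derivation of the jet algebra over `K`. -/
def jetFieldD (a : 𝒜.Jet) (b : ℕ → Fin m → 𝒜.Jet) : Derivation K 𝒜.Jet 𝒜.Jet :=
  a • 𝒜.onCoeffsD 𝒜.dx + ∑ j, b 0 j • 𝒜.onCoeffsD (𝒜.dy j)
    + (MvPolynomial.mkDerivation 𝒜.carrier
        (fun p : ℕ × Fin m => b (p.1 + 1) p.2)).restrictScalars K

theorem coe_jetFieldD (a : 𝒜.Jet) (b : ℕ → Fin m → 𝒜.Jet) :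
    ⇑(𝒜.jetFieldD a b) = 𝒜.jetField a b := by
  funext P
  simp [jetFieldD, jetField, onCoeffsD_apply, derivation_sum_apply]

theorem jetFieldD_C (a : 𝒜.Jet) (b : ℕ → Fin m → 𝒜.Jet) (f : 𝒜.carrier) :
    𝒜.jetFieldD a b (MvPolynomial.C f) = a * MvPolynomial.C (𝒜.dx f)
      + ∑ j, b 0 j * MvPolynomial.C (𝒜.dy j f) := by
  simp [jetFieldD, derivation_sum_apply]

theorem jetFieldD_jet (a : 𝒜.Jet) (b : ℕ → Fin m → 𝒜.Jet) (k : ℕ) (j : Fin m) :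
    𝒜.jetFieldD a b (𝒜.jet k j) = b k j := by
  cases k with
  | zero => simp [jet, jetFieldD_C, 𝒜.dx_y, 𝒜.dy_y]
  | succ k => simp [jet, jetFieldD, derivation_sum_apply]

/-- A derivation of the jet algebra is determined by its values on the functions and on the jet
coordinates. -/
theorem jetDerivation_ext {D₁ D₂ : Derivation K 𝒜.Jet 𝒜.Jet}
    (hC : ∀ f, D₁ (MvPolynomial.C f) = D₂ (MvPolynomial.C f))
    (hX : ∀ k j, D₁ (𝒜.jet (k + 1) j) = D₂ (𝒜.jet (k + 1) j)) : D₁ = D₂ := by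
  refine Derivation.ext fun P => ?_
  induction P using MvPolynomial.induction_on with
  | C f => exact hC f
  | add P Q hP hQ => rw [map_add, map_add, hP, hQ]
  | mul_X P p hP =>
    have h : D₁ (MvPolynomial.X p) = D₂ (MvPolynomial.X p) := hX p.1 p.2
    rw [Derivation.leibniz, Derivation.leibniz, hP, h]

/-- The total derivative as a derivation of the jet algebra. -/
def totalD : Derivation K 𝒜.Jet 𝒜.Jet := 𝒜.jetFieldD 1 fun k j => 𝒜.jet (k + 1) j

theorem coe_totalD : ⇑𝒜.totalD = 𝒜.totalDeriv := 𝒜.coe_jetFieldD _ _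

theorem totalD_C (f : 𝒜.carrier) : 𝒜.totalD (MvPolynomial.C f) = MvPolynomial.C (𝒜.dx f)
    + ∑ j, 𝒜.jet 1 j * MvPolynomial.C (𝒜.dy j f) := by
  rw [totalD, jetFieldD_C, one_mul]

theorem totalD_C_of_dependsOnX {f : 𝒜.carrier} (hf : 𝒜.DependsOnX f) :
    𝒜.totalD (MvPolynomial.C f) = MvPolynomial.C (𝒜.dx f) := by
  have h : ∀ j, 𝒜.dy j f = 0 := hf
  simp [totalD_C, h]

@[simp] theorem totalD_jet (k : ℕ) (j : Fin m) : 𝒜.totalD (𝒜.jet k j) = 𝒜.jet (k + 1) j :=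
  𝒜.jetFieldD_jet _ _ _ _

/-- The partial derivative `∂/∂y_j^{(k)}` as a derivation of the jet algebra. -/
def partialD (k : ℕ) (j : Fin m) : Derivation K 𝒜.Jet 𝒜.Jet :=
  𝒜.jetFieldD 0 fun l i => if l = k ∧ i = j then 1 else 0

theorem partialD_jet (k : ℕ) (j : Fin m) (l : ℕ) (i : Fin m) :
    𝒜.partialD k j (𝒜.jet l i) = if l = k ∧ i = j then 1 else 0 := 𝒜.jetFieldD_jet _ _ _ _

theorem partialD_zero_C (j : Fin m) (f : 𝒜.carrier) :
    𝒜.partialD 0 j (MvPolynomial.C f) = MvPolynomial.C (𝒜.dy j f) := by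
  simp [partialD, jetFieldD_C]

@[simp] theorem partialD_succ_C (k : ℕ) (j : Fin m) (f : 𝒜.carrier) :
    𝒜.partialD (k + 1) j (MvPolynomial.C f) = 0 := by
  simp [partialD, jetFieldD_C]

theorem partialD_C_of_dependsOnX (k : ℕ) (j : Fin m) {f : 𝒜.carrier} (hf : 𝒜.DependsOnX f) :
    𝒜.partialD k j (MvPolynomial.C f) = 0 := by
  cases k with
  | zero => rw [partialD_zero_C, hf j, map_zero]
  | succ k => simp

theorem partialD_apply (k : ℕ) (j : Fin m) (P : 𝒜.Jet) :
    𝒜.partialD k j P = 𝒜.partialJet k j P := by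
  cases k with
  | zero =>
    have h : 𝒜.partialD 0 j = 𝒜.onCoeffsD (𝒜.dy j) :=
      𝒜.jetDerivation_ext (fun f => by rw [partialD_zero_C, onCoeffsD_C]) fun k i => by
        rw [partialD_jet, jet, onCoeffsD_X, if_neg (by simp)]
    rw [h]; rfl
  | succ k =>
    have h : 𝒜.partialD (k + 1) j =
        (MvPolynomial.pderiv (R := 𝒜.carrier) (k, j)).restrictScalars K :=
      𝒜.jetDerivation_ext (fun f => by simp) fun l i => by
        rw [partialD_jet]
        simp only [jet, Derivation.restrictScalars_apply, MvPolynomial.pderiv_X, Pi.single_apply,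
          Prod.mk.injEq, Nat.succ_inj]
    rw [h]; rfl

theorem dx_dependsOnX {f : 𝒜.carrier} (hf : 𝒜.DependsOnX f) : 𝒜.DependsOnX (𝒜.dx f) :=
  fun j => by rw [← 𝒜.dx_dy, hf j, map_zero]

theorem partialD_zero_totalD (j : Fin m) (P : 𝒜.Jet) :
    𝒜.partialD 0 j (𝒜.totalD P) = 𝒜.totalD (𝒜.partialD 0 j P) := by
  have h : ⁅𝒜.partialD 0 j, 𝒜.totalD⁆ = 0 := 𝒜.jetDerivation_ext (fun f => by
      simp only [Derivation.commutator_apply, partialD_zero_C, totalD_C, map_add, map_sum,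
        Derivation.leibniz, smul_eq_mul, partialD_jet]
      simp [𝒜.dx_dy, 𝒜.dy_dy j])
    fun k i => by simp [Derivation.commutator_apply, partialD_jet]
  have h' := congrArg (fun d => d P) h
  simpa [Derivation.commutator_apply, sub_eq_zero] using h'

theorem partialD_succ_totalD (k : ℕ) (j : Fin m) (P : 𝒜.Jet) :
    𝒜.partialD (k + 1) j (𝒜.totalD P) = 𝒜.totalD (𝒜.partialD (k + 1) j P)
      + 𝒜.partialD k j P := by
  have h : ⁅𝒜.partialD (k + 1) j, 𝒜.totalD⁆ = 𝒜.partialD k j :=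
    𝒜.jetDerivation_ext (fun f => by
      simp only [Derivation.commutator_apply, totalD_C, map_add, map_sum,
        Derivation.leibniz, smul_eq_mul, partialD_jet, partialD_succ_C]
      cases k with
      | zero => simp [partialD_zero_C]
      | succ k => simp)
    fun l i => by
      simp only [Derivation.commutator_apply, partialD_jet, totalD_jet, Nat.succ_inj]
      split_ifs <;> simp
  have h' := congrArg (fun d => d P) h
  rw [← h']
  simp [Derivation.commutator_apply]

/-- The prolongation of a vector field as a derivation of the jet algebra. -/
def prolongD (v : Derivation K 𝒜.carrier 𝒜.carrier) : Derivation K 𝒜.Jet 𝒜.Jet :=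
  𝒜.jetFieldD (MvPolynomial.C (v 𝒜.x)) (𝒜.prolongCoeff v)

theorem coe_prolongD (v : Derivation K 𝒜.carrier 𝒜.carrier) : ⇑(𝒜.prolongD v) = 𝒜.prolong v :=
  𝒜.coe_jetFieldD _ _

theorem prolongD_jet (v : Derivation K 𝒜.carrier 𝒜.carrier) (k : ℕ) (j : Fin m) :
    𝒜.prolongD v (𝒜.jet k j) = 𝒜.prolongCoeff v k j := 𝒜.jetFieldD_jet _ _ _ _

theorem prolongCoeff_succ (v : Derivation K 𝒜.carrier 𝒜.carrier) (k : ℕ) (j : Fin m) :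
    𝒜.prolongCoeff v (k + 1) j = 𝒜.totalD (𝒜.prolongCoeff v k j)
      - 𝒜.jet (k + 1) j * 𝒜.totalD (MvPolynomial.C (v 𝒜.x)) := by
  rw [coe_totalD]; rfl

variable {𝒜}

theorem IsVectorField.apply {v : Derivation K 𝒜.carrier 𝒜.carrier} (hv : 𝒜.IsVectorField v)
    (f : 𝒜.carrier) : v f = v 𝒜.x * 𝒜.dx f + ∑ j, v (𝒜.y j) * 𝒜.dy j f := by
  have h := congrArg (fun d => d f) hv
  simpa [derivation_sum_apply] using h

theorem IsVectorField.prolongD_C {v : Derivation K 𝒜.carrier 𝒜.carrier} (hv : 𝒜.IsVectorField v)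
    (f : 𝒜.carrier) : 𝒜.prolongD v (MvPolynomial.C f) = MvPolynomial.C (v f) := by
  rw [hv.apply f, prolongD, jetFieldD_C]
  simp [prolongCoeff]

/-- The second-order terms in the commutator of a vector field and the total derivative are
symmetric. -/
theorem IsVectorField.sum_comm {v : Derivation K 𝒜.carrier 𝒜.carrier}
    (hv : 𝒜.IsVectorField v) (f : 𝒜.carrier) : MvPolynomial.C (v (𝒜.dx f))
          + ∑ j, 𝒜.jet 1 j * MvPolynomial.C (v (𝒜.dy j f)) =
      MvPolynomial.C (v 𝒜.x) * 𝒜.totalD (MvPolynomial.C (𝒜.dx f))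
          + ∑ j, MvPolynomial.C (v (𝒜.y j)) * 𝒜.totalD (MvPolynomial.C (𝒜.dy j f)) := by
  simp only [totalD_C, hv.apply (𝒜.dx f), hv.apply (𝒜.dy _ f), map_add, map_mul, map_sum,
    mul_add, Finset.sum_add_distrib, Finset.mul_sum, 𝒜.dx_dy]
  rw [Finset.sum_comm (f := fun i j => 𝒜.jet 1 i * (MvPolynomial.C (v (𝒜.y j))
      * MvPolynomial.C (𝒜.dy j (𝒜.dy i f))))]
  have e1 : ∀ i, 𝒜.jet 1 i * (MvPolynomial.C (v 𝒜.x) * MvPolynomial.C (𝒜.dy i (𝒜.dx f)))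
      = MvPolynomial.C (v 𝒜.x) * (𝒜.jet 1 i * MvPolynomial.C (𝒜.dy i (𝒜.dx f))) :=
    fun i => mul_left_comm _ _ _
  have e2 : ∀ i j, 𝒜.jet 1 i * (MvPolynomial.C (v (𝒜.y j))
      * MvPolynomial.C (𝒜.dy j (𝒜.dy i f))) =
      MvPolynomial.C (v (𝒜.y j)) * (𝒜.jet 1 i * MvPolynomial.C (𝒜.dy i (𝒜.dy j f))) :=
    fun i j => by rw [𝒜.dy_dy j i, mul_left_comm]
  simp only [e1, e2]
  abel

theorem IsVectorField.totalD_C_apply {v : Derivation K 𝒜.carrier 𝒜.carrier}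
    (hv : 𝒜.IsVectorField v) (f : 𝒜.carrier) : 𝒜.totalD (MvPolynomial.C (v f)) =
      (MvPolynomial.C (v 𝒜.x) * 𝒜.totalD (MvPolynomial.C (𝒜.dx f))
        + MvPolynomial.C (𝒜.dx f) * 𝒜.totalD (MvPolynomial.C (v 𝒜.x)))
      + (∑ j, MvPolynomial.C (v (𝒜.y j)) * 𝒜.totalD (MvPolynomial.C (𝒜.dy j f))
        + ∑ j, MvPolynomial.C (𝒜.dy j f) * 𝒜.totalD (MvPolynomial.C (v (𝒜.y j)))) := by
  rw [hv.apply f]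
  simp only [map_add, map_mul, map_sum, Derivation.leibniz, smul_eq_mul, Finset.sum_add_distrib]

theorem IsVectorField.prolongD_totalD_C {v : Derivation K 𝒜.carrier 𝒜.carrier}
    (hv : 𝒜.IsVectorField v) (f : 𝒜.carrier) : 𝒜.prolongD v (𝒜.totalD (MvPolynomial.C f)) =
      MvPolynomial.C (v (𝒜.dx f)) + (∑ j, 𝒜.jet 1 j * MvPolynomial.C (v (𝒜.dy j f))
        + (∑ j, MvPolynomial.C (𝒜.dy j f) * 𝒜.totalD (MvPolynomial.C (v (𝒜.y j)))
        - 𝒜.totalD (MvPolynomial.C (v 𝒜.x)) *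
          ∑ j, 𝒜.jet 1 j * MvPolynomial.C (𝒜.dy j f))) := by
  rw [totalD_C, map_add, map_sum, hv.prolongD_C, Finset.mul_sum, ← Finset.sum_sub_distrib,
    ← Finset.sum_add_distrib]
  congr 1
  refine Finset.sum_congr rfl fun j _ => ?_
  rw [Derivation.leibniz, hv.prolongD_C, prolongD_jet, prolongCoeff_succ]
  simp only [prolongCoeff, smul_eq_mul, mul_sub]
  rw [mul_left_comm (𝒜.totalD _), mul_comm (MvPolynomial.C (𝒜.dy j f)) (_ * _), mul_assoc]

/-- Prolongation commutes with the total derivative up to a multiple of the latter. -/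
theorem IsVectorField.prolongD_totalD {v : Derivation K 𝒜.carrier 𝒜.carrier}
    (hv : 𝒜.IsVectorField v) (P : 𝒜.Jet) :
    𝒜.prolongD v (𝒜.totalD P) = 𝒜.totalD (𝒜.prolongD v P)
      - 𝒜.totalD (MvPolynomial.C (v 𝒜.x)) * 𝒜.totalD P := by
  have h : ⁅𝒜.prolongD v, 𝒜.totalD⁆ = -(𝒜.totalD (MvPolynomial.C (v 𝒜.x)) • 𝒜.totalD) := by
    refine 𝒜.jetDerivation_ext (fun f => ?_) fun k j => ?_
    · have h3 := hv.sum_comm f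
      rw [Derivation.commutator_apply, hv.prolongD_C, hv.totalD_C_apply, hv.prolongD_totalD_C]
      simp only [Derivation.neg_apply, Derivation.smul_apply, smul_eq_mul]
      rw [totalD_C (f := f)]
      generalize ∑ j, 𝒜.jet 1 j * MvPolynomial.C (v (𝒜.dy j f)) = a1 at *
      generalize ∑ j, MvPolynomial.C (v (𝒜.y j)) * 𝒜.totalD (MvPolynomial.C (𝒜.dy j f)) = a2
        at *
      generalize ∑ j, 𝒜.jet 1 j * MvPolynomial.C (𝒜.dy j f) = a3 at *
      generalize ∑ j, MvPolynomial.C (𝒜.dy j f) * 𝒜.totalD (MvPolynomial.C (v (𝒜.y j))) = a4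
        at *
      linear_combination h3
    · rw [Derivation.commutator_apply, totalD_jet, prolongD_jet, prolongD_jet,
        prolongCoeff_succ _ _ (k + 1)]
      simp only [Derivation.neg_apply, Derivation.smul_apply, smul_eq_mul, totalD_jet]
      rw [sub_sub_cancel_left, mul_comm]
  have h' := congrArg (fun d => d P) h
  simp only [Derivation.commutator_apply, Derivation.neg_apply, Derivation.smul_apply,
    smul_eq_mul] at h'
  rw [sub_eq_iff_eq_add] at h'
  rw [h', neg_add_eq_sub]

end FunctionAlgebra

/-! ### Binary forms along a second-order linear equation -/

section Form

variable {K R : Type*} [CommRing K] [CommRing R] [Algebra K R]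

/-- The sequence `p` is a form of degree `d`, for the derivation `D` and the source equation
`s'' + q s = 0`: it satisfies `D p_i = p_{i+1} - i (d - i + 1) q p_{i-1}`. This is the law of the
values `p_i = d! / (d - i)! F(s, …, s, s', …, s')`, with `i` arguments `s'`, of a symmetric
`d`-linear form `F` with constant coefficients, for `s` a vector of solutions. The degree is an
integer, so that it may be lowered freely; at `i = 0` the truncated index `i - 1` is multiplied by
zero. -/
def IsForm (D : Derivation K R R) (q : R) (d : ℤ) (p : ℕ → R) : Prop :=
  ∀ i : ℕ, D (p i) = p (i + 1) - i * (d - i + 1) * q * p (i - 1)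

/-- The coefficients of the form of degree `d` whose zeroth coefficient is `f`. -/
def formSeq (D : Derivation K R R) (q : R) (d : ℤ) (f : R) : ℕ → R
  | 0 => f
  | 1 => D f
  | i + 2 => D (formSeq D q d f (i + 1)) + (i + 1) * (d - i) * q * formSeq D q d f i

variable {D : Derivation K R R} {q : R} {d : ℤ} {p : ℕ → R}

theorem isForm_formSeq (D : Derivation K R R) (q : R) (d : ℤ) (f : R) :
    IsForm D q d (formSeq D q d f) := by
  rintro (_ | i)
  · simp [formSeq]
  · simp only [formSeq, Nat.add_sub_cancel]
    push_cast
    ring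

namespace IsForm

theorem apply_zero (h : IsForm D q d p) : D (p 0) = p 1 := by simpa using h 0

theorem apply_succ (h : IsForm D q d p) (i : ℕ) :
    D (p (i + 1)) = p (i + 2) - (i + 1) * (d - i) * q * p i := by
  have := h (i + 1)
  simp only [Nat.add_sub_cancel] at this
  rw [this]; push_cast; ring

/-- A form is determined by its zeroth coefficient. -/
theorem ext {p' : ℕ → R} (h : IsForm D q d p) (h' : IsForm D q d p') (h0 : p 0 = p' 0) :
    p = p' := by
  have key : ∀ i, p i = p' i ∧ p (i + 1) = p' (i + 1) := by
    intro i
    induction i with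
    | zero => exact ⟨h0, by rw [← h.apply_zero, h0, h'.apply_zero]⟩
    | succ i ih =>
      refine ⟨ih.2, ?_⟩
      have h1 := h.apply_succ i
      have h2 := h'.apply_succ i
      rw [ih.1, ih.2, h2] at h1
      linear_combination -h1
  exact funext fun i => (key i).1

/-- Polarization of a form along a solution `s` of the source equation lowers the degree. -/
theorem diff (h : IsForm D q d p) {s s' : R} (hs : D s = s') (hs' : D s' = -(q * s)) :
    IsForm D q (d - 1) fun i => s * p (i + 1) - (d - i) * s' * p i := by
  rintro (_ | i)
  · simp only [map_sub, Derivation.leibniz, smul_eq_mul, hs, hs', h.apply_succ, h.apply_zero,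
      Derivation.map_natCast, Derivation.map_intCast]
    push_cast
    ring
  · simp only [map_sub, Derivation.leibniz, smul_eq_mul, hs, hs', h.apply_succ,
      Derivation.map_natCast, Derivation.map_intCast, Nat.add_sub_cancel]
    push_cast
    ring

/-- Multiplication of a form by the linear form with coefficients `s`, `s'` raises the degree. -/
theorem mul (h : IsForm D q d p) {s s' : R} (hs : D s = s') (hs' : D s' = -(q * s)) :
    IsForm D q (d + 1) fun i => s * p i + i * s' * p (i - 1) := by
  rintro (_ | _ | i)
  · simp only [map_add, Derivation.leibniz, smul_eq_mul, hs, hs', h.apply_zero,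
      Derivation.map_natCast]
    push_cast
    simp
    ring
  · simp only [map_add, Derivation.leibniz, smul_eq_mul, hs, hs', h.apply_zero, h.apply_succ,
      Derivation.map_natCast, Nat.reduceAdd, Nat.reduceSub]
    push_cast
    simp
    ring
  · simp only [map_add, Derivation.leibniz, smul_eq_mul, hs, hs', h.apply_succ,
      Derivation.map_natCast, Nat.add_sub_cancel]
    push_cast
    ring

theorem one (D : Derivation K R R) (q : R) : IsForm D q 0 fun i => if i = 0 then 1 else 0 := by
  rintro (_ | _ | i) <;> simp

/-- A monomial in two solutions is the zeroth coefficient of a form of its degree, whose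
coefficients vanish beyond the degree. -/
theorem exists_pow_mul_pow {u u' v v' : R} (hu : D u = u') (hu' : D u' = -(q * u))
    (hv : D v = v') (hv' : D v' = -(q * v)) (a b : ℕ) :
    ∃ p, IsForm D q (a + b : ℕ) p ∧ p 0 = u ^ a * v ^ b ∧ ∀ i, a + b < i → p i = 0 := by
  induction a with
  | zero =>
    induction b with
    | zero => exact ⟨_, by simpa using one D q, by simp, fun i hi => if_neg (by omega)⟩
    | succ b ih =>
      obtain ⟨p, h, h0, hp⟩ := ih
      refine ⟨_, by simpa [add_assoc] using h.mul hv hv', by simp [h0]; ring, fun i hi => ?_⟩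
      simp [hp i (by omega), hp (i - 1) (by omega)]
  | succ a ih =>
    obtain ⟨p, h, h0, hp⟩ := ih
    refine ⟨_, by simpa [add_right_comm] using h.mul hu hu', by simp [h0]; ring, fun i hi => ?_⟩
    simp [hp i (by omega), hp (i - 1) (by omega)]

/-- Each application of `s² D - d s s'`, with the fixed integer `d = n - 1`, lowers the degree of
the form by one, up to powers of `s`. In the step from `k` to `k + 1`, differentiating the factor
`s^k` changes the weight `d` to the degree `d - k` of the form reached. -/
theorem exists_iterate (h : IsForm D q d p) {s s' : R} (hs : D s = s') (hs' : D s' = -(q * s))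
    (n : ℕ) (hd : d = n - 1) : ∀ k ≤ n, ∃ P, IsForm D q (d - k) P ∧
      (fun f => s ^ 2 * D f - (d : R) * s * s' * f)^[k] (p 0) = s ^ k * P 0 ∧
      P (n - k) = s ^ k * p n := by
  intro k
  induction k with
  | zero => intro _; exact ⟨p, by simpa using h, by simp, by simp⟩
  | succ k ih =>
    intro hk
    obtain ⟨P, hP, h0, hn⟩ := ih (by omega)
    refine ⟨_, by simpa [sub_sub] using hP.diff hs hs', ?_, ?_⟩
    · rw [Function.iterate_succ_apply', h0]
      simp only [Derivation.leibniz, Derivation.leibniz_pow, hP.apply_zero, hs, smul_eq_mul]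
      rcases k with _ | k
      · simp; ring
      · simp only [Nat.add_sub_cancel, nsmul_eq_mul]
        push_cast
        simp
        ring
    · obtain ⟨l, rfl⟩ : ∃ l, n = k + 1 + l := ⟨n - (k + 1), by omega⟩
      have e1 : k + 1 + l - (k + 1) = l := by omega
      have e2 : k + 1 + l - k = l + 1 := by omega
      rw [e2] at hn
      rw [e1, hn, hd]
      push_cast
      ring

/-- The operator `s² D - d s s'` is the derivation `s² D` conjugated by `s^d`; its `n`-th power maps
the zeroth coefficient of a form of degree `d = n - 1` to the `n`-th one, up to the factor `s^{2n}`.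
-/
theorem iterate_eq (h : IsForm D q d p) {s s' : R} (hs : D s = s') (hs' : D s' = -(q * s))
    (n : ℕ) (hd : d = n - 1) :
    (fun f => s ^ 2 * D f - (d : R) * s * s' * f)^[n] (p 0) = s ^ (2 * n) * p n := by
  obtain ⟨P, -, h0, hn⟩ := h.exists_iterate hs hs' n hd n le_rfl
  rw [h0]
  rw [Nat.sub_self] at hn
  rw [hn]; ring

/-- The derivative of the pairing of two forms of degree `N` is a boundary term: in the sum of the
derivatives of `(-1)^i p_i P_{N-i}`, the terms in `p_{i+1} P_{N-i}` and those in `q` telescope. For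
`p_{N+1} = 0` it exhibits `p_0 P_{N+1}` as a total derivative. -/
theorem sum_mul {P : ℕ → R} {N : ℕ} (h : IsForm D q N p) (hP : IsForm D q N P) :
    D (∑ i ∈ Finset.range (N + 1), (-1) ^ i * (p i * P (N - i)))
      = p 0 * P (N + 1) + (-1) ^ N * (p (N + 1) * P 0) := by
  -- the partial sums, with the boundary terms at `k`
  have key : ∀ k ≤ N + 1, D (∑ i ∈ Finset.range k, (-1) ^ i * (p i * P (N - i)))
      = p 0 * P (N + 1) - (-1) ^ k * (p k * P (N + 1 - k))
        + (-1) ^ k * (k * (N - k + 1) * q * (p (k - 1) * P (N - k))) := by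
    intro k
    induction k with
    | zero => intro _; simp
    | succ k ih =>
      intro hk
      obtain ⟨l, rfl⟩ : ∃ l, N = k + l := ⟨N - k, by omega⟩
      have hs : D ((-1 : R) ^ k) = 0 := by
        rw [Derivation.leibniz_pow, map_neg, Derivation.map_one_eq_zero]; simp
      have e1 : k + l + 1 - k = l + 1 := by omega
      have e2 : k + l - k = l := by omega
      have e3 : k + l + 1 - (k + 1) = l := by omega
      have e4 : k + l - (k + 1) = l - 1 := by omega
      rw [Finset.sum_range_succ, map_add, ih (by omega), Derivation.leibniz, hs,
        Derivation.leibniz, e1, e2, e3, e4, h k, hP l, Nat.add_sub_cancel]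
      simp only [smul_eq_mul]
      push_cast
      ring
  rw [key (N + 1) le_rfl]
  push_cast
  simp
  ring

end IsForm

end Form

namespace FunctionAlgebra

variable {K : Type u} [Field K] {m : ℕ} {𝒜 : FunctionAlgebra K m}

/-! ### Functions of `x` alone -/

theorem DependsOnX.mul {f g : 𝒜.carrier} (hf : 𝒜.DependsOnX f) (hg : 𝒜.DependsOnX g) :
    𝒜.DependsOnX (f * g) := fun j => by
  rw [Derivation.leibniz, hf j, hg j]; simp

theorem DependsOnX.sub {f g : 𝒜.carrier} (hf : 𝒜.DependsOnX f) (hg : 𝒜.DependsOnX g) :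
    𝒜.DependsOnX (f - g) := fun j => by rw [map_sub, hf j, hg j, sub_zero]

theorem DependsOnX.add {f g : 𝒜.carrier} (hf : 𝒜.DependsOnX f) (hg : 𝒜.DependsOnX g) :
    𝒜.DependsOnX (f + g) := fun j => by rw [map_add, hf j, hg j, add_zero]

theorem DependsOnX.smul {f : 𝒜.carrier} (hf : 𝒜.DependsOnX f) (c : K) :
    𝒜.DependsOnX (c • f) := fun j => by rw [Derivation.map_smul, hf j, smul_zero]

theorem DependsOnX.pow {f : 𝒜.carrier} (hf : 𝒜.DependsOnX f) (k : ℕ) :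
    𝒜.DependsOnX (f ^ k) := fun j => by
  rw [Derivation.leibniz_pow, hf j]; simp

theorem DependsOnX.dx {f : 𝒜.carrier} (hf : 𝒜.DependsOnX f) : 𝒜.DependsOnX (𝒜.dx f) :=
  𝒜.dx_dependsOnX hf

theorem dependsOnX_intCast (d : ℤ) : 𝒜.DependsOnX (d : 𝒜.carrier) := fun j => by simp

theorem dependsOnX_natCast (d : ℕ) : 𝒜.DependsOnX (d : 𝒜.carrier) := fun j => by simp

theorem dependsOnX_of_isForm {q : 𝒜.carrier} (hq : 𝒜.DependsOnX q) {d : ℤ} {p : ℕ → 𝒜.carrier}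
    (h : IsForm 𝒜.dx q d p) (h0 : 𝒜.DependsOnX (p 0)) (i : ℕ) : 𝒜.DependsOnX (p i) := by
  have key : ∀ i, 𝒜.DependsOnX (p i) ∧ 𝒜.DependsOnX (p (i + 1)) := by
    intro i
    induction i with
    | zero => exact ⟨h0, by rw [← h.apply_zero]; exact h0.dx⟩
    | succ i ih =>
      refine ⟨ih.2, ?_⟩
      have e : p (i + 2) = 𝒜.dx (p (i + 1))
          + ((i + 1 : ℕ) : 𝒜.carrier) * ((d - i : ℤ) : 𝒜.carrier) * q * p i := by
        rw [h.apply_succ]; push_cast; ring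
      rw [e]
      exact ih.2.dx.add ((((dependsOnX_natCast _).mul (dependsOnX_intCast _)).mul hq).mul ih.1)
  exact (key i).1

/-- A form of degree `d` in functions of `x` alone whose coefficient with index `d + 1` vanishes
comes from a binary form in `u`, `v` with constant coefficients. By induction on the degree, this
holds for the polarizations of the form along `u` and `v`, and since `u v' - u' v = 1` the zeroth
coefficient is recovered from these two up to the factor `d`. -/
theorem mem_span_of_isForm [CharZero K] {u v u' v' q : 𝒜.carrier}
    (hu : 𝒜.dx u = u') (hu' : 𝒜.dx u' = -(q * u)) (hv : 𝒜.dx v = v') (hv' : 𝒜.dx v' = -(q * v))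
    (hux : 𝒜.DependsOnX u) (hvx : 𝒜.DependsOnX v) (hW : u * v' - u' * v = 1) (d : ℕ)
    {p : ℕ → 𝒜.carrier} (h : IsForm 𝒜.dx q d p) (hp : ∀ i, 𝒜.DependsOnX (p i))
    (hd : p (d + 1) = 0) :
    p 0 ∈ Submodule.span K (Set.range fun k : Fin (d + 1) => u ^ (d - (k : ℕ)) * v ^ (k : ℕ)) := by
  induction d generalizing p with
  | zero =>
    obtain ⟨c, hc⟩ := 𝒜.eq_const (p 0) (by rw [h.apply_zero, hd]) (hp 0)
    rw [hc, Algebra.algebraMap_eq_smul_one]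
    exact Submodule.smul_mem _ _ (Submodule.subset_span ⟨0, by simp⟩)
  | succ d ih =>
    have hstep : ∀ {s s' : 𝒜.carrier}, 𝒜.dx s = s' → 𝒜.dx s' = -(q * s) → 𝒜.DependsOnX s →
        s * p 1 - ((d + 1 : ℕ) : 𝒜.carrier) * s' * p 0 ∈ Submodule.span K
          (Set.range fun k : Fin (d + 1) => u ^ (d - (k : ℕ)) * v ^ (k : ℕ)) := by
      intro s s' hs hs' hsx
      have h1 := h.diff hs hs'
      have h2 := ih (p := fun i => s * p (i + 1) - ((d + 1 : ℕ) - i) * s' * p i)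
        (by simpa using h1) (fun i => (hsx.mul (hp _)).sub
          ((((dependsOnX_natCast _).sub (dependsOnX_natCast _)).mul (hs ▸ hsx.dx)).mul (hp i)))
        (by simp [hd])
      simpa using h2
    have h1 := hstep hu hu' hux
    have h2 := hstep hv hv' hvx
    have hmul : ∀ {f : 𝒜.carrier} (a b : 𝒜.carrier), ((a = u ∧ b = v) ∨ (a = v ∧ b = u)) →
        f ∈ Submodule.span K
          (Set.range fun k : Fin (d + 1) => u ^ (d - (k : ℕ)) * v ^ (k : ℕ)) →
        a * f ∈ Submodule.span K
          (Set.range fun k : Fin (d + 1 + 1) => u ^ (d + 1 - (k : ℕ)) * v ^ (k : ℕ)) := by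
      intro f a b hab hf
      refine Submodule.span_induction ?_ (by simp) (fun x y _ _ hx hy => ?_)
        (fun c x _ hx => ?_) hf
      · rintro _ ⟨k, rfl⟩
        have hk := k.2
        rcases hab with ⟨rfl, -⟩ | ⟨rfl, -⟩
        · refine Submodule.subset_span ⟨k.castSucc, ?_⟩
          have : d + 1 - (k : ℕ) = d - k + 1 := by omega
          simp only [Fin.val_castSucc, this]
          ring
        · refine Submodule.subset_span ⟨k.succ, ?_⟩
          simp only [Fin.val_succ, Nat.add_sub_add_right]
          ring
      · rw [mul_add]; exact Submodule.add_mem _ hx hy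
      · rw [mul_smul_comm]; exact Submodule.smul_mem _ _ hx
    have hne : ((d + 1 : ℕ) : K) ≠ 0 := Nat.cast_ne_zero.2 (by omega)
    have e : ((d + 1 : ℕ) : K) • p 0 = v * (u * p 1 - ((d + 1 : ℕ) : 𝒜.carrier) * u' * p 0)
        - u * (v * p 1 - ((d + 1 : ℕ) : 𝒜.carrier) * v' * p 0) := by
      rw [Nat.cast_smul_eq_nsmul, nsmul_eq_mul]
      linear_combination -((d + 1 : ℕ) : 𝒜.carrier) * p 0 * hW
    rw [← inv_smul_smul₀ hne (p 0), e]
    exact Submodule.smul_mem _ _ (Submodule.sub_mem _ (hmul v u (Or.inr ⟨rfl, rfl⟩) h1)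
      (hmul u v (Or.inl ⟨rfl, rfl⟩) h2))

/-- The monomials of degree `d` in `u`, `v` are linearly independent over the constants. For a
vanishing binary form with partial derivatives `X`, `Y`, Euler's identity gives `u X + v Y = 0` and
differentiation `u' X + v' Y = 0`, so both derivatives vanish. -/
theorem eq_zero_of_sum_eq_zero [CharZero K] {u v u' v' : 𝒜.carrier}
    (hu : 𝒜.dx u = u') (hv : 𝒜.dx v = v') (hW : u * v' - u' * v = 1) (d : ℕ) (c : ℕ → K)
    (h : ∑ k ∈ Finset.range (d + 1), c k • (u ^ (d - k) * v ^ k) = 0) : ∀ k ≤ d, c k = 0 := by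
  induction d generalizing c with
  | zero =>
    intro k hk
    obtain rfl : k = 0 := by omega
    have h' : algebraMap K 𝒜.carrier (c 0) = 0 := by
      simpa [Algebra.algebraMap_eq_smul_one] using h
    exact (map_eq_zero_iff _ (algebraMap K 𝒜.carrier).injective).1 h'
  | succ d ih =>
    set X := ∑ k ∈ Finset.range (d + 1), (((d + 1 - k : ℕ) : K) * c k) • (u ^ (d - k) * v ^ k)
      with hX
    set Y := ∑ k ∈ Finset.range (d + 1), (((k + 1 : ℕ) : K) * c (k + 1)) • (u ^ (d - k) * v ^ k)
      with hY
    -- Euler's identity and the chain rule, for `X` and `Y` the two partial derivatives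
    have hE : ∀ a b : 𝒜.carrier, (∑ k ∈ Finset.range (d + 1 + 1),
        c k • (((d + 1 - k : ℕ) : 𝒜.carrier) * u ^ (d - k) * a * v ^ k
          + (k : 𝒜.carrier) * u ^ (d + 1 - k) * v ^ (k - 1) * b)) = a * X + b * Y := by
      intro a b
      simp only [smul_add, Finset.sum_add_distrib]
      congr 1
      · rw [Finset.sum_range_succ, hX, Finset.mul_sum]
        simp only [Nat.sub_self, Nat.cast_zero, zero_mul, smul_zero, add_zero]
        refine Finset.sum_congr rfl fun k _ => ?_
        rw [mul_smul_comm, mul_comm (_ : K), mul_smul, Nat.cast_smul_eq_nsmul, nsmul_eq_mul]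
        congr 1
        ring
      · rw [Finset.sum_range_succ', hY, Finset.mul_sum]
        simp only [Nat.cast_zero, zero_mul, smul_zero, add_zero]
        refine Finset.sum_congr rfl fun k _ => ?_
        rw [mul_smul_comm, mul_comm (_ : K), mul_smul, Nat.cast_smul_eq_nsmul, nsmul_eq_mul,
          Nat.add_sub_add_right, Nat.add_sub_cancel]
        congr 1
        ring
    have h1 : u * X + v * Y = 0 := by
      rw [← hE, ← smul_zero ((d + 1 : ℕ) : K), ← h, Finset.smul_sum]
      refine Finset.sum_congr rfl fun k hk => ?_
      rw [Finset.mem_range] at hk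
      rw [smul_comm ((d + 1 : ℕ) : K), Nat.cast_smul_eq_nsmul, nsmul_eq_mul]
      congr 1
      rcases k with _ | k
      · simp; ring
      · rcases Nat.lt_or_ge k d with hkd | hkd
        · obtain ⟨l, rfl⟩ : ∃ l, d = k + 1 + l := ⟨d - (k + 1), by omega⟩
          have e1 : k + 1 + l + 1 - (k + 1) = l + 1 := by omega
          have e2 : k + 1 + l - (k + 1) = l := by omega
          rw [e1, e2, Nat.add_sub_cancel]
          push_cast; ring
        · obtain rfl : k = d := by omega
          simp; ring
    have h2 : u' * X + v' * Y = 0 := by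
      rw [← hE, ← map_zero 𝒜.dx, ← h, map_sum]
      refine Finset.sum_congr rfl fun k hk => ?_
      rw [Derivation.map_smul, Derivation.leibniz, Derivation.leibniz_pow, Derivation.leibniz_pow,
        hu, hv]
      congr 1
      simp only [smul_eq_mul, nsmul_eq_mul]
      have e : d + 1 - k - 1 = d - k := by omega
      rw [e]
      ring
    have hX0 : X = 0 := by linear_combination v' * h1 - v * h2 - X * hW
    have hY0 : Y = 0 := by linear_combination u * h2 - u' * h1 - Y * hW
    intro k hk
    rcases k with _ | k
    · have := ih _ hX0 0 (by omega)
      simpa [Nat.cast_add_one_ne_zero] using this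
    · have := ih _ hY0 k (by omega)
      rcases mul_eq_zero.1 this with h3 | h3
      · exact absurd h3 (Nat.cast_ne_zero.2 (by omega))
      · exact h3

/-! ### Vector fields -/

variable (𝒜) in
/-- The vector field `a ∂/∂x + ∑ b_j ∂/∂y_j`. -/
def vectorField : (𝒜.carrier × (Fin m → 𝒜.carrier)) →ₗ[K] Derivation K 𝒜.carrier 𝒜.carrier where
  toFun w := w.1 • 𝒜.dx + ∑ j, w.2 j • 𝒜.dy j
  map_add' w w' := by
    simp only [Prod.fst_add, Prod.snd_add, Pi.add_apply, add_smul, Finset.sum_add_distrib]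
    abel
  map_smul' c w := by
    simp only [Prod.smul_fst, Prod.smul_snd, Pi.smul_apply, smul_assoc, RingHom.id_apply,
      smul_add, Finset.smul_sum]

theorem vectorField_apply (w : 𝒜.carrier × (Fin m → 𝒜.carrier)) (f : 𝒜.carrier) :
    𝒜.vectorField w f = w.1 * 𝒜.dx f + ∑ j, w.2 j * 𝒜.dy j f := by
  simp [vectorField, derivation_sum_apply]

@[simp] theorem vectorField_x (w : 𝒜.carrier × (Fin m → 𝒜.carrier)) :
    𝒜.vectorField w 𝒜.x = w.1 := by
  simp [vectorField_apply, 𝒜.dx_x, 𝒜.dy_x]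

@[simp] theorem vectorField_y (w : 𝒜.carrier × (Fin m → 𝒜.carrier)) (j : Fin m) :
    𝒜.vectorField w (𝒜.y j) = w.2 j := by
  simp [vectorField_apply, 𝒜.dx_y, 𝒜.dy_y]

theorem isVectorField_iff {v : Derivation K 𝒜.carrier 𝒜.carrier} :
    𝒜.IsVectorField v ↔ v = 𝒜.vectorField (v 𝒜.x, fun j => v (𝒜.y j)) := Iff.rfl

theorem isVectorField_vectorField (w : 𝒜.carrier × (Fin m → 𝒜.carrier)) :
    𝒜.IsVectorField (𝒜.vectorField w) := by
  rw [isVectorField_iff]; simp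

theorem IsVectorField.ext {v w : Derivation K 𝒜.carrier 𝒜.carrier} (hv : 𝒜.IsVectorField v)
    (hw : 𝒜.IsVectorField w) (hx : v 𝒜.x = w 𝒜.x) (hy : ∀ j, v (𝒜.y j) = w (𝒜.y j)) :
    v = w := by
  rw [isVectorField_iff.1 hv, isVectorField_iff.1 hw, hx]
  simp only [hy]

theorem IsVectorField.add {v w : Derivation K 𝒜.carrier 𝒜.carrier} (hv : 𝒜.IsVectorField v)
    (hw : 𝒜.IsVectorField w) : 𝒜.IsVectorField (v + w) := by
  rw [isVectorField_iff.1 hv, isVectorField_iff.1 hw, ← map_add]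
  exact isVectorField_vectorField _

theorem IsVectorField.smul {v : Derivation K 𝒜.carrier 𝒜.carrier} (hv : 𝒜.IsVectorField v)
    (c : K) : 𝒜.IsVectorField (c • v) := by
  rw [isVectorField_iff.1 hv, ← map_smul]
  exact isVectorField_vectorField _

/-- The vector fields are closed under the bracket. -/
theorem IsVectorField.lie {v w : Derivation K 𝒜.carrier 𝒜.carrier} (hv : 𝒜.IsVectorField v)
    (hw : 𝒜.IsVectorField w) : 𝒜.IsVectorField ⁅v, w⁆ := by
  -- the second-order part of `v (w f)`
  have key : ∀ {v w : Derivation K 𝒜.carrier 𝒜.carrier}, 𝒜.IsVectorField v → 𝒜.IsVectorField w →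
      ∀ f, v (w f) = (v (w 𝒜.x) * 𝒜.dx f + ∑ j, v (w (𝒜.y j)) * 𝒜.dy j f)
        + (w 𝒜.x * v 𝒜.x * 𝒜.dx (𝒜.dx f) + ∑ j, (w 𝒜.x * v (𝒜.y j) + w (𝒜.y j) * v 𝒜.x)
            * 𝒜.dx (𝒜.dy j f) + ∑ i, ∑ j, w (𝒜.y i) * v (𝒜.y j) * 𝒜.dy j (𝒜.dy i f)) := by
    intro v w hv hw f
    rw [hw.apply f, map_add, map_sum]
    simp only [Derivation.leibniz, smul_eq_mul, hv.apply (𝒜.dx f), hv.apply (𝒜.dy _ f),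
      Finset.sum_add_distrib, add_mul, mul_add, Finset.mul_sum, 𝒜.dx_dy, mul_assoc,
      mul_comm (𝒜.dx f), mul_comm (𝒜.dy _ f)]
    ring
  refine Derivation.ext fun f => ?_
  rw [Derivation.commutator_apply, key hv hw f, key hw hv f]
  change _ = 𝒜.vectorField (⁅v, w⁆ 𝒜.x, fun j => ⁅v, w⁆ (𝒜.y j)) f
  rw [vectorField_apply]
  simp only [Derivation.commutator_apply, sub_mul, Finset.sum_sub_distrib]
  have e1 : ∑ j, (w 𝒜.x * v (𝒜.y j) + w (𝒜.y j) * v 𝒜.x) * 𝒜.dx (𝒜.dy j f)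
      = ∑ j, (v 𝒜.x * w (𝒜.y j) + v (𝒜.y j) * w 𝒜.x) * 𝒜.dx (𝒜.dy j f) :=
    Finset.sum_congr rfl fun j _ => by ring
  have e2 : ∑ i, ∑ j, w (𝒜.y i) * v (𝒜.y j) * 𝒜.dy j (𝒜.dy i f)
      = ∑ i, ∑ j, v (𝒜.y i) * w (𝒜.y j) * 𝒜.dy j (𝒜.dy i f) := by
    rw [Finset.sum_comm]
    exact Finset.sum_congr rfl fun i _ => Finset.sum_congr rfl fun j _ => by
      rw [𝒜.dy_dy i j]; ring
  rw [e1, e2]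
  ring

theorem prolongCoeff_add (v w : Derivation K 𝒜.carrier 𝒜.carrier) (k : ℕ) (j : Fin m) :
    𝒜.prolongCoeff (v + w) k j = 𝒜.prolongCoeff v k j + 𝒜.prolongCoeff w k j := by
  induction k with
  | zero => simp [prolongCoeff]
  | succ k ih =>
    rw [prolongCoeff_succ, prolongCoeff_succ, prolongCoeff_succ, ih]
    simp only [Derivation.add_apply, map_add]
    ring

theorem C_const_smul (c : K) (f : 𝒜.carrier) :
    (MvPolynomial.C (c • f) : 𝒜.Jet) = c • MvPolynomial.C f := by
  rw [MvPolynomial.C_apply, MvPolynomial.C_apply, MvPolynomial.smul_monomial]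

theorem prolongCoeff_smul (c : K) (v : Derivation K 𝒜.carrier 𝒜.carrier) (k : ℕ) (j : Fin m) :
    𝒜.prolongCoeff (c • v) k j = c • 𝒜.prolongCoeff v k j := by
  induction k with
  | zero => simp [prolongCoeff, C_const_smul]
  | succ k ih =>
    rw [prolongCoeff_succ, prolongCoeff_succ, ih, Derivation.smul_apply, C_const_smul,
      Derivation.map_smul, Derivation.map_smul, mul_smul_comm, smul_sub]

variable (𝒜) in
/-- Prolongation is linear in the vector field. -/
def prolongₗ : Derivation K 𝒜.carrier 𝒜.carrier →ₗ[K] Derivation K 𝒜.Jet 𝒜.Jet where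
  toFun := 𝒜.prolongD
  map_add' v w := 𝒜.jetDerivation_ext
    (fun f => by
      simp only [prolongD, jetFieldD_C, Derivation.add_apply, prolongCoeff_add, map_add, add_mul,
        Finset.sum_add_distrib]
      abel)
    (fun k j => by simp [prolongD_jet, prolongCoeff_add])
  map_smul' c v := 𝒜.jetDerivation_ext
    (fun f => by
      simp only [prolongD, jetFieldD_C, Derivation.smul_apply, prolongCoeff_smul, C_const_smul,
        smul_mul_assoc, smul_add, Finset.smul_sum, RingHom.id_apply])
    (fun k j => by simp [prolongD_jet, prolongCoeff_smul])

theorem prolongₗ_apply (v : Derivation K 𝒜.carrier 𝒜.carrier) : 𝒜.prolongₗ v = 𝒜.prolongD v := rfl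

/-! ### Orders of prolonged coefficients -/

theorem partialD_jet_of_ne {k l : ℕ} (i j : Fin m) (h : l ≠ k) :
    𝒜.partialD k i (𝒜.jet l j) = 0 := by
  rw [partialD_jet, if_neg fun h' => h h'.1]

theorem partialD_totalD_C (k : ℕ) (i : Fin m) (f : 𝒜.carrier) :
    𝒜.partialD (k + 2) i (𝒜.totalD (MvPolynomial.C f)) = 0 := by
  rw [partialD_succ_totalD]; simp

theorem partialD_one_totalD_C (i : Fin m) (f : 𝒜.carrier) :
    𝒜.partialD 1 i (𝒜.totalD (MvPolynomial.C f)) = MvPolynomial.C (𝒜.dy i f) := by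
  rw [partialD_succ_totalD]; simp [partialD_zero_C]

theorem partialD_prolongCoeff_of_lt (v : Derivation K 𝒜.carrier 𝒜.carrier) (i j : Fin m) (k l : ℕ)
    (h : k < l) : 𝒜.partialD l i (𝒜.prolongCoeff v k j) = 0 := by
  induction k generalizing l with
  | zero => obtain ⟨l, rfl⟩ : ∃ l', l = l' + 1 := ⟨l - 1, by omega⟩; simp [prolongCoeff]
  | succ k ih =>
    obtain ⟨l, rfl⟩ : ∃ l', l = l' + 2 := ⟨l - 2, by omega⟩
    rw [prolongCoeff_succ, map_sub, Derivation.leibniz, partialD_totalD_C,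
      partialD_jet_of_ne _ _ (by omega), partialD_succ_totalD, ih _ (by omega), ih _ (by omega)]
    simp

/-- The leading terms of the prolonged coefficient of order `k + 1`. -/
theorem partialD_prolongCoeff_top (v : Derivation K 𝒜.carrier 𝒜.carrier) (i j : Fin m) (k : ℕ) :
    𝒜.partialD (k + 1) i (𝒜.prolongCoeff v (k + 1) j) = MvPolynomial.C (𝒜.dy i (v (𝒜.y j)))
      - 𝒜.jet 1 j * MvPolynomial.C (𝒜.dy i (v 𝒜.x))
      - (if j = i then ((k + 1 : ℕ) : 𝒜.Jet) * 𝒜.totalD (MvPolynomial.C (v 𝒜.x)) else 0) := by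
  induction k with
  | zero =>
    rw [prolongCoeff_succ, map_sub, Derivation.leibniz, partialD_one_totalD_C, partialD_jet,
      partialD_succ_totalD]
    simp only [prolongCoeff, partialD_zero_C, zero_add, partialD_succ_C, map_zero, smul_eq_mul,
      true_and, mul_ite, mul_one, mul_zero, Nat.cast_one, one_mul]
    ring
  | succ k ih =>
    rw [prolongCoeff_succ, map_sub, Derivation.leibniz, partialD_totalD_C, partialD_jet,
      partialD_succ_totalD, partialD_prolongCoeff_of_lt _ _ _ _ _ (by omega), ih]
    simp only [smul_eq_mul, mul_zero, map_zero, true_and, zero_add, mul_ite, mul_one]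
    split_ifs
    · push_cast; ring
    · ring

/-- The coefficient of `y_i^{(k+1)}` in the prolonged coefficient of order `k + 2`; for order `n`,
the determining equations come from it. -/
theorem partialD_prolongCoeff_subtop (v : Derivation K 𝒜.carrier 𝒜.carrier) (i j : Fin m)
    (k : ℕ) :
    𝒜.partialD (k + 1) i (𝒜.prolongCoeff v (k + 2) j) =
      ((k + 2 : ℕ) : 𝒜.Jet) * 𝒜.totalD (MvPolynomial.C (𝒜.dy i (v (𝒜.y j)))
        - 𝒜.jet 1 j * MvPolynomial.C (𝒜.dy i (v 𝒜.x)))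
      - (if j = i then (((k + 2).choose 2 : ℕ) : 𝒜.Jet)
          * 𝒜.totalD (𝒜.totalD (MvPolynomial.C (v 𝒜.x))) else 0) := by
  induction k with
  | zero =>
    rw [prolongCoeff_succ, map_sub, Derivation.leibniz, partialD_one_totalD_C,
      partialD_jet_of_ne _ _ (by omega), partialD_succ_totalD, partialD_prolongCoeff_top,
      prolongCoeff_succ]
    simp only [map_sub, partialD_zero_totalD, Derivation.leibniz, prolongCoeff, partialD_zero_C,
      partialD_jet_of_ne _ _ (zero_add 1 ▸ one_ne_zero), totalD_jet, smul_eq_mul, zero_add]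
    by_cases h : j = i
    · simp [h]; ring
    · simp [h]; ring
  | succ k ih =>
    rw [prolongCoeff_succ, map_sub, Derivation.leibniz, partialD_totalD_C,
      partialD_jet_of_ne _ _ (by omega), partialD_succ_totalD, partialD_prolongCoeff_top, ih]
    have hc : ((k + 1 + 2).choose 2 : 𝒜.Jet) = ((k + 2).choose 2 : ℕ) + ((k + 2 : ℕ) : 𝒜.Jet) := by
      rw [show k + 1 + 2 = (k + 2) + 1 by ring, Nat.choose_succ_succ' (k + 2) 1]
      push_cast
      simp
      ring
    rw [hc]
    simp only [map_sub, smul_eq_mul, mul_zero, zero_add]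
    by_cases h : j = i
    · simp only [if_pos h, Derivation.leibniz, Derivation.map_natCast, smul_eq_mul, mul_zero]
      push_cast
      ring
    · simp only [if_neg h, map_zero]
      push_cast
      ring

namespace CanonicalSystem

variable {n : ℕ} (𝓔 : 𝒜.CanonicalSystem n)

/-! ### The system as the last coefficient of a binary form -/

/-- The coefficient `q` of the source equation `y'' + q y = 0` solved by `u` and `v`. -/
def source : 𝒜.carrier := 𝒜.dx 𝓔.u * 𝒜.dx (𝒜.dx 𝓔.v) - 𝒜.dx (𝒜.dx 𝓔.u) * 𝒜.dx 𝓔.v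

theorem source_dependsOnX : 𝒜.DependsOnX 𝓔.source :=
  (𝓔.u_dependsOnX.dx.mul 𝓔.v_dependsOnX.dx.dx).sub
    (𝓔.u_dependsOnX.dx.dx.mul 𝓔.v_dependsOnX.dx)

theorem dx_wronskian : 𝓔.u * 𝒜.dx (𝒜.dx 𝓔.v) - 𝒜.dx (𝒜.dx 𝓔.u) * 𝓔.v = 0 := by
  have h := congrArg 𝒜.dx 𝓔.wronskian
  rw [Derivation.map_one_eq_zero, map_sub, Derivation.leibniz, Derivation.leibniz] at h
  simp only [smul_eq_mul] at h
  linear_combination h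

theorem dx_dx_u : 𝒜.dx (𝒜.dx 𝓔.u) = -(𝓔.source * 𝓔.u) := by
  rw [source]
  linear_combination 𝒜.dx 𝓔.u * 𝓔.dx_wronskian - 𝒜.dx (𝒜.dx 𝓔.u) * 𝓔.wronskian

theorem dx_dx_v : 𝒜.dx (𝒜.dx 𝓔.v) = -(𝓔.source * 𝓔.v) := by
  rw [source]
  linear_combination 𝒜.dx 𝓔.v * 𝓔.dx_wronskian - 𝒜.dx (𝒜.dx 𝓔.v) * 𝓔.wronskian

/-- The binary form of degree `n - 1` on the jet space with zeroth coefficient `P`. -/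
def jetForm (P : 𝒜.Jet) : ℕ → 𝒜.Jet :=
  formSeq 𝒜.totalD (MvPolynomial.C 𝓔.source) (n - 1) P

/-- The binary form of degree `n - 1` with zeroth coefficient the function `f`. -/
def form (f : 𝒜.carrier) : ℕ → 𝒜.carrier := formSeq 𝒜.dx 𝓔.source (n - 1) f

theorem isForm_jetForm (P : 𝒜.Jet) :
    IsForm 𝒜.totalD (MvPolynomial.C 𝓔.source) (n - 1) (𝓔.jetForm P) := isForm_formSeq _ _ _ _

theorem isForm_form (f : 𝒜.carrier) : IsForm 𝒜.dx 𝓔.source (n - 1) (𝓔.form f) :=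
  isForm_formSeq _ _ _ _

theorem jetForm_zero (P : 𝒜.Jet) : 𝓔.jetForm P 0 = P := rfl

theorem form_zero (f : 𝒜.carrier) : 𝓔.form f 0 = f := rfl

theorem jetForm_one (P : 𝒜.Jet) : 𝓔.jetForm P 1 = 𝒜.totalD P := rfl

theorem jetForm_add_two (P : 𝒜.Jet) (i : ℕ) : 𝓔.jetForm P (i + 2) =
    𝒜.totalD (𝓔.jetForm P (i + 1))
      + ((i : 𝒜.Jet) + 1) * ((((n : ℤ) - 1 : ℤ) : 𝒜.Jet) - (i : 𝒜.Jet))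
        * MvPolynomial.C 𝓔.source * 𝓔.jetForm P i := rfl

-- unfolding these recursions is costly; only the relations above are used
attribute [irreducible] jetForm form

/-- On functions of `x` alone the total derivative is `d/dx`, hence the two kinds of forms agree. -/
theorem C_form {f : 𝒜.carrier} (hf : 𝒜.DependsOnX f) :
    (fun i => MvPolynomial.C (𝓔.form f i)) = 𝓔.jetForm (MvPolynomial.C f) := by
  refine IsForm.ext (fun i => ?_) (𝓔.isForm_jetForm _)
    (by rw [jetForm_zero, form_zero])
  rw [totalD_C_of_dependsOnX _ (dependsOnX_of_isForm 𝓔.source_dependsOnX (𝓔.isForm_form f)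
    (by rwa [form_zero]) i),
    𝓔.isForm_form f i]
  simp

/-- The left-hand side `Δ_j` is the coefficient with index `n` of the form of degree `n - 1` with
zeroth coefficient `y_j`. -/
theorem lhs_eq (j : Fin m) : 𝓔.lhs j = 𝓔.jetForm (𝒜.jet 0 j) n := by
  have key : ∀ {s : 𝒜.carrier}, 𝒜.DependsOnX s → 𝒜.dx (𝒜.dx s) = -(𝓔.source * s) →
      𝒜.IsTransformOfTrivial n 𝓔.A s →
      (MvPolynomial.C s : 𝒜.Jet) ^ (2 * n) * (𝓔.lhs j - 𝓔.jetForm (𝒜.jet 0 j) n) = 0 := by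
    intro s hs hs2 ht
    have h := (𝓔.isForm_jetForm (𝒜.jet 0 j)).iterate_eq (s := MvPolynomial.C s)
      (s' := MvPolynomial.C (𝒜.dx s)) (𝒜.totalD_C_of_dependsOnX hs)
      (by rw [totalD_C_of_dependsOnX _ hs.dx, hs2, map_neg, map_mul]) n rfl
    have ht' := ht j
    have hT : 𝒜.transOp n s = fun f : 𝒜.Jet => MvPolynomial.C s ^ 2 * 𝒜.totalD f
        - (((n : ℤ) - 1 : ℤ) : 𝒜.Jet) * MvPolynomial.C s * MvPolynomial.C (𝒜.dx s) * f := by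
      funext P
      rw [transOp, coe_totalD]
      simp only [map_mul, map_pow, map_sub, map_natCast, map_one, Int.cast_sub, Int.cast_natCast,
        Int.cast_one]
    rw [hT, map_pow] at ht'
    rw [jetForm_zero] at h
    rw [mul_sub, sub_eq_zero]
    exact ht'.trans h
  -- the Wronskian identity cancels the factors `u^{2n}` and `v^{2n}`
  have hco : IsCoprime (MvPolynomial.C 𝓔.u : 𝒜.Jet) (MvPolynomial.C 𝓔.v) :=
    ⟨MvPolynomial.C (𝒜.dx 𝓔.v), -MvPolynomial.C (𝒜.dx 𝓔.u), by
      rw [neg_mul, ← sub_eq_add_neg, ← map_mul, ← map_mul, ← map_sub, mul_comm, 𝓔.wronskian,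
        map_one]⟩
  obtain ⟨a, b, hab⟩ := hco.pow (m := 2 * n) (n := 2 * n)
  have hu := key 𝓔.u_dependsOnX 𝓔.dx_dx_u 𝓔.transform_u
  have hv := key 𝓔.v_dependsOnX 𝓔.dx_dx_v 𝓔.transform_v
  rw [← sub_eq_zero]
  linear_combination a * hu + b * hv - (𝓔.lhs j - 𝓔.jetForm (𝒜.jet 0 j) n) * hab

theorem jetForm_add (P Q : 𝒜.Jet) : 𝓔.jetForm (P + Q) = 𝓔.jetForm P + 𝓔.jetForm Q := by
  refine (𝓔.isForm_jetForm _).ext (fun i => ?_)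
    (by rw [Pi.add_apply, jetForm_zero, jetForm_zero, jetForm_zero])
  simp only [Pi.add_apply, map_add, 𝓔.isForm_jetForm P i, 𝓔.isForm_jetForm Q i]
  ring

theorem jetForm_smul (c : K) (P : 𝒜.Jet) : 𝓔.jetForm (c • P) = c • 𝓔.jetForm P := by
  refine (𝓔.isForm_jetForm _).ext (fun i => ?_)
    (by rw [Pi.smul_apply, jetForm_zero, jetForm_zero])
  simp only [Pi.smul_apply, Derivation.map_smul, 𝓔.isForm_jetForm P i, smul_sub, mul_smul_comm]

/-- The coefficient with index `i` of the form, as a linear function of its zeroth coefficient. -/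
def jetFormₗ (i : ℕ) : 𝒜.Jet →ₗ[K] 𝒜.Jet where
  toFun P := 𝓔.jetForm P i
  map_add' P Q := by rw [jetForm_add]; rfl
  map_smul' c P := by rw [jetForm_smul]; rfl

theorem partialD_C_source (k : ℕ) (i : Fin m) :
    𝒜.partialD k i (MvPolynomial.C 𝓔.source) = 0 :=
  𝒜.partialD_C_of_dependsOnX k i 𝓔.source_dependsOnX

/-- The coefficients of the form of `y_j` are linear in the jet coordinates: the one with index
`l` has order `l` and leading term `y_j^{(l)}`. -/
theorem partialD_jetForm (i j : Fin m) (l k : ℕ) (h : l ≤ k) :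
    𝒜.partialD k i (𝓔.jetForm (𝒜.jet 0 j) l) = if l = k ∧ j = i then 1 else 0 := by
  have key : ∀ l, (∀ k, l ≤ k → 𝒜.partialD k i (𝓔.jetForm (𝒜.jet 0 j) l)
        = if l = k ∧ j = i then 1 else 0) ∧
      (∀ k, l + 1 ≤ k → 𝒜.partialD k i (𝓔.jetForm (𝒜.jet 0 j) (l + 1))
        = if l + 1 = k ∧ j = i then 1 else 0) := by
    intro l
    induction l with
    | zero =>
      refine ⟨fun k _ => ?_, fun k _ => ?_⟩
      · rw [jetForm_zero, partialD_jet]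
      · rw [zero_add, jetForm_one, totalD_jet, partialD_jet]
    | succ l ih =>
      refine ⟨ih.2, fun k hk => ?_⟩
      obtain ⟨k, rfl⟩ : ∃ k', k = k' + 1 := ⟨k - 1, by omega⟩
      have hc : 𝒜.partialD (k + 1) i (((l : 𝒜.Jet) + 1)
          * ((((n : ℤ) - 1 : ℤ) : 𝒜.Jet) - (l : 𝒜.Jet)) * MvPolynomial.C 𝓔.source) = 0 := by
        have : ((l : 𝒜.Jet) + 1) * ((((n : ℤ) - 1 : ℤ) : 𝒜.Jet) - (l : 𝒜.Jet))
              * MvPolynomial.C 𝓔.source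
            = MvPolynomial.C (((l : 𝒜.carrier) + 1)
              * ((((n : ℤ) - 1 : ℤ) : 𝒜.carrier) - (l : 𝒜.carrier)) * 𝓔.source) := by
          simp only [map_mul, map_add, map_sub, map_natCast, map_intCast, map_one]
        rw [this, partialD_succ_C]
      rw [add_assoc, jetForm_add_two, map_add, partialD_succ_totalD, Derivation.leibniz, hc,
        ih.2 _ (by omega), ih.2 _ (by omega), ih.1 _ (by omega),
        if_neg (show ¬(l + 1 = k + 1 ∧ j = i) by omega),
        if_neg (show ¬(l = k + 1 ∧ j = i) by omega)]
      simp only [map_zero, smul_zero, zero_add, add_zero, ← add_assoc, Nat.add_right_cancel_iff]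
  exact (key l).1 k h

/-! ### Restriction to the solution manifold -/

/-- Restriction to the solution manifold as a homomorphism of algebras. -/
def onSol : 𝒜.Jet →ₐ[𝒜.carrier] 𝒜.Jet :=
  MvPolynomial.aeval (fun p : ℕ × Fin m =>
    if p.1 + 1 = n then -∑ i ∈ Finset.Icc 2 n, MvPolynomial.C (𝓔.A i) * 𝒜.jet (n - i) p.2
    else 𝒜.jet (p.1 + 1) p.2)

theorem onSolutions_eq (P : 𝒜.Jet) : 𝓔.onSolutions P = 𝓔.onSol P := rfl

@[simp] theorem onSol_C (f : 𝒜.carrier) : 𝓔.onSol (MvPolynomial.C f) = MvPolynomial.C f :=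
  𝓔.onSol.commutes f

theorem onSol_jet_of_ne {k : ℕ} (hk : k ≠ n) (j : Fin m) : 𝓔.onSol (𝒜.jet k j) = 𝒜.jet k j := by
  cases k with
  | zero => exact 𝓔.onSol_C _
  | succ k =>
    have : 𝓔.onSol (MvPolynomial.X (k, j)) = 𝒜.jet (k + 1) j := by
      rw [onSol, MvPolynomial.aeval_X, if_neg hk]
    exact this

theorem onSol_jet_self (hn : n ≠ 0) (j : Fin m) : 𝓔.onSol (𝒜.jet n j) =
    -∑ i ∈ Finset.Icc 2 n, MvPolynomial.C (𝓔.A i) * 𝒜.jet (n - i) j := by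
  obtain ⟨k, rfl⟩ : ∃ k, n = k + 1 := ⟨n - 1, by omega⟩
  have : 𝓔.onSol (MvPolynomial.X (k, j)) =
      -∑ i ∈ Finset.Icc 2 (k + 1), MvPolynomial.C (𝓔.A i) * 𝒜.jet (k + 1 - i) j := by
    rw [onSol, MvPolynomial.aeval_X, if_pos rfl]
  exact this

theorem onSol_lhs (hn : n ≠ 0) (j : Fin m) : 𝓔.onSol (𝓔.lhs j) = 0 := by
  rw [lhs, isotropicLHS, map_add, 𝓔.onSol_jet_self hn, map_sum, neg_add_eq_zero]
  refine Finset.sum_congr rfl fun i hi => ?_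
  rw [Finset.mem_Icc] at hi
  rw [map_mul, onSol_C, 𝓔.onSol_jet_of_ne (by omega)]

theorem partialD_onSol_jet (hn : n ≠ 0) (l : ℕ) (hl : n ≤ l + 1) (i j : Fin m) :
    𝒜.partialD l i (𝓔.onSol (𝒜.jet n j)) = 0 := by
  rw [𝓔.onSol_jet_self hn, map_neg, map_sum, neg_eq_zero]
  refine Finset.sum_eq_zero fun k hk => ?_
  rw [Finset.mem_Icc] at hk
  rw [Derivation.leibniz, partialD_jet_of_ne _ _ (by omega),
    𝒜.partialD_C_of_dependsOnX l i (𝓔.A_dependsOnX k (Finset.mem_Icc.2 hk))]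
  simp

/-- The chain rule for the restriction to the solution manifold. -/
theorem partialD_onSol (hn : n ≠ 0) (l : ℕ) (hl : l ≠ n) (i : Fin m) (P : 𝒜.Jet) :
    𝒜.partialD l i (𝓔.onSol P) = 𝓔.onSol (𝒜.partialD l i P)
      + ∑ k, 𝓔.onSol (𝒜.partialD n k P) * 𝒜.partialD l i (𝓔.onSol (𝒜.jet n k)) := by
  obtain ⟨r, rfl⟩ : ∃ r, n = r + 1 := ⟨n - 1, by omega⟩
  induction P using MvPolynomial.induction_on with
  | C f =>
    cases l with
    | zero => simp [partialD_zero_C]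
    | succ l => simp
  | add P Q hP hQ =>
    simp only [map_add, hP, hQ, add_mul, Finset.sum_add_distrib]
    ring
  | mul_X P p hP =>
    have hX : 𝒜.partialD l i (𝓔.onSol (𝒜.jet (p.1 + 1) p.2))
        = 𝓔.onSol (𝒜.partialD l i (𝒜.jet (p.1 + 1) p.2))
          + ∑ k, 𝓔.onSol (𝒜.partialD (r + 1) k (𝒜.jet (p.1 + 1) p.2))
            * 𝒜.partialD l i (𝓔.onSol (𝒜.jet (r + 1) k)) := by
      by_cases hp : p.1 = r
      · rw [hp, partialD_jet_of_ne (k := l) _ _ (Ne.symm hl)]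
        simp only [partialD_jet, true_and, apply_ite 𝓔.onSol, map_one, map_zero, ite_mul,
          one_mul, zero_mul]
        simp
      · rw [𝓔.onSol_jet_of_ne (by omega)]
        simp only [partialD_jet_of_ne (k := r + 1) _ _ (show p.1 + 1 ≠ r + 1 by omega),
          map_zero, zero_mul, Finset.sum_const_zero, add_zero]
        rw [partialD_jet]
        split_ifs <;> simp
    change 𝒜.partialD l i (𝓔.onSol (P * 𝒜.jet (p.1 + 1) p.2))
      = 𝓔.onSol (𝒜.partialD l i (P * 𝒜.jet (p.1 + 1) p.2))
        + ∑ k, 𝓔.onSol (𝒜.partialD (r + 1) k (P * 𝒜.jet (p.1 + 1) p.2))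
          * 𝒜.partialD l i (𝓔.onSol (𝒜.jet (r + 1) k))
    simp only [map_mul, Derivation.leibniz, smul_eq_mul, hP, hX, map_add, add_mul, mul_add,
      Finset.sum_add_distrib, Finset.mul_sum, mul_assoc]
    ring

end CanonicalSystem

end FunctionAlgebra

/-! ### Infinitesimal reparametrization of forms -/

section Form

variable {K R : Type*} [CommRing K] [CommRing R] [Algebra K R]
  {D W : Derivation K R R} {q : R} {d : ℤ} {p : ℕ → R}

/-- A derivation commuting with `D` and killing `q` maps forms to forms. -/
theorem IsForm.map_derivation (h : IsForm D q d p) (hW : ∀ f, W (D f) = D (W f)) (hq : W q = 0) :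
    IsForm D q d fun i => W (p i) := by
  intro i
  rw [← hW, h i]
  simp only [map_sub, Derivation.leibniz, smul_eq_mul, hq, Derivation.map_natCast,
    Derivation.map_intCast, map_add, Derivation.map_one_eq_zero]
  ring

/-- For a derivation `W` with `[W, D] = -2 ζ D` and `W p_0 = d ζ p_0`, an infinitesimal
reparametrization, a form of degree `d` is expected to transform by
`W p_i = (d - 2 i) ζ p_i + i (d - i + 1) (D ζ) p_{i-1}`; this is the difference of the two sides. -/
def reparamDefect (W D : Derivation K R R) (d : ℤ) (ζ : R) (p : ℕ → R) (i : ℕ) : R :=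
  W (p i) - ((d - 2 * i) * ζ * p i + i * (d - i + 1) * D ζ * p (i - 1))

theorem reparamDefect_zero {ζ : R} (h0 : W (p 0) = d * ζ * p 0) :
    reparamDefect W D d ζ p 0 = 0 := by
  simp [reparamDefect, h0]

theorem IsForm.reparamDefect_one (h : IsForm D q d p) {ζ : R}
    (hW : ∀ f, W (D f) = D (W f) - 2 * ζ * D f) (h0 : W (p 0) = d * ζ * p 0) :
    reparamDefect W D d ζ p 1 = 0 := by
  simp only [reparamDefect, ← h.apply_zero, hW, h0, Derivation.leibniz, smul_eq_mul,
    Derivation.map_intCast]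
  simp
  ring

/-- The defect is driven by the third-order expression `ζ'' + 4 q ζ + W q`. -/
theorem IsForm.reparamDefect_add_two (h : IsForm D q d p) {ζ : R}
    (hW : ∀ f, W (D f) = D (W f) - 2 * ζ * D f) (i : ℕ) :
    reparamDefect W D d ζ p (i + 2) = D (reparamDefect W D d ζ p (i + 1))
      + (i + 1) * (d - i) * ((D (D ζ) + 4 * q * ζ + W q) * p i
        + q * reparamDefect W D d ζ p i) := by
  have e : p (i + 2) = D (p (i + 1)) + (i + 1) * (d - i) * q * p i := by
    rw [h.apply_succ]; ring
  have hWp : W (p (i + 2)) = D (W (p (i + 1))) - 2 * ζ * D (p (i + 1))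
      + (i + 1) * (d - i) * (W q * p i + q * W (p i)) := by
    rw [e, map_add, hW]
    simp only [map_sub, Derivation.leibniz, smul_eq_mul, Derivation.map_natCast,
      Derivation.map_intCast, map_add, Derivation.map_one_eq_zero]
    ring
  have h2 : D (2 : R) = 0 := by exact_mod_cast D.map_natCast 2
  simp only [reparamDefect, hWp, map_sub, Derivation.leibniz, smul_eq_mul, Derivation.map_natCast,
    Derivation.map_intCast, map_add, Derivation.map_one_eq_zero, h.apply_succ, h i,
    Nat.add_sub_cancel, Nat.reduceSubDiff, h2]
  push_cast
  ring

end Form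

namespace FunctionAlgebra

variable {K : Type u} [Field K] {m : ℕ} {𝒜 : FunctionAlgebra K m}

/-! ### The three kinds of symmetries -/

variable (𝒜) in
/-- The vector field `ξ ∂/∂x + ½ (n-1) ξ' ∑ y_j ∂/∂y_j`: its flow multiplies the `y_j` by the
power `(n-1)/2` of the `x`-derivative of its flow in `x`. For `ξ = v²`, `-u²` and `2 u v` these are
`F_p`, `F_m` and `F_z`. -/
def projectiveField (n : ℕ) : 𝒜.carrier →ₗ[K] Derivation K 𝒜.carrier 𝒜.carrier :=
  𝒜.vectorField.comp (LinearMap.prod LinearMap.id (LinearMap.pi fun j =>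
    (1 / 2 : K) • (LinearMap.mulLeft K (((n : 𝒜.carrier) - 1) * 𝒜.y j)).comp
      (𝒜.dx : 𝒜.carrier →ₗ[K] 𝒜.carrier)))

variable (𝒜) in
/-- The linear vector field `∑ c_{ij} y_i ∂/∂y_j`. -/
def linearField : Matrix (Fin m) (Fin m) K →ₗ[K] Derivation K 𝒜.carrier 𝒜.carrier :=
  𝒜.vectorField.comp (LinearMap.prod 0
    { toFun := fun c j => ∑ i, c i j • 𝒜.y i
      map_add' := fun c c' => by
        funext j; simp [add_smul, Finset.sum_add_distrib]
      map_smul' := fun a c => by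
        funext j; simp [mul_smul, Finset.smul_sum] })

variable (𝒜) in
/-- The vector field `∑ b_j ∂/∂y_j`. -/
def translationField : (Fin m → 𝒜.carrier) →ₗ[K] Derivation K 𝒜.carrier 𝒜.carrier :=
  𝒜.vectorField.comp (LinearMap.inr K _ _)

theorem isVectorField_projectiveField (n : ℕ) (ξ : 𝒜.carrier) :
    𝒜.IsVectorField (𝒜.projectiveField n ξ) := isVectorField_vectorField _

theorem isVectorField_linearField (c : Matrix (Fin m) (Fin m) K) :
    𝒜.IsVectorField (𝒜.linearField c) := isVectorField_vectorField _

theorem isVectorField_translationField (b : Fin m → 𝒜.carrier) :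
    𝒜.IsVectorField (𝒜.translationField b) := isVectorField_vectorField _

@[simp] theorem projectiveField_x (n : ℕ) (ξ : 𝒜.carrier) : 𝒜.projectiveField n ξ 𝒜.x = ξ :=
  vectorField_x _

@[simp] theorem projectiveField_y (n : ℕ) (ξ : 𝒜.carrier) (j : Fin m) :
    𝒜.projectiveField n ξ (𝒜.y j) = ((n : 𝒜.carrier) - 1) * ((1 / 2 : K) • 𝒜.dx ξ) * 𝒜.y j := by
  refine (vectorField_y _ j).trans ?_
  simp only [LinearMap.prod_apply, Function.prod_apply, LinearMap.pi_apply, LinearMap.smul_apply,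
    LinearMap.comp_apply, LinearMap.mulLeft_apply, Derivation.coeFn_coe]
  rw [mul_smul_comm, smul_mul_assoc]
  congr 1
  ring

@[simp] theorem linearField_x (c : Matrix (Fin m) (Fin m) K) : 𝒜.linearField c 𝒜.x = 0 :=
  vectorField_x _

@[simp] theorem linearField_y (c : Matrix (Fin m) (Fin m) K) (j : Fin m) :
    𝒜.linearField c (𝒜.y j) = ∑ i, c i j • 𝒜.y i := vectorField_y _ j

@[simp] theorem translationField_x (b : Fin m → 𝒜.carrier) : 𝒜.translationField b 𝒜.x = 0 :=
  vectorField_x _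

@[simp] theorem translationField_y (b : Fin m → 𝒜.carrier) (j : Fin m) :
    𝒜.translationField b (𝒜.y j) = b j := vectorField_y _ j

theorem IsVectorField.apply_of_dependsOnX {v : Derivation K 𝒜.carrier 𝒜.carrier}
    (hv : 𝒜.IsVectorField v) {f : 𝒜.carrier} (hf : 𝒜.DependsOnX f) : v f = v 𝒜.x * 𝒜.dx f := by
  have h : ∀ j, 𝒜.dy j f = 0 := hf
  simp [hv.apply f, h]

theorem two_mul_half_smul [CharZero K] (f : 𝒜.carrier) : 2 * ((1 / 2 : K) • f) = f := by
  have h : (2 : 𝒜.carrier) = algebraMap K 𝒜.carrier 2 := (map_ofNat _ 2).symm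
  rw [h, ← Algebra.smul_def, smul_smul]
  norm_num

namespace CanonicalSystem

variable {n : ℕ} (𝓔 : 𝒜.CanonicalSystem n)

/-- The left-hand side `½ ξ''' + 2 q ξ' + q' ξ` of the equation satisfied by the products of two
solutions of the source equation. -/
def symSquare (ξ : 𝒜.carrier) : 𝒜.carrier :=
  𝒜.dx (𝒜.dx ((1 / 2 : K) • 𝒜.dx ξ)) + 4 * 𝓔.source * ((1 / 2 : K) • 𝒜.dx ξ)
    + ξ * 𝒜.dx 𝓔.source

theorem symSquare_dependsOnX {ξ : 𝒜.carrier} (hξ : 𝒜.DependsOnX ξ) :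
    𝒜.DependsOnX (𝓔.symSquare ξ) :=
  (((hξ.dx.smul _).dx.dx).add
    (((by exact_mod_cast dependsOnX_natCast (𝒜 := 𝒜) 4 : 𝒜.DependsOnX (4 : 𝒜.carrier)).mul
      𝓔.source_dependsOnX).mul (hξ.dx.smul _))).add (hξ.mul 𝓔.source_dependsOnX.dx)

/-- The defect of the form of `y_j` under the prolongation of the projective field of `ξ`. -/
def defect (ξ : 𝒜.carrier) (j : Fin m) : ℕ → 𝒜.Jet :=
  reparamDefect (𝒜.prolongD (𝒜.projectiveField n ξ)) 𝒜.totalD (n - 1)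
    (MvPolynomial.C ((1 / 2 : K) • 𝒜.dx ξ)) (𝓔.jetForm (𝒜.jet 0 j))

theorem prolongD_projectiveField_jet (ξ : 𝒜.carrier) (j : Fin m) :
    𝒜.prolongD (𝒜.projectiveField n ξ) (𝒜.jet 0 j) = (((n : ℤ) - 1 : ℤ) : 𝒜.Jet)
      * MvPolynomial.C ((1 / 2 : K) • 𝒜.dx ξ) * 𝒜.jet 0 j := by
  rw [prolongD_jet, prolongCoeff, projectiveField_y, map_mul, map_mul, jet]
  congr 2
  simp

theorem prolongD_projectiveField_totalD [CharZero K] {ξ : 𝒜.carrier} (hξ : 𝒜.DependsOnX ξ)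
    (P : 𝒜.Jet) : 𝒜.prolongD (𝒜.projectiveField n ξ) (𝒜.totalD P) =
      𝒜.totalD (𝒜.prolongD (𝒜.projectiveField n ξ) P)
        - 2 * MvPolynomial.C ((1 / 2 : K) • 𝒜.dx ξ) * 𝒜.totalD P := by
  rw [(isVectorField_projectiveField n ξ).prolongD_totalD, projectiveField_x,
    totalD_C_of_dependsOnX _ hξ]
  have h : (2 : 𝒜.Jet) = MvPolynomial.C 2 := (map_ofNat _ 2).symm
  rw [h, ← map_mul, two_mul_half_smul]

theorem defect_zero (ξ : 𝒜.carrier) (j : Fin m) : 𝓔.defect ξ j 0 = 0 := by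
  refine reparamDefect_zero ?_
  rw [jetForm_zero, prolongD_projectiveField_jet]

theorem defect_one [CharZero K] {ξ : 𝒜.carrier} (hξ : 𝒜.DependsOnX ξ) (j : Fin m) :
    𝓔.defect ξ j 1 = 0 := by
  refine (𝓔.isForm_jetForm _).reparamDefect_one (prolongD_projectiveField_totalD hξ) ?_
  rw [jetForm_zero, prolongD_projectiveField_jet]

/-- The recursion of the defect; it vanishes identically if `½ ξ''' + 2 q ξ' + q' ξ` does. -/
theorem defect_add_two [CharZero K] {ξ : 𝒜.carrier} (hξ : 𝒜.DependsOnX ξ) (j : Fin m) (i : ℕ) :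
    𝓔.defect ξ j (i + 2) = 𝒜.totalD (𝓔.defect ξ j (i + 1))
      + MvPolynomial.C ((((i + 1) * (n - 1 - i) : ℤ)) : 𝒜.carrier)
        * (MvPolynomial.C (𝓔.symSquare ξ) * 𝓔.jetForm (𝒜.jet 0 j) i
          + MvPolynomial.C 𝓔.source * 𝓔.defect ξ j i) := by
  have h := (𝓔.isForm_jetForm (𝒜.jet 0 j)).reparamDefect_add_two
    (prolongD_projectiveField_totalD (n := n) hξ) i
  have hρ : MvPolynomial.C (𝓔.symSquare ξ) =
      𝒜.totalD (𝒜.totalD (MvPolynomial.C ((1 / 2 : K) • 𝒜.dx ξ)))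
      + 4 * MvPolynomial.C 𝓔.source * MvPolynomial.C ((1 / 2 : K) • 𝒜.dx ξ)
      + 𝒜.prolongD (𝒜.projectiveField n ξ) (MvPolynomial.C 𝓔.source) := by
    rw [totalD_C_of_dependsOnX _ (hξ.dx.smul _), totalD_C_of_dependsOnX _ (hξ.dx.smul _).dx,
      (isVectorField_projectiveField n ξ).prolongD_C,
      (isVectorField_projectiveField n ξ).apply_of_dependsOnX 𝓔.source_dependsOnX,
      projectiveField_x, symSquare]
    simp only [map_add, map_mul, map_ofNat]
  rw [hρ]
  have hc : (MvPolynomial.C ((((i + 1) * (n - 1 - i) : ℤ)) : 𝒜.carrier) : 𝒜.Jet)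
      = ((i : 𝒜.Jet) + 1) * ((((n : ℤ) - 1 : ℤ) : 𝒜.Jet) - (i : 𝒜.Jet)) := by
    rw [map_intCast]; push_cast; ring
  rw [hc]
  exact h

/-- At the index `n` of a form of degree `n - 1`, the factor `d - i + 1` is zero, and a projective
field maps `Δ_j` to a multiple of itself up to the defect. -/
theorem prolongD_projectiveField_lhs (ξ : 𝒜.carrier) (j : Fin m) :
    𝒜.prolongD (𝒜.projectiveField n ξ) (𝓔.lhs j) =
      -(((n : ℤ) + 1 : ℤ) : 𝒜.Jet) * MvPolynomial.C ((1 / 2 : K) • 𝒜.dx ξ) * 𝓔.lhs j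
        + 𝓔.defect ξ j n := by
  rw [lhs_eq, defect, reparamDefect]
  push_cast
  ring

theorem defect_eq_zero [CharZero K] {ξ : 𝒜.carrier} (hξ : 𝒜.DependsOnX ξ)
    (h : 𝓔.symSquare ξ = 0) (j : Fin m) (i : ℕ) : 𝓔.defect ξ j i = 0 := by
  have key : ∀ i, 𝓔.defect ξ j i = 0 ∧ 𝓔.defect ξ j (i + 1) = 0 := by
    intro i
    induction i with
    | zero => exact ⟨𝓔.defect_zero ξ j, 𝓔.defect_one hξ j⟩
    | succ i ih =>
      refine ⟨ih.2, ?_⟩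
      rw [add_assoc, 𝓔.defect_add_two hξ, ih.1, ih.2, h]
      simp only [map_zero, zero_mul, mul_zero, add_zero]
  exact (key i).1

/-- The defect with index `i + 2` has order at most `i`. -/
theorem partialD_defect_of_lt [CharZero K] {ξ : 𝒜.carrier} (hξ : 𝒜.DependsOnX ξ) (i j : Fin m)
    (l k : ℕ) (h : l < k + 2) : 𝒜.partialD k i (𝓔.defect ξ j l) = 0 := by
  have key : ∀ l, (∀ k, l < k + 2 → 𝒜.partialD k i (𝓔.defect ξ j l) = 0) ∧
      (∀ k, l + 1 < k + 2 → 𝒜.partialD k i (𝓔.defect ξ j (l + 1)) = 0) := by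
    intro l
    induction l with
    | zero =>
      exact ⟨fun k _ => by rw [defect_zero, map_zero],
        fun k _ => by rw [zero_add, 𝓔.defect_one hξ, map_zero]⟩
    | succ l ih =>
      refine ⟨ih.2, fun k hk => ?_⟩
      obtain ⟨k, rfl⟩ : ∃ k', k = k' + 1 := ⟨k - 1, by omega⟩
      rw [add_assoc, 𝓔.defect_add_two hξ, map_add, partialD_succ_totalD, Derivation.leibniz,
        map_add, Derivation.leibniz, Derivation.leibniz, ih.1 _ (by omega), ih.2 _ (by omega),
        ih.2 _ (by omega), 𝓔.partialD_jetForm _ _ _ _ (by omega), if_neg (by omega)]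
      simp
  exact (key l).1 k h

/-- The leading coefficient of the defect with index `i + 2`: the recursion adds the multiple
`s (n - s)` of `½ ξ''' + 2 q ξ' + q' ξ` at each step, with `s = i + 1`. -/
theorem partialD_defect [CharZero K] {ξ : 𝒜.carrier} (hξ : 𝒜.DependsOnX ξ) (j : Fin m) (i : ℕ) :
    𝒜.partialD i j (𝓔.defect ξ j (i + 2)) = MvPolynomial.C
      (((∑ s ∈ Finset.range (i + 2), (s : ℤ) * (n - s) : ℤ) : 𝒜.carrier) * 𝓔.symSquare ξ) := by
  have hρ := 𝓔.symSquare_dependsOnX hξ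
  have hstep : ∀ i, 𝒜.partialD i j (MvPolynomial.C ((((i + 1) * (n - 1 - i) : ℤ)) : 𝒜.carrier)
        * (MvPolynomial.C (𝓔.symSquare ξ) * 𝓔.jetForm (𝒜.jet 0 j) i
          + MvPolynomial.C 𝓔.source * 𝓔.defect ξ j i))
      = MvPolynomial.C (((((i + 1 : ℕ) : ℤ) * (n - (i + 1 : ℕ)) : ℤ) : 𝒜.carrier)
          * 𝓔.symSquare ξ) := by
    intro i
    rw [Derivation.leibniz, map_add, Derivation.leibniz, Derivation.leibniz,
      𝓔.partialD_jetForm _ _ _ _ le_rfl, 𝒜.partialD_C_of_dependsOnX _ _ hρ,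
      𝒜.partialD_C_of_dependsOnX _ _ (dependsOnX_intCast _),
      𝓔.partialD_C_source, 𝓔.partialD_defect_of_lt hξ _ _ _ _ (by omega)]
    simp only [smul_eq_mul, map_mul, true_and, if_true, mul_one, mul_zero, add_zero]
    congr 3
    push_cast
    ring
  induction i with
  | zero =>
    rw [𝓔.defect_add_two hξ, map_add, partialD_zero_totalD, 𝓔.partialD_defect_of_lt hξ _ _ _ _
      (by omega), map_zero, zero_add, hstep]
    simp [Finset.sum_range_succ]
  | succ i ih =>
    rw [𝓔.defect_add_two hξ, map_add, partialD_succ_totalD, 𝓔.partialD_defect_of_lt hξ _ _ _ _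
      (by omega), map_zero, zero_add, hstep, ih, ← map_add, ← add_mul,
      Finset.sum_range_succ _ (i + 2)]
    congr 2
    push_cast
    ring

/-- Linear fields with constant coefficients commute with `D_x`, and the form of `y_j` is linear in
`y_j`. -/
theorem prolongD_linearField_lhs (c : Matrix (Fin m) (Fin m) K) (j : Fin m) :
    𝒜.prolongD (𝒜.linearField c) (𝓔.lhs j) = ∑ i, c i j • 𝓔.lhs i := by
  have h : (fun i => 𝒜.prolongD (𝒜.linearField c) (𝓔.jetForm (𝒜.jet 0 j) i))
      = 𝓔.jetForm (∑ i, c i j • 𝒜.jet 0 i) := by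
    refine ((𝓔.isForm_jetForm _).map_derivation (fun f => ?_) ?_).ext (𝓔.isForm_jetForm _) ?_
    · rw [(isVectorField_linearField c).prolongD_totalD, linearField_x, map_zero, map_zero,
        zero_mul, sub_zero]
    · rw [(isVectorField_linearField c).prolongD_C,
        (isVectorField_linearField c).apply_of_dependsOnX 𝓔.source_dependsOnX, linearField_x,
        zero_mul, map_zero]
    · rw [jetForm_zero, jetForm_zero, prolongD_jet, prolongCoeff, linearField_y, map_sum]
      exact Finset.sum_congr rfl fun i _ => C_const_smul _ _
  rw [lhs_eq, congrFun h n]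
  simp only [lhs_eq]
  exact (map_sum (𝓔.jetFormₗ n) _ _).trans
    (Finset.sum_congr rfl fun i _ => map_smul (𝓔.jetFormₗ n) _ _)

theorem prolongD_translationField_lhs {b : Fin m → 𝒜.carrier} (hb : ∀ j, 𝒜.DependsOnX (b j))
    (j : Fin m) :
    𝒜.prolongD (𝒜.translationField b) (𝓔.lhs j) = MvPolynomial.C (𝓔.form (b j) n) := by
  have h : (fun i => 𝒜.prolongD (𝒜.translationField b) (𝓔.jetForm (𝒜.jet 0 j) i))
      = 𝓔.jetForm (MvPolynomial.C (b j)) := by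
    refine ((𝓔.isForm_jetForm _).map_derivation (fun f => ?_) ?_).ext (𝓔.isForm_jetForm _) ?_
    · rw [(isVectorField_translationField b).prolongD_totalD, translationField_x, map_zero,
        map_zero, zero_mul, sub_zero]
    · rw [(isVectorField_translationField b).prolongD_C,
        (isVectorField_translationField b).apply_of_dependsOnX 𝓔.source_dependsOnX,
        translationField_x, zero_mul, map_zero]
    · rw [jetForm_zero, jetForm_zero, prolongD_jet, prolongCoeff, translationField_y]
  rw [lhs_eq, congrFun h n]
  exact (congrFun (𝓔.C_form (hb j)) n).symm

/-! ### The determining equations -/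

/-- Only the leading term of `Δ_j` contributes, since the term in `y_j^{(n-1)}` is absent. -/
theorem partialD_prolongD_lhs (hn : 3 ≤ n) {v : Derivation K 𝒜.carrier 𝒜.carrier}
    (hv : 𝒜.IsVectorField v) (i j : Fin m) :
    𝒜.partialD (n - 1) i (𝒜.prolongD v (𝓔.lhs j)) =
      𝒜.partialD (n - 1) i (𝒜.prolongCoeff v n j) := by
  obtain ⟨k, rfl⟩ : ∃ k, n = k + 3 := ⟨n - 3, by omega⟩
  rw [lhs, isotropicLHS, map_add, map_add, prolongD_jet, add_eq_left, map_sum, map_sum]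
  refine Finset.sum_eq_zero fun l hl => ?_
  rw [Finset.mem_Icc] at hl
  rw [Derivation.leibniz, hv.prolongD_C, prolongD_jet, map_add, smul_eq_mul, smul_eq_mul,
    Derivation.leibniz, Derivation.leibniz, partialD_prolongCoeff_of_lt _ _ _ _ _ (by omega),
    partialD_jet_of_ne _ _ (by omega), show k + 3 - 1 = k + 1 + 1 by omega, partialD_succ_C,
    partialD_succ_C]
  simp

theorem onSol_totalD_C (hn : 3 ≤ n) (f : 𝒜.carrier) :
    𝓔.onSol (𝒜.totalD (MvPolynomial.C f)) = 𝒜.totalD (MvPolynomial.C f) := by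
  rw [totalD_C, map_add, map_sum, onSol_C]
  congr 1
  exact Finset.sum_congr rfl fun j _ => by
    rw [map_mul, onSol_C, 𝓔.onSol_jet_of_ne (by omega)]

/-- The determining equations obtained from the coefficients of `y_i^{(n-1)}`. Restricting to the
solution manifold does not change these, because `y_j^{(n)}` is replaced by terms of order at most
`n - 2` and the coefficients have order at most two, which is less than `n`. -/
theorem IsPointSymmetry.totalD_eq (hn : 3 ≤ n) {v : Derivation K 𝒜.carrier 𝒜.carrier}
    (hv : 𝓔.IsPointSymmetry v) (i j : Fin m) :
    (n : 𝒜.Jet) * 𝒜.totalD (MvPolynomial.C (𝒜.dy i (v (𝒜.y j)))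
        - 𝒜.jet 1 j * MvPolynomial.C (𝒜.dy i (v 𝒜.x)))
      - (if j = i then ((n.choose 2 : ℕ) : 𝒜.Jet)
          * 𝒜.totalD (𝒜.totalD (MvPolynomial.C (v 𝒜.x))) else 0) = 0 := by
  have h := congrArg (𝒜.partialD (n - 1) i) (hv.2 j)
  rw [onSolutions_eq, ← coe_prolongD, 𝓔.partialD_onSol (by omega) _ (by omega),
    Finset.sum_eq_zero fun k _ => by rw [𝓔.partialD_onSol_jet (by omega) _ (by omega), mul_zero],
    add_zero, 𝓔.partialD_prolongD_lhs hn hv.1, map_zero] at h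
  obtain ⟨k, rfl⟩ : ∃ k, n = k + 2 := ⟨n - 2, by omega⟩
  rw [show k + 2 - 1 = k + 1 by omega, partialD_prolongCoeff_subtop] at h
  have h1 : 𝓔.onSol (𝒜.jet 1 j) = 𝒜.jet 1 j := 𝓔.onSol_jet_of_ne (by omega) _
  have hDD : 𝓔.onSol (𝒜.totalD (𝒜.totalD (MvPolynomial.C (v 𝒜.x))))
      = 𝒜.totalD (𝒜.totalD (MvPolynomial.C (v 𝒜.x))) := by
    simp only [totalD_C (f := v 𝒜.x), map_add, map_sum, Derivation.leibniz, totalD_jet,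
      𝓔.onSol_totalD_C hn, smul_eq_mul, map_mul, onSol_C]
    congr 1
    refine Finset.sum_congr rfl fun l _ => ?_
    rw [𝓔.onSol_jet_of_ne (by omega), 𝓔.onSol_jet_of_ne (by omega)]
  refine Eq.trans (Eq.symm ?_) h
  simp only [map_sub, map_mul, map_natCast, Derivation.leibniz, smul_eq_mul, map_add, totalD_jet,
    𝓔.onSol_totalD_C hn, h1, onSol_C, apply_ite 𝓔.onSol, hDD, map_zero]
  rw [𝓔.onSol_jet_of_ne (by omega)]

theorem natCast_mul_eq_zero [CharZero K] {k : ℕ} (hk : k ≠ 0) {f : 𝒜.carrier}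
    (h : (k : 𝒜.carrier) * f = 0) : f = 0 := by
  have h' : (k : K) • f = 0 := by rw [Nat.cast_smul_eq_nsmul, nsmul_eq_mul, h]
  rw [← inv_smul_smul₀ (Nat.cast_ne_zero.2 hk : (k : K) ≠ 0) f, h', smul_zero]

theorem C_eq_zero {f : 𝒜.carrier} (h : (MvPolynomial.C f : 𝒜.Jet) = 0) : f = 0 :=
  (MvPolynomial.C_injective _ _) (h.trans (map_zero _).symm)

/-- The infinitesimal transformation of the independent variable is a function of `x` alone: the
coefficient of `y_i''` in the determining equation with `i = j` is
`-(n + n (n - 1) / 2) ∂ξ/∂y_i`. -/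
theorem IsPointSymmetry.dependsOnX [CharZero K] (hn : 3 ≤ n)
    {v : Derivation K 𝒜.carrier 𝒜.carrier} (hv : 𝓔.IsPointSymmetry v) :
    𝒜.DependsOnX (v 𝒜.x) := by
  intro i
  have e1 : 𝒜.partialD 2 i (𝒜.totalD (MvPolynomial.C (𝒜.dy i (v (𝒜.y i)))
      - 𝒜.jet 1 i * MvPolynomial.C (𝒜.dy i (v 𝒜.x)))) = -MvPolynomial.C (𝒜.dy i (v 𝒜.x)) := by
    have j1 : 𝒜.partialD 1 i (𝒜.jet 1 i) = 1 := by rw [partialD_jet, if_pos ⟨rfl, rfl⟩]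
    have j2 : 𝒜.partialD 2 i (𝒜.jet 1 i) = 0 := partialD_jet_of_ne _ _ (by omega)
    rw [partialD_succ_totalD]
    simp only [map_sub, Derivation.leibniz, partialD_succ_C, j1, j2]
    simp
  have e2 : 𝒜.partialD 2 i (𝒜.totalD (𝒜.totalD (MvPolynomial.C (v 𝒜.x))))
      = MvPolynomial.C (𝒜.dy i (v 𝒜.x)) := by
    rw [partialD_succ_totalD, partialD_totalD_C 0, partialD_one_totalD_C, map_zero, zero_add]
  have h := congrArg (𝒜.partialD 2 i) (hv.totalD_eq 𝓔 hn i i)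
  rw [if_pos rfl, map_zero, map_sub, Derivation.leibniz, Derivation.leibniz, Derivation.map_natCast,
    Derivation.map_natCast, e1, e2] at h
  simp only [smul_eq_mul, mul_zero, add_zero] at h
  refine natCast_mul_eq_zero (k := n + n.choose 2) (by omega) (C_eq_zero ?_)
  rw [map_mul, map_natCast]
  push_cast
  linear_combination -h

/-- The coefficients of `∂/∂y_j` are affine in the dependent variables, and their linear parts are
those of a projective field up to constants. -/
theorem IsPointSymmetry.dependsOnX_dy [CharZero K] (hn : 3 ≤ n)
    {v : Derivation K 𝒜.carrier 𝒜.carrier} (hv : 𝓔.IsPointSymmetry v) (i j : Fin m) :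
    𝒜.DependsOnX (𝒜.dy i (v (𝒜.y j))) ∧ 𝒜.dx (𝒜.dy i (v (𝒜.y j)))
      = if j = i then ((n : 𝒜.carrier) - 1) * ((1 / 2 : K) • 𝒜.dx (𝒜.dx (v 𝒜.x))) else 0 := by
  have hx := hv.dependsOnX 𝓔 hn
  have h := hv.totalD_eq 𝓔 hn i j
  rw [hx i, map_zero, mul_zero, sub_zero, totalD_C_of_dependsOnX _ hx,
    totalD_C_of_dependsOnX _ hx.dx] at h
  have hdep : 𝒜.DependsOnX (𝒜.dy i (v (𝒜.y j))) := by
    intro k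
    have h' := congrArg (𝒜.partialD 1 k) h
    rw [map_sub, Derivation.leibniz, Derivation.map_natCast, partialD_one_totalD_C,
      apply_ite (𝒜.partialD 1 k), Derivation.leibniz, Derivation.map_natCast, partialD_succ_C,
      map_zero] at h'
    refine natCast_mul_eq_zero (k := n) (by omega) (C_eq_zero ?_)
    rw [map_mul, map_natCast]
    simpa using h'
  refine ⟨hdep, ?_⟩
  rw [totalD_C_of_dependsOnX _ hdep] at h
  rw [← sub_eq_zero]
  refine natCast_mul_eq_zero (k := n) (by omega) (C_eq_zero ?_)
  rw [map_mul, map_natCast, map_sub, apply_ite (MvPolynomial.C (R := 𝒜.carrier) (σ := ℕ × Fin m)),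
    mul_sub, mul_ite, map_zero, mul_zero]
  refine Eq.trans ?_ h
  congr 1
  split_ifs
  · have hc : ((n.choose 2 : ℕ) : 𝒜.carrier) * 2 = n * (n - 1) := by
      have h2 : n.choose 2 * 2 = n * (n - 1) := by
        rw [Nat.choose_two_right]
        exact Nat.div_mul_cancel (Nat.even_mul_pred_self n).two_dvd
      have h3 : ((n - 1 : ℕ) : 𝒜.carrier) = n - 1 := by
        rw [Nat.cast_sub (by omega), Nat.cast_one]
      rw [← h3]
      rw [← Nat.cast_mul, ← h2, Nat.cast_mul, Nat.cast_ofNat]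
    rw [← map_natCast (MvPolynomial.C (R := 𝒜.carrier) (σ := ℕ × Fin m)),
      ← map_natCast (MvPolynomial.C (R := 𝒜.carrier) (σ := ℕ × Fin m)), ← map_mul, ← map_mul]
    congr 1
    rw [← mul_assoc, ← hc, mul_assoc, two_mul_half_smul]
  · rfl

/-- A point symmetry is the sum of a projective field, a linear field with constant coefficients
and a translation by functions of `x` alone. -/
theorem IsPointSymmetry.exists_eq [CharZero K] (hn : 3 ≤ n)
    {v : Derivation K 𝒜.carrier 𝒜.carrier} (hv : 𝓔.IsPointSymmetry v) :
    ∃ (ξ : 𝒜.carrier) (c : Matrix (Fin m) (Fin m) K) (b : Fin m → 𝒜.carrier),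
      𝒜.DependsOnX ξ ∧ (∀ j, 𝒜.DependsOnX (b j)) ∧
      v = 𝒜.projectiveField n ξ + 𝒜.linearField c + 𝒜.translationField b := by
  have hx := hv.dependsOnX 𝓔 hn
  have hconst : ∀ i j, ∃ a : K, 𝒜.dy i (v (𝒜.y j)) = algebraMap K 𝒜.carrier a
      + if j = i then ((n : 𝒜.carrier) - 1) * ((1 / 2 : K) • 𝒜.dx (v 𝒜.x)) else 0 := by
    intro i j
    obtain ⟨h1, h2⟩ := hv.dependsOnX_dy 𝓔 hn i j
    have hN : 𝒜.DependsOnX ((n : 𝒜.carrier) - 1) := by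
      exact_mod_cast dependsOnX_intCast (𝒜 := 𝒜) ((n : ℤ) - 1)
    have hN' : 𝒜.dx ((n : 𝒜.carrier) - 1) = 0 := by
      rw [map_sub, Derivation.map_natCast, Derivation.map_one_eq_zero, sub_zero]
    obtain ⟨a, ha⟩ := 𝒜.eq_const (𝒜.dy i (v (𝒜.y j))
      - if j = i then ((n : 𝒜.carrier) - 1) * ((1 / 2 : K) • 𝒜.dx (v 𝒜.x)) else 0)
      (by
        rw [map_sub, h2]
        split_ifs
        · rw [Derivation.leibniz, hN', Derivation.map_smul]
          simp
        · simp)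
      (fun k => by
        rw [map_sub, h1 k]
        split_ifs
        · rw [(hN.mul (hx.dx.smul _)) k, sub_zero]
        · simp)
    exact ⟨a, by rw [← ha]; ring⟩
  choose a ha using hconst
  refine ⟨v 𝒜.x, Matrix.of a, fun j => v (𝒜.y j) - ∑ i, 𝒜.dy i (v (𝒜.y j)) * 𝒜.y i, hx,
    fun j k => ?_, ?_⟩
  · have h : ∀ i l, 𝒜.dy l (𝒜.dy i (v (𝒜.y j))) = 0 :=
      fun i l => (hv.dependsOnX_dy 𝓔 hn i j).1 l
    simp [Derivation.leibniz, h, 𝒜.dy_y]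
  · refine hv.1.ext (((isVectorField_projectiveField _ _).add (isVectorField_linearField _)).add
      (isVectorField_translationField _)) (by simp) fun j => ?_
    simp only [Derivation.add_apply, projectiveField_y, linearField_y, translationField_y,
      Matrix.of_apply, ha, add_mul, Finset.sum_add_distrib, ite_mul, zero_mul,
      Algebra.smul_def]
    simp
    ring

/-- The remaining determining equations, for `ξ` and for the translations. On the solution manifold
only the defect of the projective field and the values of the scalar operator at the `b_j` are left;
the latter depend on `x` alone, and the coefficient of `y_j^{(n-2)}` in the former is a positive
multiple of `½ ξ''' + 2 q ξ' + q' ξ`. -/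
theorem IsPointSymmetry.symSquare_eq_zero [CharZero K] (hn : 3 ≤ n) (hm : 1 ≤ m)
    {ξ : 𝒜.carrier} {c : Matrix (Fin m) (Fin m) K} {b : Fin m → 𝒜.carrier}
    (hξ : 𝒜.DependsOnX ξ) (hb : ∀ j, 𝒜.DependsOnX (b j))
    (hv : 𝓔.IsPointSymmetry
      (𝒜.projectiveField n ξ + 𝒜.linearField c + 𝒜.translationField b)) :
    𝓔.symSquare ξ = 0 ∧ ∀ j, 𝓔.form (b j) n = 0 := by
  have h : ∀ j, 𝓔.onSol (𝓔.defect ξ j n) + MvPolynomial.C (𝓔.form (b j) n) = 0 := by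
    intro j
    have h := hv.2 j
    rw [← coe_prolongD, ← prolongₗ_apply, map_add, map_add] at h
    simp only [prolongₗ_apply, Derivation.add_apply, 𝓔.prolongD_projectiveField_lhs,
      𝓔.prolongD_linearField_lhs, 𝓔.prolongD_translationField_lhs hb, onSolutions_eq, map_add,
      map_mul, map_sum, 𝓔.onSol_lhs (show n ≠ 0 by omega), mul_zero, zero_add, onSol_C] at h
    have h0 : ∀ (a : K) i, 𝓔.onSol (a • 𝓔.lhs i) = 0 := fun a i => by
      rw [← algebraMap_smul 𝒜.carrier a, map_smul, 𝓔.onSol_lhs (by omega), smul_zero]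
    simpa only [h0, Finset.sum_const_zero, add_zero] using h
  have hρ : 𝓔.symSquare ξ = 0 := by
    let j : Fin m := ⟨0, hm⟩
    obtain ⟨k, rfl⟩ : ∃ k, n = k + 2 := ⟨n - 2, by omega⟩
    have h' := congrArg (𝒜.partialD k j) (h j)
    rw [map_add, 𝒜.partialD_C_of_dependsOnX _ _
      (dependsOnX_of_isForm 𝓔.source_dependsOnX (𝓔.isForm_form _)
        (by rw [form_zero]; exact hb j) _),
      add_zero, 𝓔.partialD_onSol (by omega) _ (by omega), Finset.sum_eq_zero fun l _ => by
        rw [𝓔.partialD_defect_of_lt hξ _ _ _ _ (by omega), map_zero, zero_mul],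
      add_zero, 𝓔.partialD_defect hξ, onSol_C, map_zero] at h'
    have hpos : 0 < ∑ s ∈ Finset.range (k + 2), (s : ℤ) * ((k + 2 : ℕ) - s) := by
      refine Finset.sum_pos' (fun s hs => ?_) ⟨1, by simp, by push_cast; omega⟩
      rw [Finset.mem_range] at hs
      exact mul_nonneg (by omega) (by omega)
    obtain ⟨N, hN⟩ := Int.eq_ofNat_of_zero_le hpos.le
    rw [hN] at h' hpos
    exact natCast_mul_eq_zero (k := N) (by omega) (by exact_mod_cast C_eq_zero h')
  refine ⟨hρ, fun j => C_eq_zero ?_⟩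
  have := h j
  rwa [𝓔.defect_eq_zero hξ hρ, map_zero, zero_add] at this

theorem isPointSymmetry_projectiveField [CharZero K] (hn : n ≠ 0) {ξ : 𝒜.carrier}
    (hξ : 𝒜.DependsOnX ξ) (h : 𝓔.symSquare ξ = 0) :
    𝓔.IsPointSymmetry (𝒜.projectiveField n ξ) := by
  refine ⟨isVectorField_projectiveField _ _, fun j => ?_⟩
  rw [onSolutions_eq, ← coe_prolongD, 𝓔.prolongD_projectiveField_lhs, 𝓔.defect_eq_zero hξ h,
    add_zero, map_mul, 𝓔.onSol_lhs hn, mul_zero]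

theorem isPointSymmetry_linearField (hn : n ≠ 0) (c : Matrix (Fin m) (Fin m) K) :
    𝓔.IsPointSymmetry (𝒜.linearField c) := by
  refine ⟨isVectorField_linearField _, fun j => ?_⟩
  rw [onSolutions_eq, ← coe_prolongD, 𝓔.prolongD_linearField_lhs, map_sum]
  refine Finset.sum_eq_zero fun i _ => ?_
  rw [← algebraMap_smul 𝒜.carrier (c i j), map_smul, 𝓔.onSol_lhs hn, smul_zero]

theorem isPointSymmetry_translationField {b : Fin m → 𝒜.carrier} (hb : ∀ j, 𝒜.DependsOnX (b j))
    (h : ∀ j, 𝓔.form (b j) n = 0) : 𝓔.IsPointSymmetry (𝒜.translationField b) := by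
  refine ⟨isVectorField_translationField _, fun j => ?_⟩
  rw [onSolutions_eq, ← coe_prolongD, 𝓔.prolongD_translationField_lhs hb, h j, map_zero, map_zero]

theorem IsPointSymmetry.add {v w : Derivation K 𝒜.carrier 𝒜.carrier}
    (hv : 𝓔.IsPointSymmetry v) (hw : 𝓔.IsPointSymmetry w) : 𝓔.IsPointSymmetry (v + w) := by
  refine ⟨hv.1.add hw.1, fun j => ?_⟩
  have h1 := hv.2 j
  have h2 := hw.2 j
  rw [onSolutions_eq, ← coe_prolongD] at h1 h2 ⊢
  rw [← prolongₗ_apply, map_add, prolongₗ_apply, prolongₗ_apply, Derivation.add_apply, map_add,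
    h1, h2, add_zero]

theorem IsPointSymmetry.smul {v : Derivation K 𝒜.carrier 𝒜.carrier}
    (hv : 𝓔.IsPointSymmetry v) (a : K) : 𝓔.IsPointSymmetry (a • v) := by
  refine ⟨hv.1.smul a, fun j => ?_⟩
  have h1 := hv.2 j
  rw [onSolutions_eq, ← coe_prolongD] at h1 ⊢
  rw [← prolongₗ_apply, map_smul, prolongₗ_apply, Derivation.smul_apply,
    ← algebraMap_smul 𝒜.carrier a, map_smul, h1, smul_zero]

end CanonicalSystem

/-! ### The Euler operator -/

/-- A differential function depends on finitely many jet coordinates. -/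
theorem exists_partialD_eq_zero (P : 𝒜.Jet) (l : Fin m) :
    ∃ N, ∀ k, N ≤ k → 𝒜.partialD k l P = 0 := by
  induction P using MvPolynomial.induction_on with
  | C f =>
    refine ⟨1, fun k hk => ?_⟩
    obtain ⟨k, rfl⟩ : ∃ k', k = k' + 1 := ⟨k - 1, by omega⟩
    exact 𝒜.partialD_succ_C _ _ _
  | add P Q hP hQ =>
    obtain ⟨M, hM⟩ := hP
    obtain ⟨N, hN⟩ := hQ
    exact ⟨max M N, fun k hk => by
      rw [map_add, hM k (le_of_max_le_left hk), hN k (le_of_max_le_right hk), add_zero]⟩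
  | mul_X P p hP =>
    obtain ⟨M, hM⟩ := hP
    refine ⟨max M (p.1 + 2), fun k hk => ?_⟩
    have h : 𝒜.partialD k l (MvPolynomial.X p) = 0 :=
      partialD_jet_of_ne (l := p.1 + 1) l p.2 (by have := le_of_max_le_right hk; omega)
    rw [Derivation.leibniz, h, hM k (le_of_max_le_left hk)]
    simp

variable (𝒜) in
/-- The operator `-D_x`, as a linear map. -/
def negTotal : Module.End K 𝒜.Jet := -(𝒜.totalD : 𝒜.Jet →ₗ[K] 𝒜.Jet)

theorem negTotal_apply (P : 𝒜.Jet) : 𝒜.negTotal P = -𝒜.totalD P := rfl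

theorem negTotal_pow_apply (k : ℕ) (P : 𝒜.Jet) :
    (𝒜.negTotal ^ k) P = (-1) ^ k * 𝒜.totalDeriv^[k] P := by
  induction k with
  | zero => simp
  | succ k ih =>
    have h : 𝒜.totalD ((-1 : 𝒜.Jet) ^ k) = 0 := by
      rw [Derivation.leibniz_pow, map_neg, Derivation.map_one_eq_zero]; simp
    rw [pow_succ', Module.End.mul_apply, ih, negTotal_apply, Derivation.leibniz, h,
      Function.iterate_succ_apply', coe_totalD]
    simp only [smul_eq_mul, mul_zero, add_zero]
    ring

variable (𝒜) in
/-- The Euler operator `E_l` with weight `f`, `∑ (-D_x)ᵏ (f ∂P/∂y_l^{(k)})`: the adjoint of the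
linearization of `P` in the direction `y_l`, applied to `f`. For `f = 1` it is `E_l`. Integration
by parts, `weightedEuler_totalD`, moves total derivatives onto the weight. -/
def weightedEuler (l : Fin m) (f P : 𝒜.Jet) : 𝒜.Jet :=
  ∑ᶠ k : ℕ, (𝒜.negTotal ^ k) (f * 𝒜.partialD k l P)

theorem weightedEuler_eq_sum (l : Fin m) (f : 𝒜.Jet) {P : 𝒜.Jet} {N : ℕ}
    (h : ∀ k, N ≤ k → 𝒜.partialD k l P = 0) : 𝒜.weightedEuler l f P =
      ∑ k ∈ Finset.range N, (𝒜.negTotal ^ k) (f * 𝒜.partialD k l P) := by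
  refine finsum_eq_sum_of_support_subset _ fun k hk => ?_
  rw [Finset.coe_range, Set.mem_Iio]
  by_contra hkN
  exact hk (by simp only [h k (by omega), mul_zero, map_zero])

theorem euler_eq (l : Fin m) (P : 𝒜.Jet) : 𝒜.euler l P = 𝒜.weightedEuler l 1 P := by
  refine finsum_congr fun k => ?_
  rw [negTotal_pow_apply, one_mul, partialD_apply]

theorem weightedEuler_add (l : Fin m) (f P Q : 𝒜.Jet) : 𝒜.weightedEuler l f (P + Q) =
    𝒜.weightedEuler l f P + 𝒜.weightedEuler l f Q := by
  obtain ⟨M, hM⟩ := exists_partialD_eq_zero P l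
  obtain ⟨N, hN⟩ := exists_partialD_eq_zero Q l
  rw [weightedEuler_eq_sum l f (N := max M N) fun k hk => hM k (le_of_max_le_left hk),
    weightedEuler_eq_sum l f (N := max M N) fun k hk => hN k (le_of_max_le_right hk),
    weightedEuler_eq_sum l f (N := max M N) fun k hk => by
      rw [map_add, hM k (le_of_max_le_left hk), hN k (le_of_max_le_right hk), add_zero],
    ← Finset.sum_add_distrib]
  exact Finset.sum_congr rfl fun k _ => by rw [map_add, mul_add, map_add]

theorem weightedEuler_smul (l : Fin m) (f : 𝒜.Jet) (c : K) (P : 𝒜.Jet) :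
    𝒜.weightedEuler l f (c • P) = c • 𝒜.weightedEuler l f P := by
  obtain ⟨M, hM⟩ := exists_partialD_eq_zero P l
  rw [weightedEuler_eq_sum l f hM, weightedEuler_eq_sum l f (N := M) fun k hk => by
    rw [Derivation.map_smul, hM k hk, smul_zero], Finset.smul_sum]
  exact Finset.sum_congr rfl fun k _ => by rw [Derivation.map_smul, mul_smul_comm, map_smul]

variable (𝒜) in
/-- The Euler operator as a linear map. -/
def eulerₗ (l : Fin m) : 𝒜.Jet →ₗ[K] 𝒜.Jet where
  toFun := 𝒜.weightedEuler l 1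
  map_add' := weightedEuler_add l 1
  map_smul' := weightedEuler_smul l 1

theorem euler_eq_eulerₗ (l : Fin m) (P : 𝒜.Jet) : 𝒜.euler l P = 𝒜.eulerₗ l P := euler_eq l P

/-- Integration by parts: the adjoint of `D_x` is `-D_x`. -/
theorem weightedEuler_totalD (l : Fin m) (f P : 𝒜.Jet) : 𝒜.weightedEuler l f (𝒜.totalD P) =
    𝒜.weightedEuler l (-𝒜.totalD f) P := by
  obtain ⟨M, hM⟩ := exists_partialD_eq_zero P l
  rw [weightedEuler_eq_sum l _ hM, weightedEuler_eq_sum l f (N := M + 1) fun k hk => by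
      obtain ⟨k, rfl⟩ : ∃ k', k = k' + 1 := ⟨k - 1, by omega⟩
      rw [partialD_succ_totalD, hM _ (by omega), hM _ (by omega), map_zero, add_zero],
    Finset.sum_range_succ']
  have h1 : ∀ k, (𝒜.negTotal ^ (k + 1)) (f * 𝒜.partialD (k + 1) l (𝒜.totalD P)) =
      (𝒜.negTotal ^ (k + 1)) (f * 𝒜.totalD (𝒜.partialD (k + 1) l P))
        - (𝒜.negTotal ^ k) (f * 𝒜.totalD (𝒜.partialD k l P))
        + (𝒜.negTotal ^ k) (-𝒜.totalD f * 𝒜.partialD k l P) := by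
    intro k
    have e : (𝒜.negTotal ^ (k + 1)) (f * 𝒜.partialD k l P) =
        (𝒜.negTotal ^ k) (-𝒜.totalD f * 𝒜.partialD k l P)
        - (𝒜.negTotal ^ k) (f * 𝒜.totalD (𝒜.partialD k l P)) := by
      rw [pow_succ, Module.End.mul_apply, ← map_sub, negTotal_apply, Derivation.leibniz]
      congr 1
      simp only [smul_eq_mul]
      ring
    rw [partialD_succ_totalD, mul_add, map_add, e]
    ring
  rw [Finset.sum_congr rfl fun k _ => h1 k, Finset.sum_add_distrib,
    Finset.sum_range_sub (fun k => (𝒜.negTotal ^ k) (f * 𝒜.totalD (𝒜.partialD k l P))),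
    hM M le_rfl, partialD_zero_totalD]
  simp only [map_zero, mul_zero]
  ring

/-- The Euler operator kills total derivatives. -/
theorem eulerₗ_totalD (l : Fin m) (P : 𝒜.Jet) : 𝒜.eulerₗ l (𝒜.totalD P) = 0 := by
  refine (weightedEuler_totalD l 1 P).trans ?_
  rw [Derivation.map_one_eq_zero, neg_zero, weightedEuler]
  simp

/-- The product rule: each factor becomes a weight for the other. -/
theorem weightedEuler_mul (l : Fin m) (f g P : 𝒜.Jet) : 𝒜.weightedEuler l f (g * P) =
    𝒜.weightedEuler l (f * g) P + 𝒜.weightedEuler l (f * P) g := by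
  obtain ⟨M, hM⟩ := exists_partialD_eq_zero P l
  obtain ⟨N, hN⟩ := exists_partialD_eq_zero g l
  rw [weightedEuler_eq_sum l _ (N := max M N) fun k hk => hM k (le_of_max_le_left hk),
    weightedEuler_eq_sum l _ (N := max M N) fun k hk => hN k (le_of_max_le_right hk),
    weightedEuler_eq_sum l f (N := max M N) fun k hk => by
      rw [Derivation.leibniz, hM k (le_of_max_le_left hk), hN k (le_of_max_le_right hk)]
      simp,
    ← Finset.sum_add_distrib]
  refine Finset.sum_congr rfl fun k _ => ?_
  rw [Derivation.leibniz, mul_add, map_add, smul_eq_mul, smul_eq_mul, mul_assoc, mul_assoc]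

theorem weightedEuler_C_mul (l : Fin m) (f P : 𝒜.Jet) {g : 𝒜.carrier} (hg : 𝒜.DependsOnX g) :
    𝒜.weightedEuler l f (MvPolynomial.C g * P) =
      𝒜.weightedEuler l (f * MvPolynomial.C g) P := by
  rw [weightedEuler_mul, add_eq_left, weightedEuler_eq_sum l _ (N := 0) fun k _ =>
    𝒜.partialD_C_of_dependsOnX k l hg, Finset.sum_range_zero]

theorem weightedEuler_jet_zero (l i : Fin m) (f : 𝒜.Jet) :
    𝒜.weightedEuler l f (𝒜.jet 0 i) = if i = l then f else 0 := by
  rw [weightedEuler_eq_sum l f (N := 1) fun k hk => partialD_jet_of_ne _ _ (by omega),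
    Finset.sum_range_one, partialD_jet]
  split_ifs <;> simp_all

namespace CanonicalSystem

variable {n : ℕ} (𝓔 : 𝒜.CanonicalSystem n)

/-- The leading term of the adjoint of the form coefficient with index `r`, applied to a
function of order `s`, is `(-1)ʳ D_xʳ`. -/
theorem partialD_weightedEuler_jetForm (l k i : Fin m) (r s : ℕ) (f : 𝒜.Jet)
    (hf : ∀ t, s < t → 𝒜.partialD t i f = 0) :
    (∀ t, s + r < t → 𝒜.partialD t i (𝒜.weightedEuler l f (𝓔.jetForm (𝒜.jet 0 k) r)) = 0) ∧
      𝒜.partialD (s + r) i (𝒜.weightedEuler l f (𝓔.jetForm (𝒜.jet 0 k) r)) =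
        if k = l then (-1) ^ r * 𝒜.partialD s i f else 0 := by
  induction r using Nat.strong_induction_on generalizing s f with
  | _ r ih =>
    have hD : ∀ t, s + 1 < t → 𝒜.partialD t i (-𝒜.totalD f) = 0 := by
      intro t ht
      obtain ⟨t, rfl⟩ : ∃ t', t = t' + 1 := ⟨t - 1, by omega⟩
      rw [map_neg, partialD_succ_totalD, hf _ (by omega), hf _ (by omega), map_zero, add_zero,
        neg_zero]
    have hDs : 𝒜.partialD (s + 1) i (-𝒜.totalD f) = -𝒜.partialD s i f := by
      rw [map_neg, partialD_succ_totalD, hf _ (by omega), map_zero, zero_add]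
    rcases r with _ | _ | r
    · rw [jetForm_zero, weightedEuler_jet_zero]
      refine ⟨fun t ht => ?_, ?_⟩
      · split_ifs
        · exact hf t (by omega)
        · exact map_zero _
      · split_ifs <;> simp
    · rw [zero_add, jetForm_one, weightedEuler_totalD, weightedEuler_jet_zero]
      refine ⟨fun t ht => ?_, ?_⟩
      · split_ifs
        · exact hD t (by omega)
        · exact map_zero _
      · split_ifs
        · rw [hDs]; ring
        · exact map_zero _
    · have hc : 𝒜.DependsOnX ((((r + 1) * (n - 1 - r) : ℤ) : 𝒜.carrier) * 𝓔.source) :=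
        (dependsOnX_intCast _).mul 𝓔.source_dependsOnX
      have e : 𝓔.jetForm (𝒜.jet 0 k) (r + 2) = 𝒜.totalD (𝓔.jetForm (𝒜.jet 0 k) (r + 1))
          + MvPolynomial.C ((((r + 1) * (n - 1 - r) : ℤ) : 𝒜.carrier) * 𝓔.source)
            * 𝓔.jetForm (𝒜.jet 0 k) r := by
        rw [jetForm_add_two, map_mul, map_intCast]
        push_cast
        ring
      have h1 := ih (r + 1) (by omega) (s + 1) (-𝒜.totalD f) hD
      have h2 := ih r (by omega) s
        (f * MvPolynomial.C ((((r + 1) * (n - 1 - r) : ℤ) : 𝒜.carrier) * 𝓔.source))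
        fun t ht => by
          rw [Derivation.leibniz, hf t ht, 𝒜.partialD_C_of_dependsOnX _ _ hc]; simp
      rw [show r + 1 + 1 = r + 2 from rfl, e, weightedEuler_add, weightedEuler_totalD,
        weightedEuler_C_mul _ _ _ hc]
      refine ⟨fun t ht => ?_, ?_⟩
      · rw [map_add, h1.1 t (by omega), h2.1 t (by omega), add_zero]
      · rw [map_add, h2.1 _ (by omega), show s + (r + 2) = s + 1 + (r + 1) by ring, h1.2, hDs,
          add_zero]
        split_ifs
        · ring
        · rfl

/-- A solution of the scalar equation is an integrating factor of `Δ_j`: by the pairing of forms,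
`b Δ_j` is a total derivative. -/
theorem eulerₗ_C_mul_lhs (hn : n ≠ 0) (l j : Fin m) {b : 𝒜.carrier} (hb : 𝒜.DependsOnX b)
    (h : 𝓔.form b n = 0) : 𝒜.eulerₗ l (MvPolynomial.C b * 𝓔.lhs j) = 0 := by
  obtain ⟨N, rfl⟩ : ∃ N, n = N + 1 := ⟨n - 1, by omega⟩
  have hd : (((N + 1 : ℕ) : ℤ) - 1) = (N : ℤ) := by push_cast; ring
  have h1 := 𝓔.isForm_jetForm (MvPolynomial.C b)
  have h2 := 𝓔.isForm_jetForm (𝒜.jet 0 j)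
  rw [hd] at h1 h2
  have h3 := h1.sum_mul h2
  simp only [← 𝓔.C_form hb, h, map_zero, zero_mul, mul_zero, add_zero, form_zero] at h3
  rw [lhs_eq, ← h3, eulerₗ_totalD]

/-- The coefficients of the derivatives of order `n` in the Euler expression of `y_i Δ_k`. The
second summand comes from `E_l` acting on `y_i`, and the first from its action on `Δ_k`, with the
sign `(-1)^n`: for odd `n` the two would cancel in the symmetrization in `i`, `k`. -/
theorem partialD_eulerₗ_jet_mul_lhs (hev : Even n) (l i k i' : Fin m) :
    𝒜.partialD n i' (𝒜.eulerₗ l (𝒜.jet 0 i * 𝓔.lhs k)) =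
      (if k = l ∧ i = i' then 1 else 0) + (if i = l ∧ k = i' then 1 else 0) := by
  have h := (𝓔.partialD_weightedEuler_jetForm l k i' n 0 (𝒜.jet 0 i)
    fun t ht => partialD_jet_of_ne _ _ (by omega)).2
  rw [zero_add, hev.neg_one_pow, one_mul, partialD_jet] at h
  have e : 𝒜.eulerₗ l (𝒜.jet 0 i * 𝓔.lhs k) = 𝒜.weightedEuler l (𝒜.jet 0 i) (𝓔.lhs k)
      + if i = l then 𝓔.lhs k else 0 := by
    refine (weightedEuler_mul l 1 _ _).trans ?_
    rw [one_mul, one_mul, weightedEuler_jet_zero]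
  rw [e, map_add, lhs_eq, h, apply_ite (𝒜.partialD n i'), map_zero,
    𝓔.partialD_jetForm _ _ _ _ le_rfl]
  simp only [true_and, ite_and]

/-! ### Divergence symmetries -/

/-- The variation `v^{(n)}(L₀) + L₀ D_x ξ` of the Lagrangian, as a linear function of the vector
field. -/
def variationₗ : Derivation K 𝒜.carrier 𝒜.carrier →ₗ[K] 𝒜.Jet where
  toFun v := 𝒜.prolongₗ v 𝓔.lagrangian
    + 𝓔.lagrangian * 𝒜.totalD (MvPolynomial.C (v 𝒜.x))
  map_add' v w := by
    simp only [map_add, Derivation.add_apply]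
    ring
  map_smul' c v := by
    simp only [map_smul, Derivation.smul_apply, C_const_smul, Derivation.map_smul, mul_smul_comm,
      smul_add, RingHom.id_apply]

theorem lagrangianVariation_eq (v : Derivation K 𝒜.carrier 𝒜.carrier) :
    𝓔.lagrangianVariation v = 𝓔.variationₗ v := by
  rw [lagrangianVariation, ← coe_prolongD, ← coe_totalD]
  rfl

theorem isDivergenceSymmetry_iff (v : Derivation K 𝒜.carrier 𝒜.carrier) :
    𝓔.IsDivergenceSymmetry v ↔ 𝓔.IsPointSymmetry v ∧ ∀ l, 𝒜.eulerₗ l (𝓔.variationₗ v) = 0 := by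
  simp only [IsDivergenceSymmetry, lagrangianVariation_eq, euler_eq_eulerₗ]

/-- The divergence symmetries as a linear subspace. -/
def divSymmetries : Submodule K (Derivation K 𝒜.carrier 𝒜.carrier) where
  carrier := {v | 𝓔.IsDivergenceSymmetry v}
  add_mem' {v w} hv hw := by
    simp only [Set.mem_ofPred_eq, isDivergenceSymmetry_iff] at *
    exact ⟨hv.1.add 𝓔 hw.1, fun l => by rw [map_add, map_add, hv.2, hw.2, add_zero]⟩
  zero_mem' := by
    simp only [Set.mem_ofPred_eq, isDivergenceSymmetry_iff, map_zero]
    refine ⟨⟨by simp [IsVectorField], fun j => ?_⟩, fun l => trivial⟩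
    rw [onSolutions_eq, ← coe_prolongD, ← prolongₗ_apply, map_zero, Derivation.zero_apply,
      map_zero]
  smul_mem' c v hv := by
    simp only [Set.mem_ofPred_eq, isDivergenceSymmetry_iff] at *
    exact ⟨hv.1.smul 𝓔 c, fun l => by rw [map_smul, map_smul, hv.2, smul_zero]⟩

theorem mem_divSymmetries {v : Derivation K 𝒜.carrier 𝒜.carrier} :
    v ∈ 𝓔.divSymmetries ↔ 𝓔.IsDivergenceSymmetry v := Iff.rfl

theorem variationₗ_eq_sum {v : Derivation K 𝒜.carrier 𝒜.carrier} :
    𝓔.variationₗ v = (1 / 2 : K) • ∑ j, (𝒜.prolongCoeff v 0 j * 𝓔.lhs j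
      + 𝒜.jet 0 j * 𝒜.prolongD v (𝓔.lhs j)
      + 𝒜.jet 0 j * 𝓔.lhs j * 𝒜.totalD (MvPolynomial.C (v 𝒜.x))) := by
  change 𝒜.prolongD v 𝓔.lagrangian + 𝓔.lagrangian * 𝒜.totalD (MvPolynomial.C (v 𝒜.x)) = _
  rw [lagrangian, Derivation.map_smul, smul_mul_assoc, ← smul_add, map_sum, Finset.sum_mul,
    ← Finset.sum_add_distrib]
  congr 1
  refine Finset.sum_congr rfl fun j _ => ?_
  rw [Derivation.leibniz, prolongD_jet, smul_eq_mul, smul_eq_mul]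
  ring

/-- The variation of the Lagrangian under such a projective field vanishes: `y_j` and `Δ_j` are
multiplied by `½ (n-1) ξ'` and `-½ (n+1) ξ'`, which cancels `D_x ξ = ξ'`. -/
theorem projectiveField_mem [CharZero K] (hn : n ≠ 0) {ξ : 𝒜.carrier}
    (hξ : 𝒜.DependsOnX ξ) (h : 𝓔.symSquare ξ = 0) :
    𝒜.projectiveField n ξ ∈ 𝓔.divSymmetries := by
  rw [mem_divSymmetries, isDivergenceSymmetry_iff]
  refine ⟨𝓔.isPointSymmetry_projectiveField hn hξ h, fun l => ?_⟩
  have h0 : 𝓔.variationₗ (𝒜.projectiveField n ξ) = 0 := by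
    have h2 : 𝒜.totalD (MvPolynomial.C ξ) = 2 * MvPolynomial.C ((1 / 2 : K) • 𝒜.dx ξ) := by
      have h2 : (2 : 𝒜.Jet) = MvPolynomial.C 2 := (map_ofNat _ 2).symm
      rw [h2, ← map_mul, two_mul_half_smul, totalD_C_of_dependsOnX _ hξ]
    rw [variationₗ_eq_sum, Finset.sum_eq_zero, smul_zero]
    intro j _
    rw [← prolongD_jet, prolongD_projectiveField_jet, 𝓔.prolongD_projectiveField_lhs,
      𝓔.defect_eq_zero hξ h, projectiveField_x, h2]
    push_cast
    ring
  rw [h0, map_zero]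

theorem translationField_mem (hn : n ≠ 0) {b : Fin m → 𝒜.carrier}
    (hb : ∀ j, 𝒜.DependsOnX (b j)) (h : ∀ j, 𝓔.form (b j) n = 0) :
    𝒜.translationField b ∈ 𝓔.divSymmetries := by
  rw [mem_divSymmetries, isDivergenceSymmetry_iff]
  refine ⟨𝓔.isPointSymmetry_translationField hb h, fun l => ?_⟩
  have h0 : 𝓔.variationₗ (𝒜.translationField b)
      = (1 / 2 : K) • ∑ j, MvPolynomial.C (b j) * 𝓔.lhs j := by
    rw [variationₗ_eq_sum]
    congr 1
    refine Finset.sum_congr rfl fun j _ => ?_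
    rw [𝓔.prolongD_translationField_lhs hb, h j, prolongCoeff, translationField_y,
      translationField_x]
    simp only [map_zero, mul_zero, add_zero]
  rw [h0, map_smul, map_sum, Finset.sum_eq_zero fun j _ => 𝓔.eulerₗ_C_mul_lhs hn l j (hb j) (h j),
    smul_zero]

theorem variationₗ_linearField (c : Matrix (Fin m) (Fin m) K) : 𝓔.variationₗ (𝒜.linearField c)
    = (1 / 2 : K) • ∑ j, ∑ i, (c i j + c j i) • (𝒜.jet 0 i * 𝓔.lhs j) := by
  have e : ∑ j, ∑ i, c j i • (𝒜.jet 0 i * 𝓔.lhs j)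
      = ∑ j, ∑ i, c i j • (𝒜.jet 0 j * 𝓔.lhs i) := Finset.sum_comm
  rw [variationₗ_eq_sum]
  simp only [add_smul, Finset.sum_add_distrib, e]
  congr 1
  simp only [𝓔.prolongD_linearField_lhs, linearField_x, map_zero, mul_zero, Finset.sum_const_zero,
    add_zero, prolongCoeff, linearField_y, map_sum, C_const_smul, Finset.sum_mul, smul_mul_assoc,
    Finset.mul_sum, mul_smul_comm]
  rfl

/-- Among the linear fields, all of which are point symmetries, the divergence symmetries are the
rotations; this is where `n` has to be even. -/
theorem linearField_mem_iff [CharZero K] (hn : n ≠ 0) (hev : Even n)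
    (c : Matrix (Fin m) (Fin m) K) :
    𝒜.linearField c ∈ 𝓔.divSymmetries ↔ c.transpose = -c := by
  rw [mem_divSymmetries, isDivergenceSymmetry_iff]
  constructor
  · rintro ⟨-, h⟩
    ext i' l
    rw [Matrix.transpose_apply, Matrix.neg_apply]
    have h1 := congrArg (𝒜.partialD n i') (h l)
    rw [variationₗ_linearField, map_smul, map_sum, Derivation.map_smul, map_sum, map_zero] at h1
    simp only [map_sum, map_smul, Derivation.map_smul, 𝓔.partialD_eulerₗ_jet_mul_lhs hev] at h1
    have h2 : (∑ j, ∑ i, (c i j + c j i) • ((if j = l ∧ i = i' then (1 : 𝒜.Jet) else 0)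
        + (if i = l ∧ j = i' then 1 else 0))) = (2 * (c i' l + c l i')) • (1 : 𝒜.Jet) := by
      simp only [smul_add, Finset.sum_add_distrib, ite_and, smul_ite, smul_zero,
        Finset.sum_ite_eq', Finset.mem_univ, if_true, Finset.sum_ite_irrel, Finset.sum_const_zero]
      module
    rw [h2, smul_smul] at h1
    have h3 : (algebraMap K 𝒜.Jet) (1 / 2 * (2 * (c i' l + c l i'))) = 0 := by
      rw [Algebra.algebraMap_eq_smul_one, h1]
    have h4 := (map_eq_zero_iff _ (algebraMap K 𝒜.Jet).injective).1 h3
    have h5 : c i' l + c l i' = 0 := by linear_combination h4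
    exact eq_neg_of_add_eq_zero_right h5
  · intro hc
    refine ⟨𝓔.isPointSymmetry_linearField hn c, fun l => ?_⟩
    have h0 : ∀ i j, c i j + c j i = 0 := fun i j => by
      have := congrFun (congrFun hc i) j
      rw [Matrix.transpose_apply, Matrix.neg_apply] at this
      rw [this]; ring
    rw [variationₗ_linearField]
    simp only [h0, zero_smul, Finset.sum_const_zero, smul_zero, map_zero]

/-- The divergence symmetries are the sums of a projective field, a rotation and a translation
by solutions. -/
theorem mem_divSymmetries_iff [CharZero K] (hm : 1 ≤ m) (hn : 3 ≤ n) (hev : Even n)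
    {v : Derivation K 𝒜.carrier 𝒜.carrier} : v ∈ 𝓔.divSymmetries ↔
      ∃ (ξ : 𝒜.carrier) (c : Matrix (Fin m) (Fin m) K) (b : Fin m → 𝒜.carrier),
        (𝒜.DependsOnX ξ ∧ 𝓔.symSquare ξ = 0) ∧ c.transpose = -c ∧
        (∀ j, 𝒜.DependsOnX (b j) ∧ 𝓔.form (b j) n = 0) ∧
        v = 𝒜.projectiveField n ξ + 𝒜.linearField c + 𝒜.translationField b := by
  constructor
  · intro hv
    obtain ⟨ξ, c, b, hξ, hb, rfl⟩ := hv.1.exists_eq 𝓔 hn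
    obtain ⟨h1, h2⟩ := hv.1.symSquare_eq_zero 𝓔 hn hm hξ hb
    refine ⟨ξ, c, b, ⟨hξ, h1⟩, ?_, fun j => ⟨hb j, h2 j⟩, rfl⟩
    rw [← 𝓔.linearField_mem_iff (by omega) hev]
    have h3 := 𝓔.projectiveField_mem (by omega) hξ h1
    have h4 := 𝓔.translationField_mem (by omega) hb h2
    have h5 := Submodule.sub_mem _ (Submodule.sub_mem _ hv h4) h3
    convert h5 using 1
    abel
  · rintro ⟨ξ, c, b, ⟨hξ, h1⟩, hc, hb, rfl⟩
    exact Submodule.add_mem _ (Submodule.add_mem _ (𝓔.projectiveField_mem (by omega) hξ h1)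
      ((𝓔.linearField_mem_iff (by omega) hev c).2 hc))
      (𝓔.translationField_mem (by omega) (fun j => (hb j).1) fun j => (hb j).2)

end CanonicalSystem

end FunctionAlgebra

/-! ### Lie algebras without abelian ideals -/

section LieAlgebra

variable {K L L' : Type*} [Field K] [LieRing L] [LieAlgebra K L] [LieRing L'] [LieAlgebra K L']

theorem LieAlgebra.hasTrivialRadical_of_abelian_ideals
    (h : ∀ I : LieIdeal K L, (∀ x ∈ I, ∀ y ∈ I, ⁅x, y⁆ = 0) → ∀ x ∈ I, x = 0) :
    LieAlgebra.HasTrivialRadical K L := by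
  rw [LieAlgebra.hasTrivialRadical_iff_no_abelian_ideals]
  intro I hI
  rw [LieSubmodule.eq_bot_iff]
  exact h I fun x hx y hy => congrArg Subtype.val (hI.trivial ⟨x, hx⟩ ⟨y, hy⟩)

theorem LieAlgebra.eq_zero_of_mem_abelian_ideal [LieAlgebra.HasTrivialRadical K L]
    (I : LieIdeal K L) (h : ∀ x ∈ I, ∀ y ∈ I, ⁅x, y⁆ = 0) {x : L} (hx : x ∈ I) : x = 0 := by
  have h1 := LieAlgebra.hasTrivialRadical_iff_no_abelian_ideals K L |>.1 inferInstance I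
    ⟨fun a b => Subtype.ext (h a a.2 b b.2)⟩
  rwa [h1, LieSubmodule.mem_bot] at hx

instance LieAlgebra.hasTrivialRadical_prod [LieAlgebra.HasTrivialRadical K L]
    [LieAlgebra.HasTrivialRadical K L'] : LieAlgebra.HasTrivialRadical K (L × L') := by
  refine LieAlgebra.hasTrivialRadical_of_abelian_ideals fun I hI x hx => ?_
  refine Prod.ext ?_ ?_
  · refine LieAlgebra.eq_zero_of_mem_abelian_ideal (K := K)
      { I.toSubmodule.map (LinearMap.fst K L L') with
        lie_mem := ?_ } ?_ ⟨x, hx, rfl⟩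
    · rintro a _ ⟨b, hb, rfl⟩
      exact ⟨⁅((a, 0) : L × L'), b⁆, I.lie_mem hb, rfl⟩
    · rintro _ ⟨a, ha, rfl⟩ _ ⟨b, hb, rfl⟩
      exact congrArg Prod.fst (hI a ha b hb)
  · refine LieAlgebra.eq_zero_of_mem_abelian_ideal (K := K)
      { I.toSubmodule.map (LinearMap.snd K L L') with
        lie_mem := ?_ } ?_ ⟨x, hx, rfl⟩
    · rintro a _ ⟨b, hb, rfl⟩
      exact ⟨⁅((0, a) : L × L'), b⁆, I.lie_mem hb, rfl⟩
    · rintro _ ⟨a, ha, rfl⟩ _ ⟨b, hb, rfl⟩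
      exact congrArg Prod.snd (hI a ha b hb)

/-- An abelian ideal with a complementary subalgebra of trivial radical is the radical: the
intersection of the radical with the subalgebra is a solvable ideal of the subalgebra. -/
theorem LieAlgebra.radical_eq_of_isCompl_range [IsNoetherian K L]
    [LieAlgebra.HasTrivialRadical K L'] (φ : L' →ₗ⁅K⁆ L) (hφ : Function.Injective φ)
    (I : LieIdeal K L) [IsLieAbelian I] (h : IsCompl φ.range.toSubmodule I.toSubmodule) :
    LieAlgebra.radical K L = I := by
  have hI : I ≤ LieAlgebra.radical K L := (LieAlgebra.LieIdeal.solvable_iff_le_radical K L I).1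
    (LieAlgebra.ofAbelianIsSolvable I)
  refine le_antisymm (fun x hx => ?_) hI
  have hx1 : x ∈ φ.range.toSubmodule ⊔ I.toSubmodule := h.sup_eq_top ▸ Submodule.mem_top
  obtain ⟨y, ⟨z, rfl⟩, w, hw, rfl⟩ := Submodule.mem_sup.1 hx1
  have hz : φ z ∈ LieAlgebra.radical K L := by
    have := sub_mem hx (hI hw)
    rwa [add_sub_cancel_right] at this
  have hJ : (LieAlgebra.radical K L).comap φ = ⊥ := by
    refine LieAlgebra.HasTrivialRadical.eq_bot_of_isSolvable _ (hI := ?_)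
    let ψ : (LieAlgebra.radical K L).comap φ →ₗ⁅K⁆ LieAlgebra.radical K L :=
      { toFun := fun a => ⟨φ a, a.2⟩
        map_add' := fun a b => Subtype.ext (map_add φ _ _)
        map_smul' := fun c a => Subtype.ext (map_smul φ _ _)
        map_lie' := fun {a b} => Subtype.ext (LieHom.map_lie φ _ _) }
    have hψ : Function.Injective ψ := fun a b hab =>
      Subtype.ext (hφ (congrArg Subtype.val hab))
    exact hψ.lieAlgebra_isSolvable
  have hz0 : z ∈ (LieAlgebra.radical K L).comap φ := hz
  rw [hJ, LieSubmodule.mem_bot] at hz0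
  change φ z + w ∈ I
  rw [hz0, map_zero, zero_add]
  exact hw

/-- Finite-dimensional Lie algebras with trivial radical are semisimple in characteristic zero; the
Killing form is nondegenerate by Cartan's criterion. -/
theorem LieAlgebra.isSemisimple_of_equiv [CharZero K] [Module.Finite K L]
    [LieAlgebra.HasTrivialRadical K L] (e : L ≃ₗ⁅K⁆ L') : LieAlgebra.IsSemisimple K L' := by
  have := Module.Finite.equiv e.toLinearEquiv
  have := LieAlgebra.isKilling_of_equiv e
  infer_instance

end LieAlgebra

/-! ### The matrix Lie algebras `sl₂` and `so(m)` -/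

section Matrix

variable {K : Type*} [Field K]

open LieAlgebra

theorem LieAlgebra.SpecialLinear.apply_one_one (A : SpecialLinear.sl (Fin 2) K) :
    A.1 1 1 = -A.1 0 0 := by
  have h : Matrix.trace A.1 = 0 := A.2
  rw [Matrix.trace_fin_two] at h
  linear_combination h

/-- An element `A` of an abelian ideal satisfies `[A, [X, A]] = 0` for all `X`; with `X` the two
nilpotent matrix units, the entries of `A` are zero. -/
instance LieAlgebra.SpecialLinear.hasTrivialRadical_fin_two [CharZero K] :
    HasTrivialRadical K (SpecialLinear.sl (Fin 2) K) := by
  refine hasTrivialRadical_of_abelian_ideals fun I hI A hA => ?_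
  have key : ∀ X, (⁅A, ⁅X, A⁆⁆ : SpecialLinear.sl (Fin 2) K) = 0 := fun X =>
    hI _ hA _ (lie_mem_right K _ I X A hA)
  have h1 := congrArg Subtype.val (key (SpecialLinear.single 0 1 (by decide) 1))
  have h2 := congrArg Subtype.val (key (SpecialLinear.single 1 0 (by decide) 1))
  have hA1 := SpecialLinear.apply_one_one A
  simp only [SpecialLinear.sl_bracket, SpecialLinear.val_single] at h1 h2
  have h3 := congrFun (congrFun h1 1) 0
  have h4 := congrFun (congrFun h2 0) 1
  have h5 := congrFun (congrFun h1 0) 1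
  simp [Matrix.mul_apply, Fin.sum_univ_two, Matrix.single_apply] at h3 h4 h5
  have ha : A.1 0 0 = 0 := by
    rw [h3, h4, hA1] at h5
    have : (4 : K) * (A.1 0 0) ^ 2 = 0 := by linear_combination -h5
    simpa using this
  refine Subtype.ext (Matrix.ext fun i j => ?_)
  fin_cases i <;> fin_cases j <;> simp [ha, h3, h4, hA1]

/-- The coordinates of a traceless `2 × 2` matrix: its entries `(0, 1)`, `(1, 0)` and `(0, 0)`.
These will be the coefficients of `F_p`, `F_m` and `F_z`. -/
def LieAlgebra.SpecialLinear.finTwoEquiv : SpecialLinear.sl (Fin 2) K ≃ₗ[K] (Fin 3 → K) where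
  toFun A := ![A.1 0 1, A.1 1 0, A.1 0 0]
  map_add' A B := by ext i; fin_cases i <;> rfl
  map_smul' c A := by ext i; fin_cases i <;> rfl
  invFun c := ⟨!![c 2, c 0; c 1, -c 2], by
    change Matrix.trace !![c 2, c 0; c 1, -c 2] = 0
    simp [Matrix.trace_fin_two]⟩
  left_inv A := by
    refine Subtype.ext (Matrix.ext fun i j => ?_)
    have := SpecialLinear.apply_one_one A
    fin_cases i <;> fin_cases j <;> simp [this]
  right_inv c := by ext i; fin_cases i <;> rfl

variable {ι : Type*} [Fintype ι] [DecidableEq ι]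

theorem LieAlgebra.Orthogonal.so_apply (A : Orthogonal.so ι K) (i j : ι) :
    A.1 j i = -A.1 i j :=
  congrFun (congrFun ((Orthogonal.mem_so ι K A.1).1 A.2) i) j

theorem LieAlgebra.Orthogonal.so_bracket (A B : Orthogonal.so ι K) :
    ⁅A, B⁆.1 = A.1 * B.1 - B.1 * A.1 := rfl

variable (K) in
/-- The generator `E_{ij} - E_{ji}` of the rotations in the plane of two coordinates. -/
def LieAlgebra.Orthogonal.rot (i j : ι) : Orthogonal.so ι K :=
  ⟨Matrix.single i j 1 - Matrix.single j i 1, by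
    rw [Orthogonal.mem_so, Matrix.transpose_sub, Matrix.transpose_single, Matrix.transpose_single,
      neg_sub]⟩

theorem LieAlgebra.Orthogonal.rot_lie_apply (i j k l : ι) (A : Orthogonal.so ι K) :
    ⁅Orthogonal.rot K i j, A⁆.1 k l = (if i = k then A.1 j l else 0)
      - (if j = k then A.1 i l else 0) - (if j = l then A.1 k i else 0)
      + (if i = l then A.1 k j else 0) := by
  rw [so_bracket]
  simp only [rot, Matrix.sub_mul, Matrix.mul_sub, Matrix.sub_apply, Matrix.mul_apply,
    Matrix.single_apply, ite_and, ite_mul, mul_ite, one_mul, mul_one, zero_mul, mul_zero,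
    Finset.sum_ite_eq, Finset.mem_univ, if_true, Finset.sum_ite_irrel, Finset.sum_const_zero]
  ring

/-- The orthogonal Lie algebra has no abelian ideals but in dimension two. From an element `A` of
such an ideal with `A_{jl} ≠ 0`, brackets with rotations of the planes `(i, j)` and `(i, l)`
extract the element `B = A_{jl} R_{jl} + ∑_{k ≠ i, j, l} A_{ik} R_{ik}`; since `B` commutes with
`[R_{ij}, B]`, `A_{jl} A_{ik} = 0` for all `k`, and then `A_{jl}² = 0`. -/
theorem LieAlgebra.Orthogonal.hasTrivialRadical [CharZero K] (h : Fintype.card ι ≠ 2) :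
    HasTrivialRadical K (Orthogonal.so ι K) := by
  refine hasTrivialRadical_of_abelian_ideals fun I hI A hA => ?_
  have hdiag : ∀ B : Orthogonal.so ι K, ∀ i, B.1 i i = 0 := fun B i => by
    have := Orthogonal.so_apply B i i
    have : (2 : K) * B.1 i i = 0 := by linear_combination this
    simpa using this
  refine Subtype.ext (Matrix.ext fun j l => ?_)
  change A.1 j l = 0
  by_contra hjl
  have hne : j ≠ l := by rintro rfl; exact hjl (hdiag A j)
  obtain ⟨i, hi⟩ : ∃ i, i ∉ ({j, l} : Finset ι) := by
    by_contra! hcon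
    have h1 : ({j, l} : Finset ι) = Finset.univ := Finset.eq_univ_iff_forall.2 hcon
    exact h (by rw [← Finset.card_univ, ← h1, Finset.card_pair hne])
  obtain ⟨hij, hil⟩ : i ≠ j ∧ i ≠ l := by simpa using hi
  have hmem : ∀ X B, B ∈ I → ⁅X, B⁆ ∈ I := fun X B hB => lie_mem_right K _ I X B hB
  -- the square of the bracket with a rotation is, up to sign, a projection; the two of them leave
  -- the entry `A_{lj}` and the row of `i`
  obtain ⟨B, hBdef⟩ : ∃ B, B = ⁅Orthogonal.rot K i l, ⁅Orthogonal.rot K i l,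
    ⁅Orthogonal.rot K i j, ⁅Orthogonal.rot K i j, A⁆⁆⁆⁆ := ⟨_, rfl⟩
  have hB : B ∈ I := by rw [hBdef]; exact hmem _ _ (hmem _ _ (hmem _ _ (hmem _ _ hA)))
  have hBlj : B.1 l j = A.1 l j := by
    rw [hBdef]
    simp [Orthogonal.rot_lie_apply, hij, hil, hne, hij.symm, hil.symm, hne.symm]
  have hBl : ∀ s, s ≠ j → B.1 l s = 0 := fun s hs => by
    rw [hBdef]
    by_cases hsi : i = s
    · subst hsi
      simp [Orthogonal.rot_lie_apply, hil, hil.symm, hdiag]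
    · by_cases hsl : l = s
      · subst hsl
        exact hdiag _ _
      · simp [Orthogonal.rot_lie_apply, hil, hne, hil.symm, hsi, hsl,
          hs.symm]
  have hBij : B.1 i j = 0 := by
    rw [hBdef]
    simp [Orthogonal.rot_lie_apply, hij, hil, hij.symm, hil.symm, hne.symm, hdiag]
  have hBil : B.1 i l = 0 := by rw [Orthogonal.so_apply B l i, hBl i hij, neg_zero]
  have hBj : ∀ s, s ≠ l → B.1 s j = 0 := fun s hs => by
    by_cases hsi : i = s
    · rw [← hsi, hBij]
    · by_cases hsj : j = s
      · rw [← hsj, hdiag]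
      · rw [hBdef]
        simp [Orthogonal.rot_lie_apply, hij, hne.symm, hsi,
          hs.symm]
  clear hBdef
  have hcomm : ∀ p q, (∑ s, B.1 p s * ⁅Orthogonal.rot K i j, B⁆.1 s q)
      - ∑ s, ⁅Orthogonal.rot K i j, B⁆.1 p s * B.1 s q = 0 := fun p q => by
    have h1 := congrArg Subtype.val (hI _ hB _ (hmem (Orthogonal.rot K i j) _ hB))
    rw [Orthogonal.so_bracket] at h1
    have h2 := congrFun (congrFun h1 p) q
    rwa [Matrix.sub_apply, Matrix.mul_apply, Matrix.mul_apply] at h2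
  -- first the entries with row `l` of the relation `[B, [R_{ij}, B]] = 0`, then the entry `(i, j)`
  have hlj : A.1 l j ≠ 0 := by rw [Orthogonal.so_apply A j l]; exact neg_ne_zero.2 hjl
  have hA0 : ∀ k, k ≠ j → k ≠ l → B.1 i k = 0 := by
    intro k hkj hkl
    by_cases hki : i = k
    · rw [hki, hdiag]
    have h1 := hcomm l k
    rw [Finset.sum_eq_single j (fun s _ hs => by rw [hBl s hs, zero_mul]) (by simp),
      Finset.sum_eq_single i (fun s _ hs => by
        by_cases hsj : j = s
        · subst hsj
          simp [Orthogonal.rot_lie_apply, hij, hil, hne, hBl i hij]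
        · simp [Orthogonal.rot_lie_apply, hil, hne, hsj, hs.symm]) (by simp)] at h1
    simp only [Orthogonal.rot_lie_apply, hij, hil, hne, hij.symm, hki, hkj.symm, if_false, if_true,
      zero_sub, sub_zero, add_zero, zero_add, hBlj] at h1
    have h2 : (2 : K) * A.1 l j * B.1 i k = 0 := by linear_combination -h1
    simpa [hlj] using h2
  have hB0 : ∀ k, B.1 i k = 0 := fun k => by
    by_cases hkj : k = j
    · rw [hkj, hBij]
    · by_cases hkl : k = l
      · rw [hkl, hBil]
      · exact hA0 k hkj hkl
  have h1 := hcomm i j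
  rw [Finset.sum_eq_zero fun s _ => by rw [hB0 s, zero_mul],
    Finset.sum_eq_single l (fun s _ hs => by
      by_cases hsj : j = s
      · subst hsj
        rw [hdiag, mul_zero]
      · rw [hBj s hs, mul_zero]) (by simp)] at h1
  simp only [Orthogonal.rot_lie_apply, hil, hne, hij.symm, if_false, if_true,
      zero_sub, sub_zero, add_zero, hBlj] at h1
  rw [Orthogonal.so_apply B l j, hBlj] at h1
  simp [hlj] at h1

/-- The coordinates of a skew-symmetric matrix are its entries below the diagonal. -/
def LieAlgebra.Orthogonal.soEquiv [CharZero K] [LinearOrder ι] :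
    Orthogonal.so ι K ≃ₗ[K] ((Σ i : ι, {j // j < i}) → K) where
  toFun A p := A.1 p.1 p.2
  map_add' A B := rfl
  map_smul' c A := rfl
  invFun c := ⟨Matrix.of fun i j => if h : j < i then c ⟨i, j, h⟩ else
      if h : i < j then -c ⟨j, i, h⟩ else 0, by
    rw [Orthogonal.mem_so]
    ext i j
    simp only [Matrix.transpose_apply, Matrix.of_apply, Matrix.neg_apply]
    rcases lt_trichotomy i j with h | h | h
    · simp [h, h.not_gt]
    · simp [h]
    · simp [h, h.not_gt]⟩
  left_inv A := by
    refine Subtype.ext (Matrix.ext fun i j => ?_)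
    simp only [Matrix.of_apply]
    rcases lt_trichotomy i j with h | h | h
    · simp [h, h.not_gt, Orthogonal.so_apply A j i]
    · have := Orthogonal.so_apply A i i
      have : (2 : K) * A.1 i i = 0 := by linear_combination this
      subst h
      simpa using (mul_eq_zero.1 this).resolve_left two_ne_zero |>.symm
    · simp [h]
  right_inv c := by
    funext ⟨i, j, h⟩
    simp [h]

end Matrix

namespace FunctionAlgebra

variable {K : Type u} [Field K] {m : ℕ} {𝒜 : FunctionAlgebra K m}

/-! ### Brackets of the three kinds of symmetries -/

theorem projectiveField_lie_projectiveField (n : ℕ) {ξ η : 𝒜.carrier}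
    (hξ : 𝒜.DependsOnX ξ) (hη : 𝒜.DependsOnX η) :
    ⁅𝒜.projectiveField n ξ, 𝒜.projectiveField n η⁆
      = 𝒜.projectiveField n (ξ * 𝒜.dx η - 𝒜.dx ξ * η) := by
  refine ((isVectorField_projectiveField n ξ).lie (isVectorField_projectiveField n η)).ext
    (isVectorField_projectiveField _ _) ?_ fun j => ?_
  · rw [Derivation.commutator_apply, projectiveField_x, projectiveField_x, projectiveField_x,
      (isVectorField_projectiveField n ξ).apply_of_dependsOnX hη,
      (isVectorField_projectiveField n η).apply_of_dependsOnX hξ, projectiveField_x,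
      projectiveField_x]
    ring
  · rw [Derivation.commutator_apply, projectiveField_y, projectiveField_y, projectiveField_y]
    simp only [Derivation.leibniz, smul_eq_mul, map_sub, Derivation.map_natCast,
      Derivation.map_one_eq_zero, Derivation.map_smul, projectiveField_y,
      (isVectorField_projectiveField n ξ).apply_of_dependsOnX hη.dx,
      (isVectorField_projectiveField n η).apply_of_dependsOnX hξ.dx, projectiveField_x,
      smul_sub]
    simp only [Algebra.smul_def]
    ring

theorem linearField_lie_linearField (c d : Matrix (Fin m) (Fin m) K) :
    ⁅𝒜.linearField c, 𝒜.linearField d⁆ = 𝒜.linearField (c * d - d * c) := by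
  refine ((isVectorField_linearField c).lie (isVectorField_linearField d)).ext
    (isVectorField_linearField _) ?_ fun j => ?_
  · simp only [Derivation.commutator_apply, linearField_x, map_zero, sub_zero]
  · have key : ∀ c d : Matrix (Fin m) (Fin m) K, 𝒜.linearField c (𝒜.linearField d (𝒜.y j))
        = ∑ i, (c * d) i j • 𝒜.y i := by
      intro c d
      simp only [linearField_y, map_sum, Derivation.map_smul, Matrix.mul_apply, Finset.sum_smul,
        Finset.smul_sum, smul_smul]
      rw [Finset.sum_comm]
      simp only [mul_comm]
    rw [Derivation.commutator_apply, key, key, linearField_y, ← Finset.sum_sub_distrib]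
    simp only [Matrix.sub_apply, sub_smul]

theorem projectiveField_lie_linearField (n : ℕ) {ξ : 𝒜.carrier} (hξ : 𝒜.DependsOnX ξ)
    (c : Matrix (Fin m) (Fin m) K) : ⁅𝒜.projectiveField n ξ, 𝒜.linearField c⁆ = 0 := by
  refine ((isVectorField_projectiveField n ξ).lie (isVectorField_linearField c)).ext
    (by simp [IsVectorField]) ?_ fun j => ?_
  · rw [Derivation.commutator_apply, projectiveField_x, linearField_x, map_zero,
      (isVectorField_linearField c).apply_of_dependsOnX hξ, linearField_x, zero_mul, sub_zero,
      Derivation.zero_apply]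
  · rw [Derivation.commutator_apply, projectiveField_y, linearField_y, Derivation.zero_apply]
    simp only [map_sum, Derivation.map_smul, projectiveField_y, Derivation.leibniz, smul_eq_mul,
      map_sub, Derivation.map_natCast, Derivation.map_one_eq_zero, linearField_y,
      (isVectorField_linearField c).apply_of_dependsOnX hξ.dx, linearField_x, zero_mul, smul_zero,
      mul_zero, add_zero, Finset.mul_sum, mul_smul_comm, sub_self]

theorem projectiveField_lie_translationField (n : ℕ) {ξ : 𝒜.carrier} {b : Fin m → 𝒜.carrier}
    (hξ : 𝒜.DependsOnX ξ) (hb : ∀ j, 𝒜.DependsOnX (b j)) :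
    ⁅𝒜.projectiveField n ξ, 𝒜.translationField b⁆ = 𝒜.translationField fun j =>
      ξ * 𝒜.dx (b j) - ((n : 𝒜.carrier) - 1) * ((1 / 2 : K) • 𝒜.dx ξ) * b j := by
  refine ((isVectorField_projectiveField n ξ).lie (isVectorField_translationField b)).ext
    (isVectorField_translationField _) ?_ fun j => ?_
  · rw [Derivation.commutator_apply, projectiveField_x, translationField_x, map_zero,
      (isVectorField_translationField b).apply_of_dependsOnX hξ, translationField_x,
      translationField_x, zero_mul, sub_zero]
  · rw [Derivation.commutator_apply, projectiveField_y, translationField_y, translationField_y,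
      (isVectorField_projectiveField n ξ).apply_of_dependsOnX (hb j), projectiveField_x]
    simp only [Derivation.leibniz, smul_eq_mul, map_sub, Derivation.map_natCast,
      Derivation.map_smul, Derivation.map_one_eq_zero, translationField_y,
      (isVectorField_translationField b).apply_of_dependsOnX hξ.dx, translationField_x, zero_mul,
      smul_zero, mul_zero, add_zero, sub_self]

theorem linearField_lie_translationField (c : Matrix (Fin m) (Fin m) K) {b : Fin m → 𝒜.carrier}
    (hb : ∀ j, 𝒜.DependsOnX (b j)) : ⁅𝒜.linearField c, 𝒜.translationField b⁆ =
      𝒜.translationField fun j => -∑ i, c i j • b i := by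
  refine ((isVectorField_linearField c).lie (isVectorField_translationField b)).ext
    (isVectorField_translationField _) ?_ fun j => ?_
  · simp only [Derivation.commutator_apply, linearField_x, translationField_x, map_zero, sub_zero]
  · rw [Derivation.commutator_apply, linearField_y, translationField_y, translationField_y,
      (isVectorField_linearField c).apply_of_dependsOnX (hb j), linearField_x, zero_mul, zero_sub]
    simp only [map_sum, Derivation.map_smul, translationField_y]

theorem translationField_lie_translationField {b b' : Fin m → 𝒜.carrier}
    (hb : ∀ j, 𝒜.DependsOnX (b j)) (hb' : ∀ j, 𝒜.DependsOnX (b' j)) :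
    ⁅𝒜.translationField b, 𝒜.translationField b'⁆ = 0 := by
  refine ((isVectorField_translationField b).lie (isVectorField_translationField b')).ext
    (by simp [IsVectorField]) ?_ fun j => ?_
  · simp only [Derivation.commutator_apply, translationField_x, map_zero, sub_zero,
      Derivation.zero_apply]
  · rw [Derivation.commutator_apply, translationField_y, translationField_y,
      (isVectorField_translationField b).apply_of_dependsOnX (hb' j),
      (isVectorField_translationField b').apply_of_dependsOnX (hb j), translationField_x,
      translationField_x, zero_mul, zero_mul, sub_zero, Derivation.zero_apply]

namespace CanonicalSystem

open LieAlgebra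

variable {n : ℕ} (𝓔 : 𝒜.CanonicalSystem n)

/-! ### The solution spaces -/

/-- The element of `K u² + K u v + K v²` with coordinates a traceless matrix, such that `v²`, `-u²`
and `2 u v` correspond to the standard basis of `sl₂`; these are the solutions of the symmetric
square of the source equation. -/
def quadratic : SpecialLinear.sl (Fin 2) K →ₗ[K] 𝒜.carrier where
  toFun A := A.1 0 1 • 𝓔.v ^ 2 - A.1 1 0 • 𝓔.u ^ 2 + A.1 0 0 • (2 * 𝓔.u * 𝓔.v)
  map_add' A B := by
    change (A.1 0 1 + B.1 0 1) • 𝓔.v ^ 2 - (A.1 1 0 + B.1 1 0) • 𝓔.u ^ 2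
      + (A.1 0 0 + B.1 0 0) • (2 * 𝓔.u * 𝓔.v) = _
    module
  map_smul' c A := by
    change (c * A.1 0 1) • 𝓔.v ^ 2 - (c * A.1 1 0) • 𝓔.u ^ 2
      + (c * A.1 0 0) • (2 * 𝓔.u * 𝓔.v) = c • _
    module

theorem quadratic_apply (A : SpecialLinear.sl (Fin 2) K) : 𝓔.quadratic A =
    A.1 0 1 • 𝓔.v ^ 2 - A.1 1 0 • 𝓔.u ^ 2 + A.1 0 0 • (2 * 𝓔.u * 𝓔.v) := rfl

theorem quadratic_dependsOnX (A : SpecialLinear.sl (Fin 2) K) : 𝒜.DependsOnX (𝓔.quadratic A) :=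
  (((𝓔.v_dependsOnX.pow 2).smul _).sub ((𝓔.u_dependsOnX.pow 2).smul _)).add
    ((((by exact_mod_cast dependsOnX_natCast (𝒜 := 𝒜) 2 :
      𝒜.DependsOnX (2 : 𝒜.carrier)).mul 𝓔.u_dependsOnX).mul 𝓔.v_dependsOnX).smul _)

theorem dx_quadratic (A : SpecialLinear.sl (Fin 2) K) : 𝒜.dx (𝓔.quadratic A) =
    A.1 0 1 • (2 * 𝓔.v * 𝒜.dx 𝓔.v) - A.1 1 0 • (2 * 𝓔.u * 𝒜.dx 𝓔.u)
      + A.1 0 0 • (2 * (𝒜.dx 𝓔.u * 𝓔.v + 𝓔.u * 𝒜.dx 𝓔.v)) := by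
  have h2 : 𝒜.dx (2 : 𝒜.carrier) = 0 := by exact_mod_cast 𝒜.dx.map_natCast 2
  simp only [quadratic_apply, map_add, map_sub, Derivation.map_smul, Derivation.leibniz_pow,
    Derivation.leibniz, h2, smul_eq_mul, nsmul_eq_mul]
  congr 1
  · congr 1
    · congr 1; push_cast; ring
    · congr 1; push_cast; ring
  · congr 1; ring

theorem two_mul_symSquare [CharZero K] (ξ : 𝒜.carrier) : 2 * 𝓔.symSquare ξ =
    𝒜.dx (𝒜.dx (𝒜.dx ξ)) + 4 * 𝓔.source * 𝒜.dx ξ + 2 * 𝒜.dx 𝓔.source * ξ := by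
  have h := two_mul_half_smul (𝒜.dx ξ)
  have h' := two_mul_half_smul (𝒜.dx (𝒜.dx (𝒜.dx ξ)))
  rw [symSquare, Derivation.map_smul, Derivation.map_smul]
  linear_combination h' + 4 * 𝓔.source * h

theorem symSquare_quadratic [CharZero K] (A : SpecialLinear.sl (Fin 2) K) :
    𝓔.symSquare (𝓔.quadratic A) = 0 := by
  have h2 : 𝒜.dx (2 : 𝒜.carrier) = 0 := by exact_mod_cast 𝒜.dx.map_natCast 2
  refine natCast_mul_eq_zero (k := 2) two_ne_zero ?_
  rw [Nat.cast_ofNat, two_mul_symSquare, dx_quadratic]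
  simp only [quadratic_apply, map_add, map_sub, Derivation.map_smul, Derivation.leibniz, h2,
    smul_eq_mul, 𝓔.dx_dx_u, 𝓔.dx_dx_v, map_neg, mul_zero, add_zero]
  simp only [Algebra.smul_def]
  ring

/-- The symmetric square is the equation `p_3 = 0` for forms of degree two. -/
theorem exists_eq_quadratic [CharZero K] {ξ : 𝒜.carrier} (hξ : 𝒜.DependsOnX ξ)
    (h : 𝓔.symSquare ξ = 0) : ∃ A, ξ = 𝓔.quadratic A := by
  have h2 : 𝒜.dx (2 : 𝒜.carrier) = 0 := by exact_mod_cast 𝒜.dx.map_natCast 2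
  have hf := isForm_formSeq 𝒜.dx 𝓔.source ((2 : ℕ) : ℤ) ξ
  have h3 : formSeq 𝒜.dx 𝓔.source ((2 : ℕ) : ℤ) ξ (2 + 1) = 2 * 𝓔.symSquare ξ := by
    rw [two_mul_symSquare]
    simp only [formSeq, map_add, Derivation.leibniz, smul_eq_mul]
    simp
    linear_combination 𝓔.source * ξ * h2
  have hs := mem_span_of_isForm rfl 𝓔.dx_dx_u rfl 𝓔.dx_dx_v 𝓔.u_dependsOnX 𝓔.v_dependsOnX
    𝓔.wronskian 2 hf (dependsOnX_of_isForm 𝓔.source_dependsOnX hf hξ) (by rw [h3, h, mul_zero])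
  obtain ⟨c, hc⟩ := (Submodule.mem_span_range_iff_exists_fun K).1 hs
  refine ⟨SpecialLinear.finTwoEquiv.symm ![c 2, -c 0, (1 / 2) * c 1], ?_⟩
  have hc' : ξ = ∑ i : Fin 3, c i • (𝓔.u ^ (2 - (i : ℕ)) * 𝓔.v ^ (i : ℕ)) := hc.symm
  rw [hc', Fin.sum_univ_three, quadratic_apply]
  have e : (SpecialLinear.finTwoEquiv.symm ![c 2, -c 0, (1 / 2) * c 1]).1
      = !![(1 / 2) * c 1, c 2; -c 0, -((1 / 2) * c 1)] := rfl
  rw [e]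
  have h1 : ((1 / 2) * c 1) • (2 * 𝓔.u * 𝓔.v) = c 1 • (𝓔.u * 𝓔.v) := by
    rw [mul_comm, mul_smul, mul_assoc, ← mul_smul_comm, two_mul_half_smul]
  simp only [Matrix.of_apply, Matrix.cons_val, h1]
  simp
  abel

/-- The element of `∑ K u^{n-1-k} v^k` with given coordinates; these are the solutions of the
scalar equation. -/
def solution : (Fin n → K) →ₗ[K] 𝒜.carrier :=
  Fintype.linearCombination K fun k : Fin n => 𝓔.u ^ (n - 1 - (k : ℕ)) * 𝓔.v ^ (k : ℕ)

theorem solution_apply (t : Fin n → K) : 𝓔.solution t =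
    ∑ k, t k • (𝓔.u ^ (n - 1 - (k : ℕ)) * 𝓔.v ^ (k : ℕ)) := rfl

/-- The coefficient with index `i` of the form in the functions, as a linear function of its zeroth
coefficient. -/
def formₗ (i : ℕ) : 𝒜.carrier →ₗ[K] 𝒜.carrier where
  toFun f := 𝓔.form f i
  map_add' f g := by
    refine congrFun ((𝓔.isForm_form _).ext (p' := 𝓔.form f + 𝓔.form g) (fun i => ?_)
      (by rw [Pi.add_apply, form_zero, form_zero, form_zero])) i
    simp only [Pi.add_apply, map_add, 𝓔.isForm_form f i, 𝓔.isForm_form g i]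
    ring
  map_smul' c f := by
    refine congrFun ((𝓔.isForm_form _).ext (p' := c • 𝓔.form f) (fun i => ?_)
      (by rw [Pi.smul_apply, form_zero, form_zero])) i
    simp only [Pi.smul_apply, Derivation.map_smul, 𝓔.isForm_form f i, smul_sub, mul_smul_comm]

theorem solution_dependsOnX (t : Fin n → K) : 𝒜.DependsOnX (𝓔.solution t) := fun j => by
  rw [solution_apply, map_sum]
  exact Finset.sum_eq_zero fun k _ =>
    (((𝓔.u_dependsOnX.pow _).mul (𝓔.v_dependsOnX.pow _)).smul (t k)) j

/-- Monomials of degree `n - 1` in `u`, `v` are the zeroth coefficients of forms whose coefficient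
with index `n` vanishes. -/
theorem form_solution (t : Fin n → K) : 𝓔.form (𝓔.solution t) n = 0 := by
  change 𝓔.formₗ n _ = 0
  rw [solution_apply, map_sum]
  refine Finset.sum_eq_zero fun k _ => ?_
  rw [map_smul]
  obtain ⟨p, hp, h0, hn⟩ := IsForm.exists_pow_mul_pow (D := 𝒜.dx) rfl 𝓔.dx_dx_u rfl 𝓔.dx_dx_v
    (n - 1 - (k : ℕ)) (k : ℕ)
  have hd : ((n - 1 - (k : ℕ) + (k : ℕ) : ℕ) : ℤ) = (n : ℤ) - 1 := by omega
  rw [hd] at hp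
  have e := (𝓔.isForm_form _).ext hp ((𝓔.form_zero _).trans h0.symm)
  change t k • 𝓔.form _ n = 0
  rw [e, hn _ (by omega), smul_zero]

theorem exists_eq_solution [CharZero K] (hn : n ≠ 0) {b : 𝒜.carrier} (hb : 𝒜.DependsOnX b)
    (h : 𝓔.form b n = 0) : ∃ t, b = 𝓔.solution t := by
  obtain ⟨N, rfl⟩ : ∃ N, n = N + 1 := ⟨n - 1, by omega⟩
  have hf := 𝓔.isForm_form b
  rw [show (((N + 1 : ℕ) : ℤ) - 1) = (N : ℤ) by push_cast; ring] at hf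
  have hs := mem_span_of_isForm rfl 𝓔.dx_dx_u rfl 𝓔.dx_dx_v 𝓔.u_dependsOnX 𝓔.v_dependsOnX
    𝓔.wronskian N hf (dependsOnX_of_isForm 𝓔.source_dependsOnX hf (by rwa [form_zero])) h
  rw [form_zero] at hs
  obtain ⟨c, hc⟩ := (Submodule.mem_span_range_iff_exists_fun K).1 hs
  exact ⟨c, hc.symm⟩

theorem quadratic_injective [CharZero K] : Function.Injective 𝓔.quadratic := by
  rw [injective_iff_map_eq_zero]
  intro A hA
  have h := eq_zero_of_sum_eq_zero rfl rfl 𝓔.wronskian 2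
    (fun k => if k = 0 then -A.1 1 0 else if k = 1 then 2 * A.1 0 0 else A.1 0 1) (by
      rw [← hA, quadratic_apply, Finset.sum_range_succ, Finset.sum_range_succ,
        Finset.sum_range_succ]
      have e : algebraMap K 𝒜.carrier 2 = 2 := map_ofNat _ 2
      simp [Algebra.smul_def, e]
      ring)
  refine SpecialLinear.finTwoEquiv.injective ?_
  have h0 := h 0 (by omega)
  have h1 := h 1 (by omega)
  have h2 := h 2 (by omega)
  simp at h0 h1 h2
  rw [map_zero]
  funext i
  fin_cases i
  · exact h2
  · exact h0
  · exact h1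

theorem solution_injective [CharZero K] : Function.Injective 𝓔.solution := by
  rw [injective_iff_map_eq_zero]
  intro t ht
  rcases n with _ | N
  · exact Subsingleton.elim _ _
  have h := eq_zero_of_sum_eq_zero rfl rfl 𝓔.wronskian N
    (fun k => if hk : k < N + 1 then t ⟨k, hk⟩ else 0) (by
      rw [← ht, solution_apply, ← Fin.sum_univ_eq_sum_range (fun k =>
        (if hk : k < N + 1 then t ⟨k, hk⟩ else 0) • (𝓔.u ^ (N - k) * 𝓔.v ^ k))]
      refine Finset.sum_congr rfl fun k _ => ?_
      rw [dif_pos k.2]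
      rfl)
  funext k
  have := h k (by omega)
  rwa [dif_pos k.2] at this

end CanonicalSystem

variable (𝒜) in
/-- The action of `so(m)` by rotations. -/
def soHom : LieAlgebra.Orthogonal.so (Fin m) K →ₗ⁅K⁆ Derivation K 𝒜.carrier 𝒜.carrier where
  toFun c := 𝒜.linearField c.1
  map_add' c d := map_add 𝒜.linearField c.1 d.1
  map_smul' a c := map_smul 𝒜.linearField a c.1
  map_lie' {c d} := by
    rw [linearField_lie_linearField, LieAlgebra.Orthogonal.so_bracket]

theorem soHom_apply (c : LieAlgebra.Orthogonal.so (Fin m) K) :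
    𝒜.soHom c = 𝒜.linearField c.1 := rfl

namespace CanonicalSystem

open LieAlgebra

variable {n : ℕ} (𝓔 : 𝒜.CanonicalSystem n)

/-! ### The Lie algebra of divergence symmetries -/

/-- The bracket of `sl₂` is the bracket of vector fields in one variable; the Wronskian identity
turns the quartic expression on the right into a quadratic one. -/
theorem quadratic_lie (A B : SpecialLinear.sl (Fin 2) K) : 𝓔.quadratic ⁅A, B⁆ =
    𝓔.quadratic A * 𝒜.dx (𝓔.quadratic B) - 𝒜.dx (𝓔.quadratic A) * 𝓔.quadratic B := by
  rw [dx_quadratic, dx_quadratic]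
  simp only [quadratic_apply, SpecialLinear.sl_bracket, Matrix.sub_apply, Matrix.mul_apply,
    Fin.sum_univ_two, SpecialLinear.apply_one_one, Algebra.smul_def, map_add, map_sub, map_mul,
    map_neg]
  linear_combination (-(2 * (algebraMap K _ (A.1 0 0) * algebraMap K _ (B.1 0 1)
      - algebraMap K _ (B.1 0 0) * algebraMap K _ (A.1 0 1)) * 𝓔.v ^ 2)
    + 2 * (algebraMap K _ (A.1 1 0) * algebraMap K _ (B.1 0 0)
      - algebraMap K _ (A.1 0 0) * algebraMap K _ (B.1 1 0)) * 𝓔.u ^ 2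
    - (algebraMap K _ (A.1 0 1) * algebraMap K _ (B.1 1 0)
      - algebraMap K _ (B.1 0 1) * algebraMap K _ (A.1 1 0)) * (2 * 𝓔.u * 𝓔.v)) * 𝓔.wronskian

/-- The action of `sl₂` by projective fields. -/
def slHom [CharZero K] :
    SpecialLinear.sl (Fin 2) K →ₗ⁅K⁆ Derivation K 𝒜.carrier 𝒜.carrier where
  toLinearMap := (𝒜.projectiveField n).comp 𝓔.quadratic
  map_lie' {A B} := by
    change 𝒜.projectiveField n (𝓔.quadratic ⁅A, B⁆)
      = ⁅𝒜.projectiveField n (𝓔.quadratic A), 𝒜.projectiveField n (𝓔.quadratic B)⁆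
    rw [projectiveField_lie_projectiveField n (𝓔.quadratic_dependsOnX A)
      (𝓔.quadratic_dependsOnX B), quadratic_lie]

theorem slHom_apply [CharZero K] (A : SpecialLinear.sl (Fin 2) K) :
    𝓔.slHom A = 𝒜.projectiveField n (𝓔.quadratic A) := rfl

/-- The translation by the solutions of the scalar equation with given coordinates: `t (k, j)` is
the coefficient of `u^{n-1-k} v^k ∂/∂y_j`. -/
def solutionField : (Fin n × Fin m → K) →ₗ[K] Derivation K 𝒜.carrier 𝒜.carrier :=
  𝒜.translationField.comp (LinearMap.pi fun j =>
    𝓔.solution.comp (LinearMap.funLeft K K fun k : Fin n => (k, j)))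

theorem solutionField_apply (t : Fin n × Fin m → K) :
    𝓔.solutionField t = 𝒜.translationField fun j => 𝓔.solution fun k => t (k, j) := rfl

theorem exists_eq_solutionField {b : Fin m → 𝒜.carrier}
    (h : ∀ j, b j ∈ LinearMap.range 𝓔.solution) :
    ∃ t, 𝒜.translationField b = 𝓔.solutionField t := by
  choose t ht using h
  refine ⟨fun p => t p.2 p.1, ?_⟩
  rw [solutionField_apply]
  congr 1
  funext j
  exact (ht j).symm

theorem mem_divSymmetries_iff_exists [CharZero K] (hm : 1 ≤ m) (hn : 3 ≤ n) (hev : Even n)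
    {v : Derivation K 𝒜.carrier 𝒜.carrier} : v ∈ 𝓔.divSymmetries ↔
      ∃ A c t, v = 𝓔.slHom A + 𝒜.soHom c + 𝓔.solutionField t := by
  rw [𝓔.mem_divSymmetries_iff hm hn hev]
  constructor
  · rintro ⟨ξ, c, b, ⟨hξ, h⟩, hc, hb, rfl⟩
    obtain ⟨A, rfl⟩ := 𝓔.exists_eq_quadratic hξ h
    obtain ⟨t, ht⟩ := 𝓔.exists_eq_solutionField (b := b) fun j => by
      obtain ⟨t, ht⟩ := 𝓔.exists_eq_solution (by omega) (hb j).1 (hb j).2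
      exact ⟨t, ht.symm⟩
    exact ⟨A, ⟨c, (Orthogonal.mem_so (Fin m) K c).2 hc⟩, t, by rw [ht]; rfl⟩
  · rintro ⟨A, c, t, rfl⟩
    exact ⟨𝓔.quadratic A, c.1, fun j => 𝓔.solution fun k => t (k, j),
      ⟨𝓔.quadratic_dependsOnX A, 𝓔.symSquare_quadratic A⟩,
      (Orthogonal.mem_so (Fin m) K c.1).1 c.2,
      fun j => ⟨𝓔.solution_dependsOnX _, 𝓔.form_solution _⟩, rfl⟩

theorem pow_mul_pow_mem {a b : ℕ} (h : a + b + 1 = n) :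
    𝓔.u ^ a * 𝓔.v ^ b ∈ LinearMap.range 𝓔.solution := by
  refine ⟨Pi.single ⟨b, by omega⟩ 1, ?_⟩
  rw [solution_apply, Finset.sum_eq_single ⟨b, by omega⟩
    (fun k _ hk => by rw [Pi.single_eq_of_ne hk, zero_smul]) (by simp), Pi.single_eq_same, one_smul]
  have e : n - 1 - b = a := by omega
  rw [e]

/-- The action of `sl₂` on binary forms of degree `a + b`: the weighted Lie derivative of a monomial
in `u`, `v` along the quadratic form of `A`. For `a = 0` or `b = 0` the truncated exponents are
multiplied by zero. -/
theorem quadratic_mul_dx_sub [CharZero K] (A : SpecialLinear.sl (Fin 2) K) {a b : ℕ} :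
    𝓔.quadratic A * 𝒜.dx (𝓔.u ^ a * 𝓔.v ^ b)
      - ((a : 𝒜.carrier) + b) * ((1 / 2 : K) • 𝒜.dx (𝓔.quadratic A)) * (𝓔.u ^ a * 𝓔.v ^ b) =
    A.1 0 0 • (((b : K) - a) • (𝓔.u ^ a * 𝓔.v ^ b))
      - A.1 0 1 • ((a : K) • (𝓔.u ^ (a - 1) * 𝓔.v ^ (b + 1)))
      - A.1 1 0 • ((b : K) • (𝓔.u ^ (a + 1) * 𝓔.v ^ (b - 1))) := by
  have h : (1 / 2 : K) • 𝒜.dx (𝓔.quadratic A) = A.1 0 1 • (𝓔.v * 𝒜.dx 𝓔.v)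
      - A.1 1 0 • (𝓔.u * 𝒜.dx 𝓔.u) + A.1 0 0 • (𝒜.dx 𝓔.u * 𝓔.v + 𝓔.u * 𝒜.dx 𝓔.v) := by
    have key := two_mul_half_smul (𝒜.dx (𝓔.quadratic A))
    rw [dx_quadratic] at key ⊢
    rw [← sub_eq_zero]
    refine natCast_mul_eq_zero (k := 2) two_ne_zero ?_
    rw [mul_sub, Nat.cast_ofNat, key]
    simp only [Algebra.smul_def]
    ring
  rw [h]
  simp only [quadratic_apply, Derivation.leibniz, Derivation.leibniz_pow, smul_eq_mul,
    nsmul_eq_mul]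
  simp only [Algebra.smul_def, map_sub, map_natCast]
  have key : ∀ α β γ : 𝒜.carrier, (β * 𝓔.v ^ 2 - γ * 𝓔.u ^ 2 + α * (2 * 𝓔.u * 𝓔.v))
      * (𝓔.u ^ a * (b * (𝓔.v ^ (b - 1) * 𝒜.dx 𝓔.v)) + 𝓔.v ^ b * (a * (𝓔.u ^ (a - 1) * 𝒜.dx 𝓔.u)))
      - (a + b) * (β * (𝓔.v * 𝒜.dx 𝓔.v) - γ * (𝓔.u * 𝒜.dx 𝓔.u)
        + α * (𝒜.dx 𝓔.u * 𝓔.v + 𝓔.u * 𝒜.dx 𝓔.v)) * (𝓔.u ^ a * 𝓔.v ^ b)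
      = α * ((b - a) * (𝓔.u ^ a * 𝓔.v ^ b)) - β * (a * (𝓔.u ^ (a - 1) * 𝓔.v ^ (b + 1)))
        - γ * (b * (𝓔.u ^ (a + 1) * 𝓔.v ^ (b - 1))) := by
    intro α β γ
    rcases a with _ | a <;> rcases b with _ | b <;>
      simp only [Nat.add_sub_cancel, Nat.cast_zero, Nat.cast_succ, Nat.zero_sub]
    · ring
    · linear_combination (α * ((b + 1) * 𝓔.v ^ (b + 1)) - γ * ((b + 1) * (𝓔.u * 𝓔.v ^ b)))
        * 𝓔.wronskian
    · linear_combination (-α * ((a + 1) * 𝓔.u ^ (a + 1)) - β * ((a + 1) * (𝓔.u ^ a * 𝓔.v)))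
        * 𝓔.wronskian
    · linear_combination (α * ((b - a) * (𝓔.u ^ (a + 1) * 𝓔.v ^ (b + 1)))
        - β * ((a + 1) * (𝓔.u ^ a * 𝓔.v ^ (b + 2))) - γ * ((b + 1) * (𝓔.u ^ (a + 2) * 𝓔.v ^ b)))
        * 𝓔.wronskian
  exact key _ _ _

/-- The solutions of the scalar equation are stable under the action of `sl₂`. -/
theorem weighted_mem_range_solution [CharZero K] (A : SpecialLinear.sl (Fin 2) K) {b : 𝒜.carrier}
    (hb : b ∈ LinearMap.range 𝓔.solution) :
    𝓔.quadratic A * 𝒜.dx b - ((n : 𝒜.carrier) - 1) * ((1 / 2 : K) • 𝒜.dx (𝓔.quadratic A)) * b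
      ∈ LinearMap.range 𝓔.solution := by
  obtain ⟨t, rfl⟩ := hb
  rw [solution_apply, map_sum, Finset.mul_sum, Finset.mul_sum, ← Finset.sum_sub_distrib]
  refine Submodule.sum_mem _ fun k _ => ?_
  rw [Derivation.map_smul, mul_smul_comm, mul_smul_comm, ← smul_sub]
  refine Submodule.smul_mem _ _ ?_
  obtain ⟨a, ha⟩ : ∃ a, a = n - 1 - (k : ℕ) := ⟨_, rfl⟩
  have hn : a + k + 1 = n := by omega
  have hn' : (n : 𝒜.carrier) - 1 = a + (k : ℕ) := by
    have h := congrArg (Nat.cast (R := 𝒜.carrier)) hn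
    push_cast at h
    rw [← h]
    ring
  rw [← ha, hn', quadratic_mul_dx_sub]
  refine Submodule.sub_mem _ (Submodule.sub_mem _ (Submodule.smul_mem _ _ (Submodule.smul_mem _ _
    (𝓔.pow_mul_pow_mem hn))) (Submodule.smul_mem _ _ ?_)) (Submodule.smul_mem _ _ ?_)
  · rcases Nat.eq_zero_or_pos a with h0 | h0
    · rw [h0, Nat.cast_zero, zero_smul]
      exact Submodule.zero_mem _
    · exact Submodule.smul_mem _ _ (𝓔.pow_mul_pow_mem (by omega))
  · rcases Nat.eq_zero_or_pos (k : ℕ) with h0 | h0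
    · rw [h0, Nat.cast_zero, zero_smul]
      exact Submodule.zero_mem _
    · exact Submodule.smul_mem _ _ (𝓔.pow_mul_pow_mem (by omega))

theorem slHom_lie_solutionField [CharZero K] (A : SpecialLinear.sl (Fin 2) K)
    (t : Fin n × Fin m → K) : ∃ t', ⁅𝓔.slHom A, 𝓔.solutionField t⁆ = 𝓔.solutionField t' := by
  rw [slHom_apply, solutionField_apply, projectiveField_lie_translationField n
    (𝓔.quadratic_dependsOnX A) fun j => 𝓔.solution_dependsOnX _]
  exact 𝓔.exists_eq_solutionField fun j => 𝓔.weighted_mem_range_solution A ⟨_, rfl⟩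

theorem soHom_lie_solutionField (c : Orthogonal.so (Fin m) K)
    (t : Fin n × Fin m → K) : ∃ t', ⁅𝒜.soHom c, 𝓔.solutionField t⁆ = 𝓔.solutionField t' := by
  rw [soHom_apply, solutionField_apply, linearField_lie_translationField _
    fun j => 𝓔.solution_dependsOnX _]
  exact 𝓔.exists_eq_solutionField fun j => Submodule.neg_mem _ (Submodule.sum_mem _ fun i _ =>
    Submodule.smul_mem _ _ ⟨_, rfl⟩)

theorem solutionField_lie_solutionField (t t' : Fin n × Fin m → K) :
    ⁅𝓔.solutionField t, 𝓔.solutionField t'⁆ = 0 :=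
  translationField_lie_translationField (fun _ => 𝓔.solution_dependsOnX _)
    fun _ => 𝓔.solution_dependsOnX _

theorem slHom_lie_soHom [CharZero K] (A : SpecialLinear.sl (Fin 2) K)
    (c : Orthogonal.so (Fin m) K) : ⁅𝓔.slHom A, 𝒜.soHom c⁆ = 0 :=
  projectiveField_lie_linearField n (𝓔.quadratic_dependsOnX A) _

/-- The sum of the three kinds of symmetries is direct: the first is read off at `x`, the second
from the linear part in `y`. -/
theorem eq_zero_of_add_eq_zero [CharZero K] {A : SpecialLinear.sl (Fin 2) K}
    {c : Orthogonal.so (Fin m) K} {t : Fin n × Fin m → K}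
    (h : 𝓔.slHom A + 𝒜.soHom c + 𝓔.solutionField t = 0) : A = 0 ∧ c = 0 ∧ t = 0 := by
  have hA : A = 0 := by
    have h1 := congrArg (fun w : Derivation K 𝒜.carrier 𝒜.carrier => w 𝒜.x) h
    simp only [Derivation.add_apply, slHom_apply, soHom_apply, solutionField_apply,
      projectiveField_x, linearField_x, translationField_x, add_zero, Derivation.zero_apply] at h1
    exact (map_eq_zero_iff _ 𝓔.quadratic_injective).1 h1
  have h2 : ∀ j, 𝒜.linearField c.1 (𝒜.y j) + 𝓔.solution (fun k => t (k, j)) = 0 := fun j => by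
    have h1 := congrArg (fun w : Derivation K 𝒜.carrier 𝒜.carrier => w (𝒜.y j)) h
    simpa only [hA, map_zero, zero_add, Derivation.add_apply, soHom_apply, solutionField_apply,
      translationField_y, Derivation.zero_apply] using h1
  have hc : c = 0 := by
    refine Subtype.ext (Matrix.ext fun i j => ?_)
    have h3 := congrArg (𝒜.dy i) (h2 j)
    rw [map_add, 𝓔.solution_dependsOnX _ i, linearField_y, map_sum] at h3
    simp only [Derivation.map_smul, 𝒜.dy_y, smul_ite, smul_zero, Finset.sum_ite_eq,
      Finset.mem_univ, if_true, add_zero, map_zero] at h3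
    rw [← Algebra.algebraMap_eq_smul_one] at h3
    exact (map_eq_zero_iff _ (algebraMap K 𝒜.carrier).injective).1 h3
  refine ⟨hA, hc, ?_⟩
  funext ⟨k, j⟩
  have h3 := h2 j
  have h4 : 𝒜.linearField (K := K) (m := m) 0 (𝒜.y j) = 0 := by
    rw [map_zero, Derivation.zero_apply]
  rw [hc] at h3
  have h5 := (congrArg (· + 𝓔.solution (fun k => t (k, j))) h4).symm.trans h3
  rw [zero_add] at h5
  exact congrFun ((map_eq_zero_iff _ 𝓔.solution_injective).1 h5) k

end CanonicalSystem

/-! ### The explicit generators -/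

theorem projectiveField_eq [CharZero K] (n : ℕ) {ξ η : 𝒜.carrier} (h : 2 * η = 𝒜.dx ξ) :
    𝒜.projectiveField n ξ
      = ξ • 𝒜.dx + (((n : 𝒜.carrier) - 1) * η) • ∑ i, 𝒜.y i • 𝒜.dy i := by
  have e : ξ • 𝒜.dx + (((n : 𝒜.carrier) - 1) * η) • ∑ i, 𝒜.y i • 𝒜.dy i
      = 𝒜.vectorField (ξ, fun j => ((n : 𝒜.carrier) - 1) * η * 𝒜.y j) := by
    simp only [vectorField, LinearMap.coe_mk, AddHom.coe_mk, Finset.smul_sum, smul_smul]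
  have h' : (1 / 2 : K) • 𝒜.dx ξ = η := by
    rw [← h, ← mul_smul_comm, two_mul_half_smul]
  rw [e]
  refine (isVectorField_projectiveField n ξ).ext (isVectorField_vectorField _) ?_ fun j => ?_
  · rw [projectiveField_x, vectorField_x]
  · rw [projectiveField_y, vectorField_y, h']

theorem rotation_eq (i j : Fin m) :
    𝒜.rotation i j = 𝒜.soHom (LieAlgebra.Orthogonal.rot K i j) := by
  have e : 𝒜.rotation i j
      = 𝒜.vectorField (0, Pi.single j (𝒜.y i) - Pi.single i (𝒜.y j)) := by
    refine Derivation.ext fun f => ?_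
    simp [vectorField_apply, rotation, sub_mul, Finset.sum_sub_distrib, Pi.single_apply]
  rw [e]
  refine (isVectorField_vectorField _).ext (isVectorField_linearField _) ?_ fun k => ?_
  · rw [vectorField_x, soHom_apply, linearField_x]
  · rw [vectorField_y, soHom_apply, linearField_y, LieAlgebra.Orthogonal.rot]
    simp [Matrix.single_apply, sub_smul, Finset.sum_sub_distrib, ite_and, Pi.single_apply, eq_comm]

theorem range_soHom [CharZero K] : LinearMap.range 𝒜.soHom.toLinearMap =
    Submodule.span K (Set.range fun p : Fin m × Fin m => 𝒜.rotation p.1 p.2) := by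
  refine le_antisymm ?_ (Submodule.span_le.2 ?_)
  · rintro _ ⟨c, rfl⟩
    -- both triangles are summed, whence the factor
    have hc : c = (1 / 2 : K) • ∑ i, ∑ j, c.1 i j • LieAlgebra.Orthogonal.rot K i j := by
      refine Subtype.ext (Matrix.ext fun k l => ?_)
      have h := LieAlgebra.Orthogonal.so_apply c k l
      let f : LieAlgebra.Orthogonal.so (Fin m) K →ₗ[K] K :=
        { toFun := fun d => d.1 k l, map_add' := fun _ _ => rfl, map_smul' := fun _ _ => rfl }
      have e : ∀ d : LieAlgebra.Orthogonal.so (Fin m) K, d.1 k l = f d := fun _ => rfl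
      rw [e ((1 / 2 : K) • _)]
      simp only [map_smul, map_sum]
      simp only [← e, LieAlgebra.Orthogonal.rot, Matrix.sub_apply, Matrix.single_apply, smul_eq_mul,
        mul_sub, Finset.sum_sub_distrib, ite_and, mul_ite, mul_one, mul_zero, Finset.sum_ite_eq',
        Finset.mem_univ, if_true, Finset.sum_ite_irrel, Finset.sum_const_zero]
      rw [h]
      ring
    rw [hc]
    simp only [map_smul, map_sum]
    exact Submodule.smul_mem _ _ (Submodule.sum_mem _ fun i _ => Submodule.sum_mem _ fun j _ =>
      Submodule.smul_mem _ _ (Submodule.subset_span ⟨(i, j), rotation_eq i j⟩))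
  · rintro _ ⟨p, rfl⟩
    exact ⟨_, (rotation_eq p.1 p.2).symm⟩

namespace CanonicalSystem

open LieAlgebra

variable {n : ℕ} (𝓔 : 𝒜.CanonicalSystem n)

theorem Fp_eq [CharZero K] : 𝓔.Fp = 𝒜.projectiveField n (𝓔.v ^ 2) :=
  (projectiveField_eq n (η := 𝓔.v * 𝒜.dx 𝓔.v) (by simp [Derivation.leibniz_pow])).symm

theorem Fm_eq [CharZero K] : 𝓔.Fm = -𝒜.projectiveField n (𝓔.u ^ 2) := by
  rw [projectiveField_eq n (η := 𝓔.u * 𝒜.dx 𝓔.u) (by simp [Derivation.leibniz_pow]), Fm,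
    neg_add, sub_eq_add_neg]

theorem Fz_eq [CharZero K] : 𝓔.Fz = 𝒜.projectiveField n (2 * 𝓔.u * 𝓔.v) := by
  have h2 : 𝒜.dx (2 : 𝒜.carrier) = 0 := by exact_mod_cast 𝒜.dx.map_natCast 2
  exact (projectiveField_eq n (η := 𝓔.u * 𝒜.dx 𝓔.v + 𝒜.dx 𝓔.u * 𝓔.v)
    (by simp only [Derivation.leibniz, smul_eq_mul, h2]; ring)).symm

theorem slHom_eq [CharZero K] (A : SpecialLinear.sl (Fin 2) K) :
    𝓔.slHom A = A.1 0 1 • 𝓔.Fp + A.1 1 0 • 𝓔.Fm + A.1 0 0 • 𝓔.Fz := by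
  rw [Fp_eq, Fm_eq, Fz_eq, slHom_apply, quadratic_apply, map_add, map_sub, map_smul, map_smul,
    map_smul, smul_neg, sub_eq_add_neg]

theorem range_slHom [CharZero K] : LinearMap.range 𝓔.slHom.toLinearMap =
    Submodule.span K {𝓔.Fp, 𝓔.Fm, 𝓔.Fz} := by
  have key : ∀ c : Fin 3 → K, 𝓔.slHom (SpecialLinear.finTwoEquiv.symm c)
      = c 0 • 𝓔.Fp + c 1 • 𝓔.Fm + c 2 • 𝓔.Fz := fun c => 𝓔.slHom_eq _
  ext w
  rw [Submodule.mem_span_triple]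
  constructor
  · rintro ⟨A, rfl⟩
    exact ⟨_, _, _, (𝓔.slHom_eq A).symm⟩
  · rintro ⟨a, b, c, rfl⟩
    exact ⟨_, key ![a, b, c]⟩

theorem solutionField_single (k : Fin n) (j : Fin m) :
    𝓔.solutionField (Pi.single (k, j) 1) = 𝓔.Skj k j := by
  have e : 𝓔.Skj k j = 𝒜.translationField
      (Pi.single j (𝓔.u ^ (n - 1 - (k : ℕ)) * 𝓔.v ^ (k : ℕ))) := by
    refine Derivation.ext fun f => ?_
    change _ = 𝒜.vectorField (0, _) f
    simp [vectorField_apply, Skj, Pi.single_apply]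
  rw [e, solutionField_apply]
  congr 1
  funext i
  rw [solution_apply]
  simp [Pi.single_apply, ite_and, Prod.ext_iff]

theorem range_solutionField : LinearMap.range 𝓔.solutionField =
    Submodule.span K (Set.range fun p : Fin n × Fin m => 𝓔.Skj p.1 p.2) := by
  have h : 𝓔.solutionField = Fintype.linearCombination K
      fun p : Fin n × Fin m => 𝓔.Skj p.1 p.2 := by
    refine LinearMap.pi_ext' fun p => LinearMap.ext_ring ?_
    rw [LinearMap.comp_apply, LinearMap.comp_apply, LinearMap.single_apply]
    refine (𝓔.solutionField_single p.1 p.2).trans ?_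
    rw [Fintype.linearCombination_apply_single, one_smul]
  rw [h, Fintype.range_linearCombination]

/-! ### The semidirect sum -/

/-- The divergence symmetries as a Lie subalgebra of the derivations. That they are closed under the
bracket is read off from their explicit description. -/
def divLieSubalgebra [CharZero K] (hm : 1 ≤ m) (hn : 3 ≤ n) (hev : Even n) :
    LieSubalgebra K (Derivation K 𝒜.carrier 𝒜.carrier) where
  toSubmodule := 𝓔.divSymmetries
  lie_mem' {v w} hv hw := by
    have hmem := fun v => 𝓔.mem_divSymmetries_iff_exists hm hn hev (v := v)
    have h1 : ∀ A, 𝓔.slHom A ∈ 𝓔.divSymmetries := fun A =>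
      (hmem _).2 ⟨A, 0, 0, by rw [map_zero, map_zero, add_zero, add_zero]⟩
    have h2 : ∀ c, 𝒜.soHom c ∈ 𝓔.divSymmetries := fun c =>
      (hmem _).2 ⟨0, c, 0, by rw [map_zero, map_zero, add_zero, zero_add]⟩
    have h3 : ∀ t, 𝓔.solutionField t ∈ 𝓔.divSymmetries := fun t =>
      (hmem _).2 ⟨0, 0, t, by rw [map_zero, map_zero, zero_add, zero_add]⟩
    have h13 : ∀ A t, ⁅𝓔.slHom A, 𝓔.solutionField t⁆ ∈ 𝓔.divSymmetries := fun A t => by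
      obtain ⟨t', ht⟩ := 𝓔.slHom_lie_solutionField A t
      exact ht ▸ h3 t'
    have h23 : ∀ c t, ⁅𝒜.soHom c, 𝓔.solutionField t⁆ ∈ 𝓔.divSymmetries := fun c t => by
      obtain ⟨t', ht⟩ := 𝓔.soHom_lie_solutionField c t
      exact ht ▸ h3 t'
    obtain ⟨A, c, t, rfl⟩ := (hmem v).1 hv
    obtain ⟨B, d, s, rfl⟩ := (hmem w).1 hw
    change _ ∈ 𝓔.divSymmetries
    rw [add_lie, add_lie, lie_add, lie_add, lie_add, lie_add, lie_add, lie_add, ← LieHom.map_lie,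
      ← LieHom.map_lie, 𝓔.slHom_lie_soHom, 𝓔.solutionField_lie_solutionField,
      ← lie_skew (𝒜.soHom c) (𝓔.slHom B), 𝓔.slHom_lie_soHom,
      ← lie_skew (𝓔.solutionField t) (𝓔.slHom B), ← lie_skew (𝓔.solutionField t) (𝒜.soHom d)]
    have hz := 𝓔.divSymmetries.zero_mem
    have hz' := 𝓔.divSymmetries.neg_mem hz
    have hadd := fun {v w} => 𝓔.divSymmetries.add_mem (x := v) (y := w)
    exact hadd (hadd (hadd (hadd (h1 _) hz) (h13 _ _)) (hadd (hadd hz' (h2 _)) (h23 _ _)))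
      (hadd (hadd (𝓔.divSymmetries.neg_mem (h13 _ _)) (𝓔.divSymmetries.neg_mem (h23 _ _))) hz)

variable [CharZero K] (hm : 1 ≤ m) (hn : 3 ≤ n) (hev : Even n)

/-- The embedding of `sl₂ × so(m)` as the fields without translation part. -/
def leviHom : (SpecialLinear.sl (Fin 2) K × Orthogonal.so (Fin m) K) →ₗ⁅K⁆
    𝓔.divLieSubalgebra hm hn hev where
  toFun p := ⟨𝓔.slHom p.1 + 𝒜.soHom p.2, (𝓔.mem_divSymmetries_iff_exists hm hn hev).2
    ⟨p.1, p.2, 0, by rw [map_zero, add_zero]⟩⟩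
  map_add' p q := Subtype.ext (by
    change 𝓔.slHom (p.1 + q.1) + 𝒜.soHom (p.2 + q.2) =
      𝓔.slHom p.1 + 𝒜.soHom p.2 + (𝓔.slHom q.1 + 𝒜.soHom q.2)
    rw [map_add, map_add]
    abel)
  map_smul' a p := Subtype.ext (by
    change 𝓔.slHom (a • p.1) + 𝒜.soHom (a • p.2) = a • (𝓔.slHom p.1 + 𝒜.soHom p.2)
    rw [map_smul, map_smul, smul_add])
  map_lie' {p q} := Subtype.ext (by
    change 𝓔.slHom ⁅p.1, q.1⁆ + 𝒜.soHom ⁅p.2, q.2⁆ =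
      ⁅𝓔.slHom p.1 + 𝒜.soHom p.2, 𝓔.slHom q.1 + 𝒜.soHom q.2⁆
    rw [add_lie, lie_add, lie_add, 𝓔.slHom_lie_soHom, ← lie_skew (𝒜.soHom p.2),
      𝓔.slHom_lie_soHom, LieHom.map_lie, LieHom.map_lie, neg_zero, add_zero, zero_add])

/-- The embedding of the translations by solutions of the scalar equation; `t (k, j)` is the
coefficient of `u^{n-1-k} v^k ∂/∂y_j`. -/
def solutionMap : (Fin n × Fin m → K) →ₗ[K] 𝓔.divLieSubalgebra hm hn hev where
  toFun t := ⟨𝓔.solutionField t, (𝓔.mem_divSymmetries_iff_exists hm hn hev).2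
    ⟨0, 0, t, by rw [map_zero, map_zero, zero_add, zero_add]⟩⟩
  map_add' t s := Subtype.ext (map_add 𝓔.solutionField t s)
  map_smul' a t := Subtype.ext (map_smul 𝓔.solutionField a t)

theorem exists_leviHom_add_solutionMap (w : 𝓔.divLieSubalgebra hm hn hev) :
    ∃ p t, w = 𝓔.leviHom hm hn hev p + 𝓔.solutionMap hm hn hev t := by
  obtain ⟨A, c, t, h⟩ := (𝓔.mem_divSymmetries_iff_exists hm hn hev).1 w.2
  exact ⟨(A, c), t, Subtype.ext h⟩

theorem eq_zero_of_leviHom_add_solutionMap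
    {p : SpecialLinear.sl (Fin 2) K × Orthogonal.so (Fin m) K} {t : Fin n × Fin m → K}
    (h : 𝓔.leviHom hm hn hev p + 𝓔.solutionMap hm hn hev t = 0) : p = 0 ∧ t = 0 := by
  obtain ⟨h1, h2, h3⟩ := 𝓔.eq_zero_of_add_eq_zero (A := p.1) (c := p.2) (congrArg Subtype.val h)
  exact ⟨Prod.ext h1 h2, h3⟩

theorem leviHom_injective : Function.Injective (𝓔.leviHom hm hn hev) := by
  rw [injective_iff_map_eq_zero]
  intro p hp
  exact (𝓔.eq_zero_of_leviHom_add_solutionMap hm hn hev (t := 0)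
    (by rw [hp, map_zero, add_zero])).1

/-- The underlying vector space of the Lie algebra of divergence symmetries is
`sl₂ × so(m) × K^{nm}`. -/
def divEquiv : ((SpecialLinear.sl (Fin 2) K × Orthogonal.so (Fin m) K) × (Fin n × Fin m → K)) ≃ₗ[K]
    𝓔.divLieSubalgebra hm hn hev :=
  LinearEquiv.ofBijective ((𝓔.leviHom hm hn hev : _ →ₗ[K] _).coprod (𝓔.solutionMap hm hn hev)) (by
    constructor
    · rw [injective_iff_map_eq_zero]
      intro p hp
      obtain ⟨h1, h2⟩ := 𝓔.eq_zero_of_leviHom_add_solutionMap hm hn hev (p := p.1) (t := p.2) hp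
      exact Prod.ext h1 h2
    · intro w
      obtain ⟨p, t, rfl⟩ := 𝓔.exists_leviHom_add_solutionMap hm hn hev w
      exact ⟨(p, t), rfl⟩)

/-- The ideal of the translations by solutions. -/
def solutionIdeal : LieIdeal K (𝓔.divLieSubalgebra hm hn hev) where
  toSubmodule := LinearMap.range (𝓔.solutionMap hm hn hev)
  lie_mem := by
    rintro w _ ⟨t, rfl⟩
    obtain ⟨A, c, s, h⟩ := (𝓔.mem_divSymmetries_iff_exists hm hn hev).1 w.2
    obtain ⟨t1, h1⟩ := 𝓔.slHom_lie_solutionField A t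
    obtain ⟨t2, h2⟩ := 𝓔.soHom_lie_solutionField c t
    refine ⟨t1 + t2, Subtype.ext ?_⟩
    change 𝓔.solutionField (t1 + t2) = ⁅w.1, 𝓔.solutionField t⁆
    rw [h, add_lie, add_lie, h1, h2, 𝓔.solutionField_lie_solutionField, map_add, add_zero]

instance isLieAbelian_solutionIdeal : IsLieAbelian (𝓔.solutionIdeal hm hn hev) := by
  refine ⟨?_⟩
  rintro ⟨_, t, rfl⟩ ⟨_, s, rfl⟩
  exact Subtype.ext (Subtype.ext (𝓔.solutionField_lie_solutionField t s))

theorem isCompl_leviHom_solutionIdeal : IsCompl (𝓔.leviHom hm hn hev).range.toSubmodule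
    (𝓔.solutionIdeal hm hn hev).toSubmodule := by
  constructor
  · rw [Submodule.disjoint_def]
    rintro _ ⟨p, rfl⟩ ⟨t, ht⟩
    change 𝓔.solutionMap hm hn hev t = 𝓔.leviHom hm hn hev p at ht
    have h := (𝓔.eq_zero_of_leviHom_add_solutionMap hm hn hev (p := p) (t := -t)
      (by rw [map_neg, ht, add_neg_cancel])).1
    change 𝓔.leviHom hm hn hev p = 0
    rw [h, map_zero]
  · rw [codisjoint_iff, eq_top_iff]
    intro w _
    obtain ⟨p, t, rfl⟩ := 𝓔.exists_leviHom_add_solutionMap hm hn hev w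
    exact Submodule.add_mem_sup ⟨p, rfl⟩ ⟨t, rfl⟩

end CanonicalSystem

end FunctionAlgebra

/-! ### Dimensions -/

theorem LieAlgebra.SpecialLinear.finrank_fin_two (K : Type*) [Field K] :
    Module.finrank K (LieAlgebra.SpecialLinear.sl (Fin 2) K) = 3 := by
  rw [LieAlgebra.SpecialLinear.finTwoEquiv.finrank_eq, Module.finrank_fin_fun]

theorem LieAlgebra.Orthogonal.finrank_so_mul_two (K : Type*) [Field K] [CharZero K] (m : ℕ) :
    Module.finrank K (LieAlgebra.Orthogonal.so (Fin m) K) * 2 = m * (m - 1) := by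
  rw [LieAlgebra.Orthogonal.soEquiv.finrank_eq, Module.finrank_fintype_fun_eq_card,
    Fintype.card_sigma]
  have h : ∀ i : Fin m, Fintype.card {j // j < i} = (i : ℕ) := fun i => by
    rw [Fintype.card_subtype, Finset.filter_gt_eq_Iio, Fin.card_Iio]
  simp only [h]
  rw [Fin.sum_univ_eq_sum_range (fun i => i), Finset.sum_range_id_mul_two]

end
theorem theorem2 {K : Type u} [Field K] [CharZero K] {m n : ℕ} (hm : 1 ≤ m) (hn : 3 ≤ n)
    (hev : Even n) (𝒜 : FunctionAlgebra K m) (h𝒜 : 𝒜.IsStandard) (𝓔 : 𝒜.CanonicalSystem n) :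
    -- the divergence symmetries form a Lie algebra `𝔖`
    ∃ 𝔖 : LieSubalgebra K (Derivation K 𝒜.carrier 𝒜.carrier),
      (∀ v, v ∈ 𝔖 ↔ 𝓔.IsDivergenceSymmetry v) ∧
      -- of dimension `(m² + m (2n - 1) + 6) / 2`
      (Module.Finite K 𝔖 ∧
        (Module.finrank K 𝔖 : ℚ) = 1 / 2 * ((m : ℚ) ^ 2 + m * (2 * n - 1) + 6)) ∧
      -- with subalgebras `𝔤_F`, `𝔰𝔬(m)`, `𝔩 = 𝔤_F ⊕ 𝔰𝔬(m)` and an ideal `𝔤_S`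
      ∃ (𝔤F 𝔰𝔬m 𝔩 : LieSubalgebra K 𝔖) (𝔤S : LieIdeal K 𝔖),
        𝔤F.toSubmodule.map 𝔖.toSubmodule.subtype = Submodule.span K {𝓔.Fp, 𝓔.Fm, 𝓔.Fz} ∧
        Nonempty (𝔤F ≃ₗ⁅K⁆ LieAlgebra.SpecialLinear.sl (Fin 2) K) ∧
        𝔰𝔬m.toSubmodule.map 𝔖.toSubmodule.subtype
          = Submodule.span K (Set.range fun p : Fin m × Fin m => 𝒜.rotation p.1 p.2) ∧
        Nonempty (𝔰𝔬m ≃ₗ⁅K⁆ LieAlgebra.Orthogonal.so (Fin m) K) ∧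
        𝔤S.toSubmodule.map 𝔖.toSubmodule.subtype
          = Submodule.span K (Set.range fun p : Fin n × Fin m => 𝓔.Skj p.1 p.2) ∧
        IsLieAbelian 𝔤S ∧
        -- `𝔩` is the direct sum of the commuting subalgebras `𝔤_F` and `𝔰𝔬(m)`
        𝔩.toSubmodule = 𝔤F.toSubmodule ⊔ 𝔰𝔬m.toSubmodule ∧
        Disjoint 𝔤F.toSubmodule 𝔰𝔬m.toSubmodule ∧
        (∀ a ∈ 𝔤F, ∀ b ∈ 𝔰𝔬m, ⁅a, b⁆ = 0) ∧
        -- `𝔖` is the semidirect sum of the subalgebra `𝔩` and the ideal `𝔤_S`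
        IsCompl 𝔩.toSubmodule 𝔤S.toSubmodule ∧
        -- this is a Levi decomposition (`𝔰𝔬(2)` being abelian, `m = 2` is excluded here)
        (m ≠ 2 → LieAlgebra.IsSemisimple K 𝔩 ∧ LieAlgebra.radical K 𝔖 = 𝔤S) := by
  have hinj := 𝓔.leviHom_injective hm hn hev
  have hfinS : Module.Finite K (𝓔.divLieSubalgebra hm hn hev) :=
    Module.Finite.equiv (𝓔.divEquiv hm hn hev)
  refine ⟨𝓔.divLieSubalgebra hm hn hev, fun v => Iff.rfl, ⟨hfinS, ?_⟩,
    ((𝓔.leviHom hm hn hev).comp (LieHom.inl K _ _)).range,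
    ((𝓔.leviHom hm hn hev).comp (LieHom.inr K _ _)).range, (𝓔.leviHom hm hn hev).range,
    𝓔.solutionIdeal hm hn hev, ?_, ?_, ?_, ?_, ?_, inferInstance, ?_, ?_, ?_,
    𝓔.isCompl_leviHom_solutionIdeal hm hn hev, fun hm2 => ?_⟩
  · rw [← (𝓔.divEquiv hm hn hev).finrank_eq, Module.finrank_prod, Module.finrank_prod,
      LieAlgebra.SpecialLinear.finrank_fin_two, Module.finrank_fintype_fun_eq_card,
      Fintype.card_prod, Fintype.card_fin, Fintype.card_fin]
    have h := congrArg (Nat.cast (R := ℚ)) (LieAlgebra.Orthogonal.finrank_so_mul_two K m)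
    rw [Nat.cast_mul, Nat.cast_mul, Nat.cast_sub hm] at h
    push_cast at h ⊢
    linarith
  · rw [← 𝓔.range_slHom, LieHom.range_toSubmodule, ← LinearMap.range_comp]
    congr 1
    refine LinearMap.ext fun A => ?_
    change 𝓔.slHom A + 𝒜.soHom 0 = 𝓔.slHom A
    rw [map_zero, add_zero]
  · exact ⟨(LieEquiv.ofInjective ((𝓔.leviHom hm hn hev).comp (LieHom.inl K _ _))
      (hinj.comp (LieHom.inl_injective (R := K)))).symm⟩
  · rw [← 𝒜.range_soHom, LieHom.range_toSubmodule, ← LinearMap.range_comp]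
    congr 1
    refine LinearMap.ext fun c => ?_
    change 𝓔.slHom 0 + 𝒜.soHom c = 𝒜.soHom c
    rw [map_zero, zero_add]
  · exact ⟨(LieEquiv.ofInjective ((𝓔.leviHom hm hn hev).comp (LieHom.inr K _ _))
      (hinj.comp (LieHom.inr_injective (R := K)))).symm⟩
  · rw [← 𝓔.range_solutionField]
    change (LinearMap.range (𝓔.solutionMap hm hn hev)).map _ = _
    rw [← LinearMap.range_comp]
    rfl
  · refine le_antisymm ?_ (sup_le ?_ ?_)
    · rintro _ ⟨p, rfl⟩
      have hp : p = LieHom.inl K _ _ p.1 + LieHom.inr K _ _ p.2 := by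
        simp [LieHom.inl_apply, LieHom.inr_apply]
      rw [hp]
      refine Submodule.mem_sup.2 ⟨_, ⟨p.1, rfl⟩, _, ⟨p.2, rfl⟩, ?_⟩
      exact (map_add (𝓔.leviHom hm hn hev) _ _).symm
    · rintro _ ⟨A, rfl⟩
      exact ⟨_, rfl⟩
    · rintro _ ⟨c, rfl⟩
      exact ⟨_, rfl⟩
  · rw [Submodule.disjoint_def]
    rintro _ ⟨A, rfl⟩ ⟨c, hc⟩
    have h := hinj hc
    have h1 : A = 0 := (congrArg Prod.fst h).symm
    rw [h1]
    exact map_zero _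
  · rintro _ ⟨A, rfl⟩ _ ⟨c, rfl⟩
    refine ((𝓔.leviHom hm hn hev).map_lie _ _).symm.trans ?_
    have h : ⁅LieHom.inl K (LieAlgebra.SpecialLinear.sl (Fin 2) K)
          (LieAlgebra.Orthogonal.so (Fin m) K) A,
        LieHom.inr K (LieAlgebra.SpecialLinear.sl (Fin 2) K)
          (LieAlgebra.Orthogonal.so (Fin m) K) c⁆ = 0 := by
      simp [LieHom.inl_apply, LieHom.inr_apply]
    exact (congrArg _ h).trans (map_zero _)
  · have := LieAlgebra.Orthogonal.hasTrivialRadical (K := K) (ι := Fin m)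
      (by rwa [Fintype.card_fin])
    exact ⟨LieAlgebra.isSemisimple_of_equiv (LieEquiv.ofInjective _ hinj),
      LieAlgebra.radical_eq_of_isCompl_range _ hinj _ (𝓔.isCompl_leviHom_solutionIdeal hm hn hev)⟩
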